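/- **Definitions.** Let $B$ be a unital $*$-algebra represented faithfully on a separable Hilbert space $H$ by bounded operators. Write $[\cdot,\cdot]$ for commutators and $\{\cdot,\cdot\}$ for anticommutators; a grading is a self-adjoint operator with square $1$. A relation between unbounded operators includes the corresponding statements on domains: a bounded operator occurring in a (anti)commutator with $S$ preserves $\mathrm{dom}\,S$; $S^2=0$ means $S(\mathrm{dom}\,S)\subseteq\ker S$; and $\{S,S'\}=0$ means that $SS'+S'S$, with its natural domain, is densely defined and zero. * $(B,H,D,\gamma)$ is a set of $N=1$ *spectral data* (a $\Theta$-summable even spectral triple) if $D$ is self-adjoint, $[D,a]$ is bounded for all $a\in B$, $e^{-\varepsilon D^2}$ is trace class for all $\varepsilon>0$, and $\gamma$ is a grading with $[\gamma,a]=0$ $(a\in B)$ and $\{\gamma,D\}=0$. * $(B,H,d,\gamma,\star)$ is a set of $N=(1,1)$ *spectral data* if $d$ is closed and densely defined, $d^2=0$, $[d,a]$ is bounded for all $a\in B$, $e^{-\varepsilon(dd^*+d^*d)}$ is trace class for all $\varepsilon>0$, $\gamma$ is a grading with $[\gamma,a]=0$ $(a\in B)$ and $\{\gamma,d\}=0$,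 and $\star$ is a unitary with $[\star,a]=0$ $(a\in B)$ and $\star d=\zeta d^*\star$ for some phase $\zeta$. * $(B,H,\partial,\bar\partial,T,\bar T,\gamma,\star)$ is a set of $N=(2,2)$ *Kähler spectral data* over $B$ (a *Kähler structure*) if $\partial,\bar\partial$ are closed and densely defined, $T,\bar T$ are bounded self-adjoint, $(B,H,\overline{\partial+\bar\partial},\gamma,\star)$ is a set of $N=(1,1)$ spectral data (the bar over the sum denoting closure), and (i) $\partial^2=\bar\partial^2=\{\partial,\bar\partial\}=0$, $[T,\bar T]=0$, $[T,\partial]=\partial$, $[T,\bar\partial]=[\bar T,\partial]=0$, $[\bar T,\bar\partial]=\bar\partial$; (ii) $[T,a]=[\bar T,a]=0$, and $[\partial,a]$, $[\bar\partial,a]$, $\{\partial,[\bar\partial,a]\}$ extend to bounded operators, for all $a\in B$; (iii) $\{\gamma,\partial\}=\{\gamma,\bar\partial\}=0$ and $[\gamma,T]=[\gamma,\bar T]=0$; (iv) $\star\partial=\zeta\bar\partial^{*}\star$ and $\star\bar\partial=\zeta\partial^*\star$ for some phase $\zeta$; (v) $\{\partial,\bar\partial^*\}=\{\bar\partial,\partial^*\}=0$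 and $\{\partial,\partial^*\}=\{\bar\partial,\bar\partial^*\}$. **Theorem.** Let $G$ be a connected abelian real Lie group of dimension $2k$, let $\mathcal A\neq 0$ be a unital $C^*$-algebra with a strongly continuous action $\alpha$ of $G$ by $*$-automorphisms, and let $\tau$ be a faithful $G$-invariant (finite, positive) trace on $\mathcal A$. Let $\mathcal A^\infty$ be the $*$-subalgebra of those $a\in\mathcal A$ for which $g\mapsto\alpha_g(a)$ is $C^\infty$, let $X_1,\dots,X_{2k}$ be a basis of the Lie algebra of $G$, and let $\partial_j(a)=\frac{d}{dt}\big|_{t=0}\alpha_{\exp(tX_j)}(a)$ for $a\in\mathcal A^\infty$. Let $N=2^k$ and let $\gamma_1,\dots,\gamma_{2k},\sigma\in M_N(\mathbb C)$ satisfy $\gamma_j^*=-\gamma_j$, $\gamma_j\gamma_l+\gamma_l\gamma_j=-2\delta_{jl}$, $\sigma^*=\sigma$, $\sigma^2=1$, $\sigma\gamma_j=-\gamma_j\sigma$. Suppose that $\mathcal A^\infty$ (acting by left multiplication), $L^2(\mathcal A,\tau)\otimes\mathbb C^N$, the closure $D$ of $\sum_j\partial_j\otimes\gamma_j$ on $\mathcal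 A^\infty\otimes\mathbb C^N$, and the grading $1\otimes\sigma$ form a $\Theta$-summable even spectral triple. For either sign $s\in\{1,-1\}$ let $d$ be the closure of $\frac12(\mathfrak D-i\overline{\mathfrak D})$ on $\mathcal A^\infty\otimes\mathbb C^N\otimes\mathbb C^N$, where $\mathfrak D=\sum_j\partial_j\otimes 1\otimes\gamma_j$ and $\overline{\mathfrak D}=-s\sum_j\partial_j\otimes\gamma_j\otimes\sigma$ (here $\overline{\mathfrak D}$ is a second operator, not the closure of $\mathfrak D$). Then there are at least $$M=\prod_{\substack{1\le j\le 2k\\ j\ \mathrm{odd}}}(2k-j)$$ pairwise different $N=(2,2)$ Kähler structures $(\mathcal A^\infty,H,\partial_m,\bar\partial_m,T_m,\bar T_m,\gamma,\star)$, $m=1,\dots,M$, over $\mathcal A^\infty$ on the Hilbert space $H=L^2(\mathcal A,\tau)\otimes\mathbb C^N\otimes\mathbb C^N$, all with grading $\gamma=1\otimes\sigma\otimes\sigma$, Hodge operator $\star=1\otimes1\otimes\sigma$ and $\overline{\partial_m+\bar\partial_m}=d$. They can be chosen so that, if moreover the action $\alpha$ is not trivial, the operators $\partial_1,\dots,\partial_M$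 are pairwise different. The number $M$ is the number of perfect matchings of $\{1,\dots,2k\}$. -/

import Mathlib

open scoped Manifold ContDiff ComplexOrder Kronecker InnerProductSpace

noncomputable section

/-! ### Unbounded operators on a Hilbert space -/

section Unbounded

variable {H : Type*} [NormedAddCommGroup H] [InnerProductSpace ℂ H] [CompleteSpace H]

/-- The product `S T` of two unbounded operators, on its natural domain
`{x ∈ dom T | T x ∈ dom S}`. -/
def opMul (S T : H →ₗ.[ℂ] H) : H →ₗ.[ℂ] H :=
  S.comp (T.domRestrict ((S.domain.comap T.toFun).map T.domain.subtype)) (by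
    rintro ⟨x, hx⟩
    obtain ⟨⟨y, hy, rfl⟩, -⟩ := hx
    exact hy)

/-- The anticommutator `{S, T} = S T + T S`, on its natural domain. -/
def opAnti (S T : H →ₗ.[ℂ] H) : H →ₗ.[ℂ] H := opMul S T + opMul T S

/-- `{S, T} = 0`: the operator `S T + T S` is densely defined and vanishes on its domain. -/
def AnticommuteZero (S T : H →ₗ.[ℂ] H) : Prop :=
  Dense ((opAnti S T).domain : Set H) ∧ ∀ x : (opAnti S T).domain, opAnti S T x = 0

/-- `T² = 0`: the operator `T` maps its domain into its kernel. -/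
def SquareZero (T : H →ₗ.[ℂ] H) : Prop := ∀ x : T.domain, (T x, (0 : H)) ∈ T.graph

/-- For a bounded `B`: `B` preserves the domain of `T`, and the commutator `[T, B]`, defined on
`dom T`, is the restriction of the bounded operator `C`. -/
def CommutatorExtends (T : H →ₗ.[ℂ] H) (B C : H →L[ℂ] H) : Prop :=
  ∀ x : T.domain, (B x, B (T x) + C x) ∈ T.graph

/-- For a bounded `B`: `B` preserves the domain of `T`, and the anticommutator `{T, B}`, defined
on `dom T`, is the restriction of the bounded operator `C`. -/
def AnticommutatorExtends (T : H →ₗ.[ℂ] H) (B C : H →L[ℂ] H) : Prop :=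
  ∀ x : T.domain, (B x, C x - B (T x)) ∈ T.graph

/-- `[B, T] = c T` for a bounded `B`, an unbounded `T` and a scalar `c`. -/
def CommutatorEqSmul (B : H →L[ℂ] H) (T : H →ₗ.[ℂ] H) (c : ℂ) : Prop :=
  ∀ x : T.domain, (B x, B (T x) - c • T x) ∈ T.graph

/-- `U S = ζ T U` for a unitary `U`, unbounded `S`, `T` and a phase `ζ`, including the equality of
the domains (`conj ζ` is the inverse of the phase `ζ`). -/
def Intertwines (U : H →L[ℂ] H) (S T : H →ₗ.[ℂ] H) (ζ : ℂ) : Prop :=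
  ∀ x y : H, (x, y) ∈ S.graph ↔ (U x, (starRingEnd ℂ) ζ • U y) ∈ T.graph

/-- A `ℤ/2`-grading operator: a self-adjoint bounded operator with square `1`. -/
def IsGrading (g : H →L[ℂ] H) : Prop := IsSelfAdjoint g ∧ g * g = 1

/-- A bounded operator on a Hilbert space is of trace class if it is nuclear, i.e. an absolutely
convergent sum of operators of rank at most one. -/
def IsTraceClass (T : H →L[ℂ] H) : Prop :=
  ∃ u v : ℕ → H, Summable (fun n => ‖u n‖ * ‖v n‖) ∧
    ∀ z : H, HasSum (fun n => ⟪u n, z⟫_ℂ • v n) (T z)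

/-- `S t = exp (-t L)`, `t ≥ 0`: the strongly continuous one-parameter semigroup `S` has
infinitesimal generator `-L` (with equality of domains). -/
structure IsHeatSemigroup (L : H →ₗ.[ℂ] H) (S : ℝ → H →L[ℂ] H) : Prop where
  map_zero : S 0 = 1
  map_add : ∀ s t : ℝ, 0 ≤ s → 0 ≤ t → S (s + t) = S s * S t
  continuousOn : ∀ x : H, ContinuousOn (fun t => S t x) (Set.Ici 0)
  generator : ∀ x y : H, (x, y) ∈ L.graph ↔
    Filter.Tendsto (fun t : ℝ => t⁻¹ • (x - S t x)) (nhdsWithin 0 (Set.Ioi 0)) (nhds y)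

/-- `exp (-ε L)` is of trace class for all `ε > 0`. -/
def HeatTraceClass (L : H →ₗ.[ℂ] H) : Prop :=
  ∃ S : ℝ → H →L[ℂ] H, IsHeatSemigroup L S ∧ ∀ ε : ℝ, 0 < ε → IsTraceClass (S ε)

end Unbounded

/-! ### Spectral data -/

section SpectralData

variable {B : Type*} [Ring B] [StarRing B] [Algebra ℂ B]
variable {H : Type*} [NormedAddCommGroup H] [InnerProductSpace ℂ H] [CompleteSpace H]

/-- `(B, H, D, g)` is a set of `N = 1` spectral data, i.e. a `Θ`-summable even spectral triple,
where the unital `*`-algebra `B` is represented on `H` by `π`. -/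
structure IsN1SpectralData (π : B →⋆ₐ[ℂ] (H →L[ℂ] H)) (D : H →ₗ.[ℂ] H) (g : H →L[ℂ] H) :
    Prop where
  separable : TopologicalSpace.SeparableSpace H
  faithful : Function.Injective π
  selfAdjoint : IsSelfAdjoint D
  commutator : ∀ a : B, ∃ C : H →L[ℂ] H, CommutatorExtends D (π a) C
  traceClass : HeatTraceClass (opMul D D)
  grading : IsGrading g
  grading_comm : ∀ a : B, Commute g (π a)
  grading_anti : AnticommutatorExtends D g 0

/-- `(B, H, d, g, hodge)` is a set of `N = (1,1)` spectral data, where the unital `*`-algebra `B`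
is represented on `H` by `π`. -/
structure IsN11SpectralData (π : B →⋆ₐ[ℂ] (H →L[ℂ] H)) (d : H →ₗ.[ℂ] H)
    (g hodge : H →L[ℂ] H) : Prop where
  separable : TopologicalSpace.SeparableSpace H
  faithful : Function.Injective π
  dense : Dense (d.domain : Set H)
  closed : d.IsClosed
  sq_zero : SquareZero d
  commutator : ∀ a : B, ∃ C : H →L[ℂ] H, CommutatorExtends d (π a) C
  traceClass : HeatTraceClass (opAnti d d.adjoint)
  grading : IsGrading g
  grading_comm : ∀ a : B, Commute g (π a)
  grading_anti : AnticommutatorExtends d g 0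
  hodge_unitary : hodge ∈ unitary (H →L[ℂ] H)
  hodge_intertwines : ∃ ζ : ℂ, ‖ζ‖ = 1 ∧ Intertwines hodge d d.adjoint ζ
  hodge_comm : ∀ a : B, Commute hodge (π a)

/-- A set of `N = (2,2)` Kähler spectral data `(B, H, del, delbar, T, Tbar, grading, hodge)` over
the unital `*`-algebra `B` represented on `H` by `π`. The operator `del + delbar` of the underlying
`N = (1,1)` data is understood as the closure of the sum defined on `dom del ∩ dom delbar`. -/
@[ext] structure KahlerSpectralData (π : B →⋆ₐ[ℂ] (H →L[ℂ] H)) where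
  del : H →ₗ.[ℂ] H
  delbar : H →ₗ.[ℂ] H
  T : H →L[ℂ] H
  Tbar : H →L[ℂ] H
  grading : H →L[ℂ] H
  hodge : H →L[ℂ] H
  isN11 : IsN11SpectralData π (del + delbar).closure grading hodge
  T_selfAdjoint : IsSelfAdjoint T
  Tbar_selfAdjoint : IsSelfAdjoint Tbar
  del_dense : Dense (del.domain : Set H)
  delbar_dense : Dense (delbar.domain : Set H)
  del_closed : del.IsClosed
  delbar_closed : delbar.IsClosed
  del_sq : SquareZero del
  delbar_sq : SquareZero delbar
  del_delbar : AnticommuteZero del delbar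
  T_Tbar : Commute T Tbar
  T_del : CommutatorEqSmul T del 1
  T_delbar : CommutatorEqSmul T delbar 0
  Tbar_del : CommutatorEqSmul Tbar del 0
  Tbar_delbar : CommutatorEqSmul Tbar delbar 1
  T_comm : ∀ a : B, Commute T (π a)
  Tbar_comm : ∀ a : B, Commute Tbar (π a)
  del_commutator : ∀ a : B, ∃ C : H →L[ℂ] H, CommutatorExtends del (π a) C
  delbar_commutator : ∀ a : B, ∃ C : H →L[ℂ] H, CommutatorExtends delbar (π a) C ∧
    ∃ C' : H →L[ℂ] H, AnticommutatorExtends del C C'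
  grading_del : AnticommutatorExtends del grading 0
  grading_delbar : AnticommutatorExtends delbar grading 0
  grading_T : Commute grading T
  grading_Tbar : Commute grading Tbar
  hodge_intertwines : ∃ ζ : ℂ, ‖ζ‖ = 1 ∧ Intertwines hodge del delbar.adjoint ζ ∧
    Intertwines hodge delbar del.adjoint ζ
  kahler_del : AnticommuteZero del delbar.adjoint
  kahler_delbar : AnticommuteZero delbar del.adjoint
  kahler_laplacian : opAnti del del.adjoint = opAnti delbar delbar.adjoint

/-- The differential `del + delbar` (closed) of the underlying `N = (1,1)` spectral data. -/
def KahlerSpectralData.d {π : B →⋆ₐ[ℂ] (H →L[ℂ] H)} (K : KahlerSpectralData π) : H →ₗ.[ℂ] H :=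
  (K.del + K.delbar).closure

end SpectralData

/-! ### Matrices and diagonal operators on `L ⊗ ℂ^ι` -/

section Amplification

variable {ι : Type*} [Fintype ι]
variable {L : Type*} [NormedAddCommGroup L] [InnerProductSpace ℂ L]

/-- The operator `1 ⊗ m` on the Hilbert space `L ⊗ ℂ^ι = ⨁_ι L`. -/
def matOp (m : Matrix ι ι ℂ) :
    PiLp 2 (fun _ : ι => L) →L[ℂ] PiLp 2 (fun _ : ι => L) :=
  ((PiLp.continuousLinearEquiv 2 ℂ (fun _ : ι => L)).symm : (ι → L) →L[ℂ] _) ∘L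
    (ContinuousLinearMap.pi fun i => ∑ j, m i j • ContinuousLinearMap.proj j) ∘L
    ((PiLp.continuousLinearEquiv 2 ℂ (fun _ : ι => L)) : _ →L[ℂ] (ι → L))

/-- The operator `b ⊗ 1` on the Hilbert space `L ⊗ ℂ^ι = ⨁_ι L`. -/
def diagOp (ι : Type*) [Fintype ι] (b : L →L[ℂ] L) :
    PiLp 2 (fun _ : ι => L) →L[ℂ] PiLp 2 (fun _ : ι => L) :=
  ((PiLp.continuousLinearEquiv 2 ℂ (fun _ : ι => L)).symm : (ι → L) →L[ℂ] _) ∘L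
    (ContinuousLinearMap.pi fun i => b ∘L ContinuousLinearMap.proj i) ∘L
    ((PiLp.continuousLinearEquiv 2 ℂ (fun _ : ι => L)) : _ →L[ℂ] (ι → L))

@[simp] theorem matOp_apply (m : Matrix ι ι ℂ) (x : PiLp 2 (fun _ : ι => L)) (i : ι) :
    matOp m x i = ∑ j, m i j • x j := by
  simp [matOp]

@[simp] theorem diagOp_apply (b : L →L[ℂ] L) (x : PiLp 2 (fun _ : ι => L)) (i : ι) :
    diagOp ι b x i = b (x i) := by
  simp [diagOp]

/-- `b ↦ b ⊗ 1` as a `*`-homomorphism. -/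
def diagHom (ι : Type*) [Fintype ι] (L : Type*) [NormedAddCommGroup L] [InnerProductSpace ℂ L]
    [CompleteSpace L] :
    (L →L[ℂ] L) →⋆ₐ[ℂ] (PiLp 2 (fun _ : ι => L) →L[ℂ] PiLp 2 (fun _ : ι => L)) where
  toFun b := diagOp ι b
  map_one' := by ext x i; simp
  map_mul' a b := by ext x i; simp
  map_zero' := by ext x i; simp
  map_add' a b := by ext x i; simp
  commutes' r := by ext x i; simp [Algebra.algebraMap_eq_smul_one]
  map_star' b := by
    rw [ContinuousLinearMap.star_eq_adjoint, ContinuousLinearMap.star_eq_adjoint,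
      ContinuousLinearMap.eq_adjoint_iff]
    intro x y
    simp [PiLp.inner_apply, ContinuousLinearMap.adjoint_inner_left]

end Amplification

/-! ### `C*`-dynamical systems -/

/-- A `C*`-dynamical system `(A, G, α)`, with a unital `C*`-algebra `A`, a real Lie group `G`
and a strongly continuous action `α`, together with a faithful `G`-invariant (positive, finite)
trace `τ`. -/
structure CStarDynamicalSystem (G A : Type*) [Group G] [TopologicalSpace G] [CStarAlgebra A]
    [PartialOrder A] [StarOrderedRing A] where
  α : G →* (A ≃⋆ₐ[ℂ] A)
  continuous_orbit : ∀ a : A, Continuous fun g => α g a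
  τ : A →ₚ[ℂ] ℂ
  tracial : ∀ a b : A, τ (a * b) = τ (b * a)
  faithful : ∀ a : A, τ (star a * a) = 0 → a = 0
  invariant : ∀ (g : G) (a : A), τ (α g a) = τ a

namespace CStarDynamicalSystem

variable {E : Type*} [NormedAddCommGroup E] [NormedSpace ℝ E]
variable {G : Type*} [CommGroup G] [TopologicalSpace G] [ChartedSpace E G]
variable {A : Type*} [CStarAlgebra A] [PartialOrder A] [StarOrderedRing A]
variable (S : CStarDynamicalSystem G A)

/-- The smooth subalgebra `A^∞` of all `a` such that `g ↦ α_g a` is of class `C^∞`. -/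
def smooth (E : Type*) [NormedAddCommGroup E] [NormedSpace ℝ E] {G : Type*} [CommGroup G]
    [TopologicalSpace G] [ChartedSpace E G] {A : Type*} [CStarAlgebra A] [PartialOrder A]
    [StarOrderedRing A] (S : CStarDynamicalSystem G A) : StarSubalgebra ℂ A where
  carrier := {a | ContMDiff 𝓘(ℝ, E) 𝓘(ℝ, A) ∞ fun g => S.α g a}
  mul_mem' {a b} ha hb := by
    have h := (contDiff_mul (𝕜 := ℝ) (𝔸 := A) (n := ∞)).contMDiff.comp (ha.prodMk_space hb)
    simpa [Function.comp_def] using h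
  add_mem' {a b} ha hb := by
    have h := (contDiff_add (𝕜 := ℝ) (F := A) (n := ∞)).contMDiff.comp (ha.prodMk_space hb)
    simpa [Function.comp_def] using h
  algebraMap_mem' r := by
    have : (fun g => S.α g (algebraMap ℂ A r)) = fun _ => algebraMap ℂ A r := by
      funext g; exact AlgHomClass.commutes (S.α g) r
    change ContMDiff 𝓘(ℝ, E) 𝓘(ℝ, A) ∞ fun g => S.α g (algebraMap ℂ A r)
    rw [this]
    exact contMDiff_const
  star_mem' {a} ha := by
    have h := ((starL' ℝ : A ≃L[ℝ] A).contDiff (n := ∞)).contMDiff.comp ha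
    simpa [Function.comp_def, map_star] using h

theorem hasMFDerivAt_orbit (a : S.smooth E) :
    HasMFDerivAt 𝓘(ℝ, E) 𝓘(ℝ, A) (fun g => S.α g (a : A)) 1
      (mfderiv 𝓘(ℝ, E) 𝓘(ℝ, A) (fun g => S.α g (a : A)) 1) := by
  have ha : ContMDiff 𝓘(ℝ, E) 𝓘(ℝ, A) ∞ fun g => S.α g (a : A) := a.2
  exact (ha.mdifferentiable (by simp) 1).hasMFDerivAt

/-- The derivation `∂_X` of `A^∞` attached to `X` in the Lie algebra of `G`: the derivative of the
orbit map `g ↦ α_g a` at the identity in the direction `X`, that is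
`∂_X a = d/dt α_{exp (t X)} a` at `t = 0`. -/
def derivation (X : GroupLieAlgebra 𝓘(ℝ, E) G) : S.smooth E →ₗ[ℂ] A where
  toFun a := mfderiv 𝓘(ℝ, E) 𝓘(ℝ, A) (fun g => S.α g (a : A)) 1 X
  map_add' a b := by
    have h := (S.hasMFDerivAt_orbit a).add (S.hasMFDerivAt_orbit b)
    have e : (fun g => S.α g ((a + b : S.smooth E) : A)) =
        (fun g => S.α g (a : A)) + fun g => S.α g (b : A) := by
      funext g; simp
    rw [e, h.mfderiv]
    rfl
  map_smul' c a := by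
    have h := (((c • ContinuousLinearMap.id ℝ A : A →L[ℝ] A).hasMFDerivAt
      (x := S.α 1 (a : A))).comp (1 : G) (S.hasMFDerivAt_orbit a))
    have e : (fun g => S.α g ((c • a : S.smooth E) : A)) =
        (c • ContinuousLinearMap.id ℝ A : A →L[ℝ] A) ∘ fun g => S.α g (a : A) := by
      funext g; simp
    rw [e, h.mfderiv]
    rfl

/-- The embedding of `A` into the GNS Hilbert space `L²(A, τ)`, with `⟪a, b⟫ = τ (a* b)`. -/
def toL2 : A →ₗ[ℂ] S.τ.GNS :=
  (UniformSpace.Completion.toComplₗᵢ (𝕜 := ℂ) (E := S.τ.PreGNS)).toLinearMap ∘ₗ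
    S.τ.toPreGNS.toLinearMap

theorem toL2_injective : Function.Injective S.toL2 := by
  rw [injective_iff_map_eq_zero]
  intro a ha
  have h0 : ‖S.τ.toPreGNS a‖ = 0 := by
    rw [← UniformSpace.Completion.norm_coe (S.τ.toPreGNS a)]
    exact norm_eq_zero.2 ha
  have h1 := S.τ.preGNS_norm_sq (S.τ.toPreGNS a)
  rw [h0] at h1
  exact S.faithful a (by simpa using h1.symm)

/-- The Hilbert space `L²(A, τ) ⊗ ℂ^ι`. -/
abbrev hilbert (ι : Type*) [Fintype ι] : Type _ := PiLp 2 (fun _ : ι => S.τ.GNS)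

/-- The representation of `A^∞` on `L²(A, τ) ⊗ ℂ^ι` by left multiplication. -/
def rep (E : Type*) [NormedAddCommGroup E] [NormedSpace ℝ E] {G : Type*} [CommGroup G]
    [TopologicalSpace G] [ChartedSpace E G] {A : Type*} [CStarAlgebra A] [PartialOrder A]
    [StarOrderedRing A] (S : CStarDynamicalSystem G A) (ι : Type*) [Fintype ι] :
    S.smooth E →⋆ₐ[ℂ] (S.hilbert ι →L[ℂ] S.hilbert ι) :=
  ((diagHom ι S.τ.GNS).comp S.τ.gnsStarAlgHom).comp (S.smooth E).subtype

/-- The embedding of `A^∞ ⊗ ℂ^ι` into `L²(A, τ) ⊗ ℂ^ι`. -/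
def core (E : Type*) [NormedAddCommGroup E] [NormedSpace ℝ E] {G : Type*} [CommGroup G]
    [TopologicalSpace G] [ChartedSpace E G] {A : Type*} [CStarAlgebra A] [PartialOrder A]
    [StarOrderedRing A] (S : CStarDynamicalSystem G A) (ι : Type*) [Fintype ι] :
    (ι → S.smooth E) →ₗ[ℂ] S.hilbert ι :=
  (WithLp.linearEquiv 2 ℂ (ι → S.τ.GNS)).symm.toLinearMap ∘ₗ
    LinearMap.pi fun i => S.toL2 ∘ₗ (S.smooth E).subtype.toLinearMap ∘ₗ LinearMap.proj i

theorem core_injective (ι : Type*) [Fintype ι] : Function.Injective (S.core E ι) := by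
  intro x y h
  funext i
  have hi : S.toL2 (x i : A) = S.toL2 (y i : A) :=
    congrArg (fun z : S.hilbert ι => z i) h
  exact Subtype.ext (S.toL2_injective hi)

/-- The operator `∑_r ∂_r ⊗ m_r` with domain `A^∞ ⊗ ℂ^ι`, where `∂_r` is the derivation attached
to `X_r`. -/
def firstOrder {ι : Type*} [Fintype ι] {n : ℕ} (X : Fin n → GroupLieAlgebra 𝓘(ℝ, E) G)
    (m : Fin n → Matrix ι ι ℂ) : S.hilbert ι →ₗ.[ℂ] S.hilbert ι where
  domain := LinearMap.range (S.core E ι)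
  toFun :=
    ((WithLp.linearEquiv 2 ℂ (ι → S.τ.GNS)).symm.toLinearMap ∘ₗ
      (LinearMap.pi fun i => ∑ r, ∑ j,
        m r i j • (S.toL2 ∘ₗ S.derivation (X r) ∘ₗ LinearMap.proj j))) ∘ₗ
      (LinearEquiv.ofInjective (S.core E ι) (S.core_injective ι)).symm.toLinearMap

variable {n : ℕ} {ν : Type*} [Fintype ν] [DecidableEq ν]

/-- The Dirac operator `D = ∑_r ∂_r ⊗ γ_r` on `L²(A, τ) ⊗ ℂ^ν` (the closure of the operator on
`A^∞ ⊗ ℂ^ν`). -/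
def dirac (X : Fin n → GroupLieAlgebra 𝓘(ℝ, E) G) (γ : Fin n → Matrix ν ν ℂ) :
    S.hilbert ν →ₗ.[ℂ] S.hilbert ν :=
  (S.firstOrder X γ).closure

/-- The differential `d = (𝔇 - i 𝔇') / 2` on `L²(A, τ) ⊗ ℂ^ν ⊗ ℂ^ν` (the closure of the operator
on `A^∞ ⊗ ℂ^ν ⊗ ℂ^ν`), where
`𝔇 = ∑_r ∂_r ⊗ 1 ⊗ γ_r` and `𝔇' = - s ∑_r ∂_r ⊗ γ_r ⊗ σ`. -/
def differential (X : Fin n → GroupLieAlgebra 𝓘(ℝ, E) G) (γ : Fin n → Matrix ν ν ℂ)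
    (σ : Matrix ν ν ℂ) (s : ℂ) : S.hilbert (ν × ν) →ₗ.[ℂ] S.hilbert (ν × ν) :=
  (S.firstOrder X fun r =>
    (1 / 2 : ℂ) • (((1 : Matrix ν ν ℂ) ⊗ₖ γ r) - Complex.I • (-s • (γ r ⊗ₖ σ)))).closure

end CStarDynamicalSystem

/-- Matrices `γ_1, …, γ_n` generating a representation of the Clifford algebra by skew-adjoint
matrices, with a grading operator `σ`. -/
structure IsGradedClifford {n : ℕ} {ν : Type*} [Fintype ν] [DecidableEq ν]
    (γ : Fin n → Matrix ν ν ℂ) (σ : Matrix ν ν ℂ) : Prop where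
  skew : ∀ j, (γ j).conjTranspose = -γ j
  clifford : ∀ j l, γ j * γ l + γ l * γ j = if j = l then (-2 : ℂ) • 1 else 0
  grading_selfAdjoint : σ.conjTranspose = σ
  grading_sq : σ * σ = 1
  grading_anti : ∀ j, σ * γ j = -(γ j * σ)

end

set_option linter.unusedSectionVars false

noncomputable section

/-! ### Graphs of unbounded operators -/

section Graphs

variable {H : Type*} [NormedAddCommGroup H] [InnerProductSpace ℂ H] [CompleteSpace H]

/-! The proof diagonalises everything and then does linear algebra. Since `G` is abelian and `τ` is
invariant, the unitaries `U g` on the GNS space implementing the action commute with each other and,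
amplified, with `D`. The trace class hypothesis makes `(1 + D²)⁻¹` compact, so its eigenspaces for
nonzero eigenvalues are finite dimensional and the `U g` have a total set of joint eigenvectors
(`eq_zero_of_forall_eigenvector`). On the joint eigenspace of `χ` the derivation `∂_r` acts as an
imaginary scalar `i w_r(χ)` (`exists_weight`). Hence `∑ ∂_r ⊗ m_r` becomes multiplication, block by
block, by the matrix `∑ i w_r(χ) m_r`. Because `D` is self-adjoint and its symbol has square `|w|²`,
the graph norm of `D` controls every single `∂_r`; therefore the smooth vectors are a core for each
of these maximal multiplication operators (`mem_closure_gradient`, `closure_firstOrder`). All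
operator identities, including those on domains, reduce to matrix identities.

The coefficient matrices `a_r` of `d` satisfy the canonical anticommutation relations
(`isFermionic`). An orthogonal complex structure on `ℝ^{2k}` is encoded by a Hermitian projection
`P` with `Pᵀ = 1 - P`. It splits `d` into `∂`, with coefficients `∑_l P_{lr} a_l`, and `∂̄`, with
`Pᵀ` in place of `P`; `T` and `T̄` are the second quantizations of `P` and `Pᵀ`. The mixed Kähler
relations follow from `P Pᵀ = Pᵀ P = 0`. The two Laplacians agree because a real vector satisfies
`w·Pw = w·Pᵀw = |w|²/2`.

For the count, no specific family indexed by matchings is needed. If `k ≥ 2` there are arbitrarily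
many such `P` taking distinct values on a prescribed nonzero vector, and if `k ≤ 1` then `M = 1`.
Different `P` give different `T`. For a nontrivial action the prescribed vector is a nonzero weight
occurring in the GNS space, so that the `∂` differ as well. The number of matchings is computed
separately as the number of permutations of cycle type `2^k`. -/

theorem mem_graph_opMul {S T : H →ₗ.[ℂ] H} {x z : H} :
    (x, z) ∈ (opMul S T).graph ↔ ∃ y, (x, y) ∈ T.graph ∧ (y, z) ∈ S.graph := by
  simp only [LinearPMap.mem_graph_iff]
  constructor
  · rintro ⟨w, rfl, rfl⟩
    obtain ⟨w, ⟨u, hu, rfl⟩, hw⟩ := w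
    exact ⟨T u, ⟨u, rfl, rfl⟩, ⟨T u, hu⟩, rfl, rfl⟩
  · rintro ⟨_, ⟨u, rfl, rfl⟩, v, hv, rfl⟩
    have hu : T u ∈ S.domain := hv ▸ v.2
    have hm : (u : H) ∈ (opMul S T).domain := ⟨⟨u, hu, rfl⟩, u.2⟩
    refine ⟨⟨u, hm⟩, rfl, ?_⟩
    have : v = ⟨T u, hu⟩ := Subtype.ext hv
    rw [this]
    rfl

theorem mem_graph_add {S T : H →ₗ.[ℂ] H} {x z : H} :
    (x, z) ∈ (S + T).graph ↔ ∃ y y', (x, y) ∈ S.graph ∧ (x, y') ∈ T.graph ∧ y + y' = z := by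
  simp only [LinearPMap.mem_graph_iff]
  constructor
  · rintro ⟨w, rfl, rfl⟩
    exact ⟨_, _, ⟨⟨w, w.2.1⟩, rfl, rfl⟩, ⟨⟨w, w.2.2⟩, rfl, rfl⟩, (LinearPMap.add_apply _ _ _).symm⟩
  · rintro ⟨_, _, ⟨u, rfl, rfl⟩, ⟨v, hv, rfl⟩, rfl⟩
    have hm : (u : H) ∈ (S + T).domain := ⟨u.2, hv ▸ v.2⟩
    refine ⟨⟨u, hm⟩, rfl, ?_⟩
    rw [LinearPMap.add_apply]
    have : v = ⟨u, hv ▸ v.2⟩ := Subtype.ext hv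
    rw [this]

theorem mem_graph_opAnti {S T : H →ₗ.[ℂ] H} {x z : H} :
    (x, z) ∈ (opAnti S T).graph ↔ ∃ u v w w', (x, u) ∈ T.graph ∧ (u, w) ∈ S.graph ∧
      (x, v) ∈ S.graph ∧ (v, w') ∈ T.graph ∧ w + w' = z := by
  rw [opAnti, mem_graph_add]
  simp only [mem_graph_opMul]
  constructor
  · rintro ⟨w, w', ⟨u, hu, hw⟩, ⟨v, hv, hw'⟩, h⟩
    exact ⟨u, v, w, w', hu, hw, hv, hw', h⟩
  · rintro ⟨u, v, w, w', hu, hw, hv, hw', h⟩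
    exact ⟨w, w', ⟨u, hu, hw⟩, ⟨v, hv, hw'⟩, h⟩

theorem LinearPMap.eq_of_mem_graph_iff {S T : H →ₗ.[ℂ] H}
    (h : ∀ x y, (x, y) ∈ S.graph ↔ (x, y) ∈ T.graph) : S = T :=
  LinearPMap.eq_of_eq_graph (Submodule.ext fun p => h p.1 p.2)

theorem LinearPMap.mem_adjoint_graph_iff {T : H →ₗ.[ℂ] H} (hT : Dense (T.domain : Set H))
    {x y : H} : (x, y) ∈ T.adjoint.graph ↔ ∀ a b, (a, b) ∈ T.graph → ⟪b, x⟫_ℂ = ⟪a, y⟫_ℂ := by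
  rw [LinearPMap.adjoint_graph_eq_graph_adjoint hT, Submodule.mem_adjoint_iff]
  simp only [sub_eq_zero]

end Graphs

/-! ### Resolutions of the identity and multiplication operators -/

section Resolution

variable {κ H : Type*} [NormedAddCommGroup H] [InnerProductSpace ℂ H] [CompleteSpace H]

/-- A family of mutually orthogonal projections with sum `1` (in the strong sense). -/
structure IsResolution (Q : κ → H →L[ℂ] H) : Prop where
  inner_left : ∀ χ x y, ⟪Q χ x, y⟫_ℂ = ⟪x, Q χ y⟫_ℂ
  idem : ∀ χ x, Q χ (Q χ x) = Q χ x
  ortho : ∀ χ ψ x, χ ≠ ψ → Q χ (Q ψ x) = 0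
  hasSum : ∀ x, HasSum (fun χ => Q χ x) x

/-- The operator acting as `c χ` on the range of the projection `Q χ`, with its maximal domain. -/
def multOp (Q c : κ → H →L[ℂ] H) : H →ₗ.[ℂ] H :=
  Submodule.toLinearPMap
    (⨅ χ, LinearMap.eqLocus ((Q χ).toLinearMap ∘ₗ LinearMap.snd ℂ H H)
      ((c χ).toLinearMap ∘ₗ (Q χ).toLinearMap ∘ₗ LinearMap.fst ℂ H H))

namespace IsResolution

variable {Q : κ → H →L[ℂ] H} (hQ : IsResolution Q) {c c' : κ → H →L[ℂ] H}

include hQ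

theorem ext {x y : H} (h : ∀ χ, Q χ x = Q χ y) : x = y :=
  (hQ.hasSum x).unique (by simpa only [h] using hQ.hasSum y)

theorem hasSum_inner (x y : H) : HasSum (fun χ => ⟪Q χ x, Q χ y⟫_ℂ) ⟪x, y⟫_ℂ := by
  have h := (hQ.hasSum y).mapL (innerSL ℂ x)
  simpa [hQ.inner_left, hQ.idem] using h

theorem hasSum_norm_sq (x : H) : HasSum (fun χ => ‖Q χ x‖ ^ 2) (‖x‖ ^ 2) := by
  have h := Complex.hasSum_re (hQ.hasSum_inner x x)
  simpa [inner_self_eq_norm_sq_to_K, ← Complex.ofReal_pow] using h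

theorem norm_le_norm {x y : H} (h : ∀ χ, ‖Q χ x‖ ≤ ‖Q χ y‖) : ‖x‖ ≤ ‖y‖ := by
  refine le_of_sq_le_sq ?_ (norm_nonneg y)
  exact hasSum_le (fun χ => by gcongr; exact h χ) (hQ.hasSum_norm_sq x) (hQ.hasSum_norm_sq y)

/-- The ranges of the `Q χ` are mutually orthogonal, so square summability already gives convergence
of `∑ y χ`. This is the tool for showing that a vector lies in the domain of a product. -/
theorem exists_of_summable {y : κ → H} (hy : ∀ χ, Q χ (y χ) = y χ)
    (hs : Summable fun χ => ‖y χ‖ ^ 2) : ∃ w, ∀ χ, Q χ w = y χ := by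
  have hV : OrthogonalFamily ℂ (fun χ => LinearMap.range (Q χ).toLinearMap)
      fun χ => (LinearMap.range (Q χ).toLinearMap).subtypeₗᵢ := by
    rintro χ ψ hne ⟨_, x, rfl⟩ ⟨_, z, rfl⟩
    change ⟪Q χ x, Q ψ z⟫_ℂ = 0
    rw [hQ.inner_left, hQ.ortho _ _ _ hne, inner_zero_right]
  have h := (hV.summable_iff_norm_sq_summable fun χ => ⟨y χ, y χ, hy χ⟩).2 (by simpa using hs)
  obtain ⟨w, hw⟩ := h
  refine ⟨w, fun χ => ?_⟩
  have h1 := hw.mapL (Q χ)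
  refine h1.unique ?_
  classical
  have h3 := hasSum_single (f := fun ψ => Q χ (y ψ)) χ (fun ψ h => by
    change Q χ (y ψ) = 0
    rw [← hy ψ, hQ.ortho _ _ _ (Ne.symm h)])
  simpa [hy] using h3

/-- The submodule defining `multOp` is the graph of a function only because a vector is determined
by its components; without a resolution `Submodule.toLinearPMap` would return a default value. -/
theorem mem_graph {x y : H} :
    (x, y) ∈ (multOp Q c).graph ↔ ∀ χ, Q χ y = c χ (Q χ x) := by
  rw [multOp, Submodule.toLinearPMap_graph_eq]
  · simp [Submodule.mem_iInf, LinearMap.mem_eqLocus]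
  · rintro ⟨x, y⟩ h (rfl : x = 0)
    simp only [Submodule.mem_iInf, LinearMap.mem_eqLocus] at h
    exact hQ.ext fun χ => by simpa using h χ

theorem multOp_isClosed : (multOp Q c).IsClosed := by
  have : ((multOp Q c).graph : Set (H × H)) =
      ⋂ χ, {p : H × H | Q χ p.2 = c χ (Q χ p.1)} := by
    ext ⟨x, y⟩
    simp [hQ.mem_graph]
  rw [LinearPMap.IsClosed, this]
  exact isClosed_iInter fun χ => isClosed_eq (by fun_prop) (by fun_prop)

theorem dense_of_forall_mem {V : Submodule ℂ H} (h : ∀ χ x, Q χ x ∈ V) : Dense (V : Set H) := by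
  intro x
  exact mem_closure_of_tendsto (hQ.hasSum x) (.of_forall fun s => V.sum_mem fun χ _ => h χ x)

variable (hc : ∀ χ x, Q χ (c χ x) = c χ (Q χ x))

include hc

theorem component_mem_graph (χ : κ) (x : H) : (Q χ x, c χ (Q χ x)) ∈ (multOp Q c).graph := by
  rw [hQ.mem_graph]
  intro ψ
  by_cases h : ψ = χ
  · subst h; rw [hc, hQ.idem]
  · rw [← hc, hQ.ortho _ _ _ h, hQ.ortho _ _ _ h, map_zero]

theorem multOp_dense : Dense ((multOp Q c).domain : Set H) :=
  hQ.dense_of_forall_mem fun χ x =>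
    LinearPMap.mem_domain_iff.2 ⟨_, hQ.component_mem_graph hc χ x⟩

omit hc in
theorem inner_multiplier (h : ∀ χ x y, ⟪c χ x, y⟫_ℂ = ⟪x, c' χ y⟫_ℂ) {x y a b : H}
    (hab : (a, b) ∈ (multOp Q c).graph) (hxy : (x, y) ∈ (multOp Q c').graph) :
    ⟪b, x⟫_ℂ = ⟪a, y⟫_ℂ := by
  rw [hQ.mem_graph] at hab hxy
  refine (hQ.hasSum_inner b x).unique ?_
  convert hQ.hasSum_inner a y using 2 with χ
  rw [hab, hxy, h]

/-- Every component `Q χ z` lies in the domain, and testing against these vectors alone determines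
all components of the image under the adjoint. -/
theorem adjoint_multOp (h : ∀ χ x y, ⟪c χ x, y⟫_ℂ = ⟪x, c' χ y⟫_ℂ) :
    (multOp Q c).adjoint = multOp Q c' := by
  refine LinearPMap.eq_of_mem_graph_iff fun x y => ?_
  rw [LinearPMap.mem_adjoint_graph_iff (hQ.multOp_dense hc)]
  constructor
  · intro H'
    rw [hQ.mem_graph]
    intro χ
    refine ext_inner_left ℂ fun z => ?_
    have h1 := H' _ _ (hQ.component_mem_graph hc χ z)
    rw [← hQ.inner_left, ← h1, ← hc, hQ.inner_left, h]
  · intro hxy a b hab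
    exact hQ.inner_multiplier h hab hxy

omit hc in
theorem squareZero_multOp (h : ∀ χ x, c χ (c χ x) = 0) : SquareZero (multOp Q c) := by
  intro x
  have hx := (hQ.mem_graph (c := c)).1 ((multOp Q c).mem_graph x)
  rw [hQ.mem_graph]
  intro χ
  rw [hx, h, map_zero]

theorem anticommuteZero_multOp (hc' : ∀ χ x, Q χ (c' χ x) = c' χ (Q χ x))
    (h : ∀ χ x, c χ (c' χ x) + c' χ (c χ x) = 0) :
    AnticommuteZero (multOp Q c) (multOp Q c') := by
  constructor
  · refine hQ.dense_of_forall_mem fun χ x => LinearPMap.mem_domain_iff.2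
      ⟨c χ (c' χ (Q χ x)) + c' χ (c χ (Q χ x)), mem_graph_opAnti.2 ⟨_, _, _, _,
        hQ.component_mem_graph hc' χ x, ?_, hQ.component_mem_graph hc χ x, ?_, rfl⟩⟩
    · rw [← hc']; exact hQ.component_mem_graph hc χ _
    · rw [← hc]; exact hQ.component_mem_graph hc' χ _
  · intro x
    obtain ⟨u, v, w, w', h1, h2, h3, h4, h5⟩ := mem_graph_opAnti.1 ((opAnti _ _).mem_graph x)
    rw [hQ.mem_graph] at h1 h2 h3 h4
    refine hQ.ext fun χ => ?_
    rw [← h5, map_add, h2, h4, h1, h3, h, map_zero]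

/-- The issue is the domain: a vector in the maximal domain of multiplication by `μ` must lie in the
natural domain of both products. The identity `‖c z‖² + ‖c' z‖² = μ ‖z‖²` together with `μ ≤ 1 + μ²`
makes the first order components square summable; applied once more to `c z` and `c' z`, it bounds
the second order components by those of `y`. -/
theorem opAnti_multOp_adjoint (hc' : ∀ χ x, Q χ (c' χ x) = c' χ (Q χ x))
    (hadj : ∀ χ x y, ⟪c χ x, y⟫_ℂ = ⟪x, c' χ y⟫_ℂ) {μ : κ → ℝ}
    (h : ∀ χ x, c χ (c' χ x) + c' χ (c χ x) = (μ χ : ℂ) • x) :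
    opAnti (multOp Q c) (multOp Q c') = multOp Q fun χ => (μ χ : ℂ) • 1 := by
  have key : ∀ χ z, ‖c χ z‖ ^ 2 + ‖c' χ z‖ ^ 2 = μ χ * ‖z‖ ^ 2 := by
    intro χ z
    have h1 := congrArg (fun w => ⟪z, w⟫_ℂ) (h χ z)
    simp only [inner_add_right, inner_smul_right] at h1
    have hadj' : ⟪z, c χ (c' χ z)⟫_ℂ = ⟪c' χ z, c' χ z⟫_ℂ := by
      rw [← inner_conj_symm, hadj, inner_conj_symm]
    rw [← hadj, hadj', add_comm] at h1
    simp only [inner_self_eq_norm_sq_to_K, Complex.coe_algebraMap] at h1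
    exact_mod_cast h1
  refine LinearPMap.eq_of_mem_graph_iff fun x y => ?_
  rw [mem_graph_opAnti]
  constructor
  · rintro ⟨u, v, w, w', h1, h2, h3, h4, h5⟩
    rw [hQ.mem_graph] at *
    intro χ
    rw [← h5, map_add, h2, h4, h1, h3, h]
    simp
  · intro hxy
    rw [hQ.mem_graph] at hxy
    have hy : ∀ χ, ‖Q χ y‖ = |μ χ| * ‖Q χ x‖ := fun χ => by
      rw [hxy]; simp [norm_smul]
    have S1 : Summable fun χ => ‖Q χ x‖ ^ 2 + ‖Q χ y‖ ^ 2 :=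
      (hQ.hasSum_norm_sq x).summable.add (hQ.hasSum_norm_sq y).summable
    have bound : ∀ χ, μ χ * ‖Q χ x‖ ^ 2 ≤ ‖Q χ x‖ ^ 2 + ‖Q χ y‖ ^ 2 := by
      intro χ
      rw [hy, mul_pow, sq_abs]
      nlinarith [sq_nonneg (‖Q χ x‖), sq_nonneg (μ χ - 1), mul_nonneg (sq_nonneg ‖Q χ x‖)
        (sq_nonneg (μ χ - 1)), mul_nonneg (sq_nonneg ‖Q χ x‖) (sq_nonneg (μ χ + 1))]
    obtain ⟨u, hu⟩ := hQ.exists_of_summable (y := fun χ => c' χ (Q χ x))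
      (fun χ => by rw [hc', hQ.idem])
      (S1.of_nonneg_of_le (fun _ => by positivity) fun χ => by
        nlinarith [bound χ, key χ (Q χ x), sq_nonneg ‖c χ (Q χ x)‖])
    obtain ⟨v, hv⟩ := hQ.exists_of_summable (y := fun χ => c χ (Q χ x))
      (fun χ => by rw [hc, hQ.idem])
      (S1.of_nonneg_of_le (fun _ => by positivity) fun χ => by
        nlinarith [bound χ, key χ (Q χ x), sq_nonneg ‖c' χ (Q χ x)‖])
    have bound2 : ∀ χ, ‖c χ (c' χ (Q χ x))‖ ^ 2 ≤ ‖Q χ y‖ ^ 2 ∧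
        ‖c' χ (c χ (Q χ x))‖ ^ 2 ≤ ‖Q χ y‖ ^ 2 := by
      intro χ
      have k0 := key χ (Q χ x)
      have k1 := key χ (c χ (Q χ x))
      have k2 := key χ (c' χ (Q χ x))
      have e : ‖Q χ y‖ ^ 2 = μ χ * (‖c χ (Q χ x)‖ ^ 2 + ‖c' χ (Q χ x)‖ ^ 2) := by
        rw [k0, hy, mul_pow, sq_abs]; ring
      rw [e, mul_add, ← k1, ← k2]
      constructor <;> nlinarith [sq_nonneg ‖c χ (c χ (Q χ x))‖, sq_nonneg ‖c' χ (c χ (Q χ x))‖,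
        sq_nonneg ‖c χ (c' χ (Q χ x))‖, sq_nonneg ‖c' χ (c' χ (Q χ x))‖]
    obtain ⟨w, hw⟩ := hQ.exists_of_summable (y := fun χ => c χ (c' χ (Q χ x)))
      (fun χ => by rw [hc, hc', hQ.idem])
      ((hQ.hasSum_norm_sq y).summable.of_nonneg_of_le (fun _ => by positivity) fun χ => (bound2 χ).1)
    obtain ⟨w', hw'⟩ := hQ.exists_of_summable (y := fun χ => c' χ (c χ (Q χ x)))
      (fun χ => by rw [hc', hc, hQ.idem])
      ((hQ.hasSum_norm_sq y).summable.of_nonneg_of_le (fun _ => by positivity) fun χ => (bound2 χ).2)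
    refine ⟨u, v, w, w', ?_, ?_, ?_, ?_, ?_⟩
    any_goals rw [hQ.mem_graph]
    · exact hu
    · intro χ; rw [hw, hu]
    · exact hv
    · intro χ; rw [hw', hv]
    · refine hQ.ext fun χ => ?_
      rw [map_add, hw, hw', h, hxy]
      simp

theorem opMul_multOp_self (hadj : ∀ χ x y, ⟪c χ x, y⟫_ℂ = ⟪x, c χ y⟫_ℂ) {μ : κ → ℝ}
    (h : ∀ χ x, c χ (c χ x) = (μ χ : ℂ) • x) :
    opMul (multOp Q c) (multOp Q c) = multOp Q fun χ => (μ χ : ℂ) • 1 := by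
  have key : ∀ χ z, ‖c χ z‖ ^ 2 = μ χ * ‖z‖ ^ 2 := by
    intro χ z
    have h1 := congrArg (fun w => ⟪z, w⟫_ℂ) (h χ z)
    simp only [inner_smul_right] at h1
    rw [← hadj] at h1
    simp only [inner_self_eq_norm_sq_to_K, Complex.coe_algebraMap] at h1
    exact_mod_cast h1
  refine LinearPMap.eq_of_mem_graph_iff fun x y => ?_
  rw [mem_graph_opMul]
  constructor
  · rintro ⟨u, h1, h2⟩
    rw [hQ.mem_graph] at *
    intro χ
    rw [h2, h1, h]
    simp
  · intro hxy
    rw [hQ.mem_graph] at hxy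
    have S1 : Summable fun χ => ‖Q χ x‖ ^ 2 + ‖Q χ y‖ ^ 2 :=
      (hQ.hasSum_norm_sq x).summable.add (hQ.hasSum_norm_sq y).summable
    obtain ⟨u, hu⟩ := hQ.exists_of_summable (y := fun χ => c χ (Q χ x))
      (fun χ => by rw [hc, hQ.idem])
      (S1.of_nonneg_of_le (fun _ => by positivity) fun χ => by
        have hy : ‖Q χ y‖ = |μ χ| * ‖Q χ x‖ := by rw [hxy]; simp [norm_smul]
        rw [key, hy, mul_pow, sq_abs]
        nlinarith [sq_nonneg (‖Q χ x‖), mul_nonneg (sq_nonneg ‖Q χ x‖)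
          (sq_nonneg (μ χ - 1)), mul_nonneg (sq_nonneg ‖Q χ x‖) (sq_nonneg (μ χ + 1))])
    refine ⟨u, hQ.mem_graph.2 hu, hQ.mem_graph.2 fun χ => ?_⟩
    rw [hu, h, hxy]
    simp

end IsResolution

end Resolution

/-! ### Trace class operators and heat semigroups -/

section HeatSemigroups

variable {H : Type*} [NormedAddCommGroup H] [InnerProductSpace ℂ H] [CompleteSpace H]
variable {H' : Type*} [NormedAddCommGroup H'] [InnerProductSpace ℂ H'] [CompleteSpace H']

-- Absolute summability makes the series of rank one operators converge in operator norm, and norm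
-- limits of finite rank operators are compact.
open InnerProductSpace in
theorem IsTraceClass.isCompactOperator {T : H →L[ℂ] H} (hT : IsTraceClass T) :
    IsCompactOperator T := by
  obtain ⟨u, v, hs, hT⟩ := hT
  have hs' : Summable fun n => rankOne ℂ (v n) (u n) := by
    refine Summable.of_norm ?_
    simpa [norm_rankOne, mul_comm] using hs
  have hT' : HasSum (fun n => rankOne ℂ (v n) (u n)) T := by
    convert hs'.hasSum
    ext z
    refine (hT z).unique ?_
    simpa using hs'.hasSum.mapL (ContinuousLinearMap.apply ℂ H z)
  refine isCompactOperator_of_tendsto hT' (.of_forall fun s => ?_)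
  have : ∀ s : Finset ℕ, ∑ n ∈ s, rankOne ℂ (v n) (u n) ∈
      compactOperator (RingHom.id ℂ) H H := by
    intro s
    classical
    induction s using Finset.induction_on with
    | empty => simpa using isCompactOperator_zero
    | insert n s hn ih =>
      rw [Finset.sum_insert hn]
      exact (compactOperator (RingHom.id ℂ) H H).add_mem
        (isCompactOperator_of_locallyCompactSpace_dom (innerSL ℂ (u n)) |>.clm_comp
          (ContinuousLinearMap.toSpanSingleton ℂ (v n))) ih
  exact this s

theorem isTraceClass_zero : IsTraceClass (0 : H →L[ℂ] H) :=
  ⟨0, 0, by simpa using summable_zero, fun z => by simpa using hasSum_zero⟩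

theorem IsTraceClass.add {T T' : H →L[ℂ] H} (hT : IsTraceClass T) (hT' : IsTraceClass T') :
    IsTraceClass (T + T') := by
  obtain ⟨u, v, hs, hT⟩ := hT
  obtain ⟨u', v', hs', hT'⟩ := hT'
  obtain ⟨e⟩ : Nonempty (ℕ ≃ ℕ ⊕ ℕ) := ⟨Equiv.natSumNatEquivNat.symm⟩
  refine ⟨fun n => Sum.elim u u' (e n), fun n => Sum.elim v v' (e n), ?_, fun z => ?_⟩
  · have h : HasSum (fun m => ‖Sum.elim u u' m‖ * ‖Sum.elim v v' m‖) _ :=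
      HasSum.sum (f := fun m => ‖Sum.elim u u' m‖ * ‖Sum.elim v v' m‖) hs.hasSum hs'.hasSum
    exact (e.summable_iff (f := fun m => ‖Sum.elim u u' m‖ * ‖Sum.elim v v' m‖)).2 h.summable
  · have h : HasSum (fun m => ⟪Sum.elim u u' m, z⟫_ℂ • Sum.elim v v' m) (T z + T' z) :=
      HasSum.sum (f := fun m => ⟪Sum.elim u u' m, z⟫_ℂ • Sum.elim v v' m) (hT z) (hT' z)
    exact (e.hasSum_iff (f := fun m => ⟪Sum.elim u u' m, z⟫_ℂ • Sum.elim v v' m)).2 h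

theorem IsTraceClass.sum {J : Type*} (s : Finset J) {T : J → H →L[ℂ] H}
    (hT : ∀ j, IsTraceClass (T j)) : IsTraceClass (∑ j ∈ s, T j) := by
  classical
  induction s using Finset.induction_on with
  | empty => simpa using isTraceClass_zero
  | insert j s hj ih => rw [Finset.sum_insert hj]; exact (hT j).add ih

theorem IsTraceClass.comp_comp {T : H →L[ℂ] H} (hT : IsTraceClass T) (B : H →L[ℂ] H')
    (C : H' →L[ℂ] H) : IsTraceClass (B ∘L T ∘L C) := by
  obtain ⟨u, v, hs, hT⟩ := hT
  refine ⟨fun n => C.adjoint (u n), fun n => B (v n), ?_, fun z => ?_⟩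
  · refine (hs.mul_left (‖C.adjoint‖ * ‖B‖)).of_nonneg_of_le (fun n => by positivity) fun n => ?_
    calc _ ≤ (‖C.adjoint‖ * ‖u n‖) * (‖B‖ * ‖v n‖) := by
            gcongr <;> exact ContinuousLinearMap.le_opNorm _ _
      _ = _ := by ring
  · simpa [ContinuousLinearMap.adjoint_inner_left] using (hT (C z)).mapL B

/-- The trace class property of the heat semigroup passes to finite amplifications. -/
theorem HeatTraceClass.amplify {J : Type*} [Fintype J] [DecidableEq J] {L : H →ₗ.[ℂ] H}
    (hL : HeatTraceClass L) {L' : H' →ₗ.[ℂ] H'} (slice : J → H' →L[ℂ] H) (incl : J → H →L[ℂ] H')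
    (h1 : ∀ i j x, slice i (incl j x) = if i = j then x else 0)
    (h2 : ∀ x, ∑ j, incl j (slice j x) = x)
    (h3 : ∀ x y, (x, y) ∈ L'.graph ↔ ∀ j, (slice j x, slice j y) ∈ L.graph) :
    HeatTraceClass L' := by
  obtain ⟨S, hS, htr⟩ := hL
  have hsl : ∀ t j x, slice j ((∑ i, incl i ∘L S t ∘L slice i) x) = S t (slice j x) := by
    intro t j x
    simp [map_sum, h1]
  have hext : ∀ x y : H', (∀ j, slice j x = slice j y) → x = y := fun x y h => by
    rw [← h2 x, ← h2 y]; simp only [h]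
  refine ⟨fun t => ∑ j, incl j ∘L S t ∘L slice j, ⟨?_, ?_, ?_, ?_⟩, fun ε hε =>
    IsTraceClass.sum _ fun j => (htr ε hε).comp_comp _ _⟩
  · ext x
    simpa [hS.map_zero] using h2 x
  · intro s t hs ht
    ext x
    refine hext _ _ fun j => ?_
    rw [hsl, hS.map_add s t hs ht, ContinuousLinearMap.mul_apply, ContinuousLinearMap.mul_apply,
      hsl, hsl]
  · intro x
    simp only [sum_apply, ContinuousLinearMap.comp_apply]
    exact continuousOn_finsetSum _ fun j _ =>
      (incl j).continuous.comp_continuousOn (hS.continuousOn (slice j x))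
  · intro x y
    rw [h3]
    simp only [hS.generator]
    constructor
    · intro h
      have h4 := tendsto_finsetSum Finset.univ fun j _ =>
        ((incl j).continuous.tendsto _).comp (h j)
      rw [h2] at h4
      refine h4.congr fun t => ?_
      refine hext _ _ fun j => ?_
      simp only [Function.comp_apply, map_sum, h1, Finset.sum_ite_eq, Finset.mem_univ, if_true]
      rw [(slice j).map_smul_of_tower, map_sub, hsl]
    · intro h j
      refine (((slice j).continuous.tendsto _).comp h).congr fun t => ?_
      simp only [Function.comp_apply]
      rw [(slice j).map_smul_of_tower, map_sub, hsl]

namespace IsHeatSemigroup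

variable {L : H →ₗ.[ℂ] H} {S : ℝ → H →L[ℂ] H}

/-- Contractivity is not part of the definition of a heat semigroup; strong continuity on a compact
interval and the uniform boundedness principle replace it. -/
theorem exists_bound (hS : IsHeatSemigroup L S) :
    ∃ C, ∀ t ∈ Set.Icc (0 : ℝ) 1, ‖S t‖ ≤ C := by
  obtain ⟨C, hC⟩ := banach_steinhaus (g := fun t : Set.Icc (0 : ℝ) 1 => S t) fun x => by
    obtain ⟨C, hC⟩ := isCompact_Icc.exists_bound_of_continuousOn
      ((hS.continuousOn x).mono fun t ht => ht.1)
    exact ⟨C, fun t => hC t t.2⟩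
  exact ⟨C, fun t ht => hC ⟨t, ht⟩⟩

/-- The generator gives a derivative at `0` from the right only, and the semigroup law transports it
to `t`. A right derivative is all the mean value inequality in `norm_sub_le` requires. -/
theorem hasDerivWithinAt (hS : IsHeatSemigroup L S) {x y : H} (hxy : (x, y) ∈ L.graph) {t : ℝ}
    (ht : 0 ≤ t) : HasDerivWithinAt (fun r => S r x) (-S t y) (Set.Ici t) t := by
  rw [← hasDerivWithinAt_Ioi_iff_Ici, hasDerivWithinAt_iff_tendsto_slope' (by simp)]
  have h := ((S t).continuous.tendsto _).comp ((hS.generator x y).1 hxy)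
  have h' := h.neg
  have hm : Filter.Tendsto (fun r : ℝ => r - t) (nhdsWithin t (Set.Ioi t))
      (nhdsWithin 0 (Set.Ioi 0)) := by
    refine tendsto_nhdsWithin_iff.2 ⟨?_, ?_⟩
    · have : Filter.Tendsto (fun r : ℝ => r - t) (nhds t) (nhds (t - t)) :=
        (continuous_id.sub continuous_const).tendsto t
      rw [sub_self] at this
      exact this.mono_left nhdsWithin_le_nhds
    · filter_upwards [self_mem_nhdsWithin] with r hr
      simpa using hr
  refine (h'.comp hm).congr' ?_
  filter_upwards [self_mem_nhdsWithin] with r hr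
  have hr' : 0 ≤ r - t := sub_nonneg.2 (le_of_lt hr)
  have e : S r = S t * S (r - t) := by rw [← hS.map_add t _ ht hr', add_sub_cancel]
  simp only [Function.comp_apply, slope_def_module]
  rw [e, (S t).map_smul_of_tower, map_sub, ContinuousLinearMap.mul_apply, ← smul_neg, neg_sub]

theorem norm_sub_le (hS : IsHeatSemigroup L S) {C : ℝ}
    (hC : ∀ t ∈ Set.Icc (0 : ℝ) 1, ‖S t‖ ≤ C) {x y : H} (hxy : (x, y) ∈ L.graph) {t : ℝ}
    (ht : t ∈ Set.Icc (0 : ℝ) 1) : ‖S t x - x‖ ≤ C * ‖y‖ * t := by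
  have h := norm_image_sub_le_of_norm_deriv_right_le_segment (f := fun r => S r x)
    (f' := fun r => -S r y) (C := C * ‖y‖) (a := 0) (b := 1)
    ((hS.continuousOn x).mono Set.Icc_subset_Ici_self)
    (fun r hr => hS.hasDerivWithinAt hxy hr.1)
    (fun r hr => by
      rw [norm_neg]
      exact ((S r).le_opNorm y).trans (by gcongr; exact hC r ⟨hr.1, hr.2.le⟩)) t ht
  simpa [hS.map_zero] using h

/-- As `R` maps into the domain of `L` with `L R = B` bounded, `‖S t R - R‖ = O(t)`. Thus `R` is the
norm limit of the compact operators `S t R`, and no functional calculus is involved. -/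
theorem isCompactOperator_of_forall_mem_graph (hS : IsHeatSemigroup L S)
    (hc : ∀ ε : ℝ, 0 < ε → IsCompactOperator (S ε)) {R B : H →L[ℂ] H}
    (hR : ∀ x, (R x, B x) ∈ L.graph) : IsCompactOperator R := by
  obtain ⟨C, hC⟩ := hS.exists_bound
  have hC0 : 0 ≤ C := (norm_nonneg _).trans (hC 0 (by simp))
  have key : ∀ t ∈ Set.Icc (0 : ℝ) 1, ‖S t ∘L R - R‖ ≤ C * ‖B‖ * t := by
    intro t ht
    refine ContinuousLinearMap.opNorm_le_bound _ (by have := ht.1; positivity) fun x => ?_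
    refine (hS.norm_sub_le hC (hR x) ht).trans ?_
    have := B.le_opNorm x
    have h0 := ht.1
    calc C * ‖B x‖ * t ≤ C * (‖B‖ * ‖x‖) * t := by gcongr
      _ = _ := by ring
  have ht : Filter.Tendsto (fun n : ℕ => S (1 / ((n : ℝ) + 1)) ∘L R) Filter.atTop (nhds R) := by
    rw [tendsto_iff_norm_sub_tendsto_zero]
    refine squeeze_zero (fun _ => norm_nonneg _) (fun n => key _ ⟨by positivity, ?_⟩) ?_
    · rw [div_le_one (by positivity)]; linarith [(Nat.cast_nonneg n : (0 : ℝ) ≤ n)]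
    · simpa using tendsto_one_div_add_atTop_nhds_zero_nat.const_mul (C * ‖B‖)
  exact isCompactOperator_of_tendsto ht (.of_forall fun n => (hc _ (by positivity)).comp_clm R)

end IsHeatSemigroup

end HeatSemigroups

/-! ### The resolvent of the square of a self-adjoint operator -/

section Resolvent

variable {H : Type*} [NormedAddCommGroup H] [InnerProductSpace ℂ H] [CompleteSpace H]
variable {D : H →ₗ.[ℂ] H}

theorem IsSelfAdjoint.inner_eq_of_mem_graph (hD : IsSelfAdjoint D) {a b x y : H}
    (hab : (a, b) ∈ D.graph) (hxy : (x, y) ∈ D.graph) : ⟪b, x⟫_ℂ = ⟪a, y⟫_ℂ := by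
  rw [← LinearPMap.isSelfAdjoint_def.1 hD] at hxy
  exact (LinearPMap.mem_adjoint_graph_iff hD.dense_domain).1 hxy a b hab

/-- If `D² x = -x`, then `‖D x‖² = -‖x‖²`. This gives the injectivity of `1 + D²`. -/
theorem IsSelfAdjoint.eq_zero_of_mem_graph_opMul (hD : IsSelfAdjoint D) {x : H}
    (hx : (x, -x) ∈ (opMul D D).graph) : x = 0 := by
  obtain ⟨y, h1, h2⟩ := mem_graph_opMul.1 hx
  have h := hD.inner_eq_of_mem_graph h1 h2
  rw [inner_neg_right, inner_self_eq_norm_sq_to_K, inner_self_eq_norm_sq_to_K] at h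
  have h' : ‖y‖ ^ 2 = -‖x‖ ^ 2 := by
    simp only [Complex.coe_algebraMap] at h
    exact_mod_cast h
  have : ‖x‖ ^ 2 = 0 := by nlinarith [sq_nonneg ‖y‖, sq_nonneg ‖x‖]
  exact norm_eq_zero.1 (pow_eq_zero_iff two_ne_zero |>.1 this)

/-- The bounded operator `(1 + D²)⁻¹` of a self-adjoint operator `D`. -/
theorem IsSelfAdjoint.exists_resolvent (hD : IsSelfAdjoint D) :
    ∃ R : H →L[ℂ] H, ∀ x, (R x, x - R x) ∈ (opMul D D).graph := by
  -- Von Neumann's argument: let `p` be the orthogonal projection of `(h, 0)` onto the graph `Γ` and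
  -- `R h` its first component. Orthogonality of `(h, 0) - p` to `Γ` says that `p.snd` lies in the
  -- domain of `D* = D`, with image `h - R h`.
  let Γ : Submodule ℂ (WithLp 2 (H × H)) :=
    D.graph.comap (WithLp.linearEquiv 2 ℂ (H × H)).toLinearMap
  have hΓ : IsClosed (Γ : Set (WithLp 2 (H × H))) :=
    hD.isClosed.preimage (WithLp.prod_continuous_ofLp 2 H H)
  have : CompleteSpace Γ := hΓ.completeSpace_coe
  let pr : WithLp 2 (H × H) →L[ℂ] H :=
    ContinuousLinearMap.fst ℂ H H ∘L (WithLp.prodContinuousLinearEquiv 2 ℂ H H : _ →L[ℂ] _)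
  let inc : H →L[ℂ] WithLp 2 (H × H) :=
    ((WithLp.prodContinuousLinearEquiv 2 ℂ H H).symm : _ →L[ℂ] _) ∘L ContinuousLinearMap.inl ℂ H H
  refine ⟨pr ∘L Γ.starProjection ∘L inc, fun h => ?_⟩
  set p := Γ.starProjection (inc h) with hp
  have hpΓ : p ∈ Γ := Γ.starProjection_apply_mem _
  have hort : inc h - p ∈ Γᗮ := Γ.sub_starProjection_mem_orthogonal _
  change (p.fst, h - p.fst) ∈ (opMul D D).graph
  refine mem_graph_opMul.2 ⟨p.snd, hpΓ, ?_⟩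
  rw [← LinearPMap.isSelfAdjoint_def.1 hD, LinearPMap.mem_adjoint_graph_iff hD.dense_domain]
  intro a b hab
  have h1 := (Submodule.mem_orthogonal _ _).1 hort (WithLp.toLp 2 (a, b)) hab
  rw [WithLp.prod_inner_apply] at h1
  have e1 : (inc h - p).fst = h - p.fst := rfl
  have e2 : (inc h - p).snd = 0 - p.snd := rfl
  simp only [WithLp.ofLp_fst, WithLp.ofLp_snd, e1, e2, zero_sub, inner_neg_right] at h1
  linear_combination -h1

end Resolvent

/-! ### Joint eigenvectors -/

section JointEigenvectors

variable {H : Type*} [NormedAddCommGroup H] [InnerProductSpace ℂ H] [CompleteSpace H]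

/-- An isometry has no nontrivial Jordan blocks. For a block of size two, `w = V x - μ x` is an
eigenvector; if `w ≠ 0` then `|μ| = 1`, so `⟪w, V x⟫ = μ ⟪w, x⟫`, which forces `⟪w, w⟫ = 0`. Longer
blocks follow by induction. -/
theorem maxGenEigenspace_eq_of_isometry {V : H →L[ℂ] H} (hV : ∀ x y, ⟪V x, V y⟫_ℂ = ⟪x, y⟫_ℂ)
    {μ : ℂ} {x : H} (hx : x ∈ Module.End.maxGenEigenspace (V.toLinearMap) μ) : V x = μ • x := by
  have sq : ∀ x, V (V x - μ • x) = μ • (V x - μ • x) → V x = μ • x := by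
    intro x hx
    set w := V x - μ • x with hw
    have h1 : starRingEnd ℂ μ * ⟪w, V x⟫_ℂ = ⟪w, x⟫_ℂ := by
      rw [← inner_smul_left, ← hx, hV]
    have h2 : starRingEnd ℂ μ * (μ * ⟪w, w⟫_ℂ) = ⟪w, w⟫_ℂ := by
      rw [← inner_smul_right, ← inner_smul_left, ← hx, hV]
    have h3 : ⟪w, w⟫_ℂ = ⟪w, V x⟫_ℂ - μ * ⟪w, x⟫_ℂ := by
      conv_lhs => rw [hw]
      rw [← hw, inner_sub_right, inner_smul_right]
    by_contra hne
    have hw0 : ⟪w, w⟫_ℂ ≠ 0 := by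
      rw [inner_self_ne_zero]; exact sub_ne_zero.2 hne
    have h4 : starRingEnd ℂ μ * μ = 1 := by
      apply mul_right_cancel₀ hw0; linear_combination h2
    have h5 : starRingEnd ℂ μ ≠ 0 := fun h => by simp [h] at h4
    apply hw0
    apply mul_left_cancel₀ h5
    rw [mul_zero]
    linear_combination (starRingEnd ℂ μ) * h3 + h1 - ⟪w, x⟫_ℂ * h4
  obtain ⟨k, hk⟩ := (Module.End.mem_maxGenEigenspace _ _ _).1 hx
  clear hx
  induction k generalizing x with
  | zero =>
    have : x = 0 := by simpa using hk
    simp [this]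
  | succ k ih =>
    refine sq x ?_
    refine ih (x := V x - μ • x) ?_
    rw [pow_succ] at hk
    simpa using hk

/-- A commuting family of isometries that commute with an injective compact symmetric operator has
a total set of joint eigenvectors. -/
theorem eq_zero_of_forall_joint_eigenvector {G : Type*} {R : H →L[ℂ] H} (hR : IsCompactOperator R)
    (hsymm : R.IsSymmetric) (hinj : ∀ x, R x = 0 → x = 0) {V : G → H →L[ℂ] H}
    (hV : ∀ g x y, ⟪V g x, V g y⟫_ℂ = ⟪x, y⟫_ℂ) (hcomm : ∀ g h x, V g (V h x) = V h (V g x))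
    (hVR : ∀ g x, V g (R x) = R (V g x)) {y : H}
    (hy : ∀ (χ : G → ℂ) x, (∀ g, V g x = χ g • x) → ⟪x, y⟫_ℂ = 0) : y = 0 := by
  have hbot := ContinuousLinearMap.orthogonalComplement_iSup_eigenspaces_eq_bot hR hsymm
  suffices h : y ∈ (⨆ μ, Module.End.eigenspace (R : Module.End ℂ H) μ)ᗮ by
    rw [hbot] at h
    simpa using h
  rw [← Submodule.iInf_orthogonal, Submodule.mem_iInf]
  intro μ
  rw [Submodule.mem_orthogonal]
  intro x hx
  by_cases hμ : μ = 0
  · subst hμ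
    have : R x = 0 := by simpa using Module.End.mem_eigenspace_iff.1 hx
    rw [hinj x this, inner_zero_left]
  -- For `μ ≠ 0` compactness makes the eigenspace finite dimensional. The commuting `V g` preserve
  -- it, so it is spanned by their joint generalized eigenvectors, which are genuine eigenvectors
  -- because the `V g` are isometric.
  have := ContinuousLinearMap.finite_dimensional_eigenspace hR μ hμ
  set p := Module.End.eigenspace R.toLinearMap μ with hp
  have hmaps : ∀ g, Set.MapsTo (V g).toLinearMap p p := by
    intro g z hz
    have hz' : R z = μ • z := Module.End.mem_eigenspace_iff.1 hz
    refine Module.End.mem_eigenspace_iff.2 ?_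
    change R (V g z) = μ • V g z
    rw [← hVR, hz', map_smul]
  have htop := Module.End.iSup_iInf_maxGenEigenspace_eq_top_of_iSup_maxGenEigenspace_eq_top_of_commute
    (fun g => (V g).toLinearMap.restrict (hmaps g))
    (fun g h _ => by
      ext z
      exact hcomm g h z)
    (fun g => Module.End.iSup_maxGenEigenspace_eq_top _)
  have hxm : (⟨x, hx⟩ : p) ∈ (⊤ : Submodule ℂ p) := trivial
  rw [← htop] at hxm
  refine Submodule.iSup_induction _ (motive := fun z : p => ⟪(z : H), y⟫_ℂ = 0) hxm ?_ ?_ ?_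
  · intro χ z hz
    refine hy χ z fun g => ?_
    refine maxGenEigenspace_eq_of_isometry (hV g) ?_
    have hz2 : (z : H) ∈ p ⊓ ⨅ g, Module.End.maxGenEigenspace (V g).toLinearMap (χ g) := by
      rw [Submodule.inf_iInf_maxGenEigenspace_of_forall_mapsTo _ p hmaps]
      exact ⟨z, hz, rfl⟩
    exact (Submodule.mem_iInf _).1 hz2.2 g
  · simp
  · intro a b ha hb
    simp [inner_add_left, ha, hb]

end JointEigenvectors

/-! ### Canonical anticommutation relations -/

section Fermions

variable {ι 𝔄 : Type*} [Fintype ι] [DecidableEq ι] [Ring 𝔄] [StarRing 𝔄] [Algebra ℂ 𝔄]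
  [StarModule ℂ 𝔄]

/-- Elements satisfying the canonical anticommutation relations. -/
structure IsFermionic (a : ι → 𝔄) : Prop where
  anti : ∀ r l, a r * a l + a l * a r = 0
  car : ∀ r l, a r * star (a l) + star (a l) * a r = if r = l then 1 else 0

/-- The linear combinations `∑_l P_{lr} a_l`. -/
def rotate (P : Matrix ι ι ℂ) (a : ι → 𝔄) (r : ι) : 𝔄 := ∑ l, P l r • a l

/-- The second quantization `∑_{l r} P_{lr} a_l a_r^*`. -/
def secondQuant (P : Matrix ι ι ℂ) (a : ι → 𝔄) : 𝔄 := ∑ r, rotate P a r * star (a r)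

theorem rotate_rotate (P Q : Matrix ι ι ℂ) (a : ι → 𝔄) (r : ι) :
    rotate Q (rotate P a) r = rotate (P * Q) a r := by
  simp only [rotate, Matrix.mul_apply, Finset.smul_sum, Finset.sum_smul, smul_smul]
  rw [Finset.sum_comm]
  simp only [mul_comm]

theorem rotate_add (P Q : Matrix ι ι ℂ) (a : ι → 𝔄) (r : ι) :
    rotate (P + Q) a r = rotate P a r + rotate Q a r := by
  simp [rotate, add_smul, Finset.sum_add_distrib]

theorem rotate_zero (a : ι → 𝔄) (r : ι) : rotate 0 a r = 0 := by simp [rotate]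

theorem rotate_one (a : ι → 𝔄) (r : ι) : rotate 1 a r = a r := by
  simp [rotate, Matrix.one_apply]

theorem star_rotate (P : Matrix ι ι ℂ) (a : ι → 𝔄) (r : ι) :
    star (rotate P a r) = rotate (P.map star) (fun l => star (a l)) r := by
  simp [rotate, star_sum, star_smul]

theorem sum_smul_rotate (P : Matrix ι ι ℂ) (a : ι → 𝔄) (c : ι → ℂ) :
    ∑ r, c r • rotate P a r = ∑ l, (P.mulVec c) l • a l := by
  simp only [rotate, Finset.smul_sum, smul_smul, Matrix.mulVec, dotProduct, Finset.sum_smul]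
  rw [Finset.sum_comm]
  simp only [mul_comm]

theorem rotate_anti_of_anti {g : 𝔄} {a : ι → 𝔄} (hg : ∀ r, g * a r = -(a r * g))
    (P : Matrix ι ι ℂ) (r : ι) : g * rotate P a r = -(rotate P a r * g) := by
  simp [rotate, Finset.mul_sum, Finset.sum_mul, hg]

theorem secondQuant_commute_of_anti {g : 𝔄} {a : ι → 𝔄} (hg : ∀ r, g * a r = -(a r * g))
    (hs : star g = g) (P : Matrix ι ι ℂ) : Commute g (secondQuant P a) := by
  have h1 : ∀ r, g * star (a r) = -(star (a r) * g) := fun r => by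
    have := congrArg star (hg r)
    simp only [star_mul, star_neg, hs] at this
    rw [this, neg_neg]
  rw [Commute, SemiconjBy]
  simp only [secondQuant, Finset.mul_sum, Finset.sum_mul]
  refine Finset.sum_congr rfl fun r _ => ?_
  rw [← mul_assoc, rotate_anti_of_anti hg, neg_mul, mul_assoc, h1, mul_neg, neg_neg, mul_assoc]

/-- For Hermitian `P`, conjugating the entries amounts to transposing, so an operator exchanging
`a_r` and `a_r^*` exchanges the roles of `P` and `Pᵀ`. This is why the Hodge operator relates `∂` to
the adjoint of `∂̄`. -/
theorem rotate_intertwine {w : 𝔄} {a : ι → 𝔄} (hw : ∀ r, w * a r = star (a r) * w)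
    {P : Matrix ι ι ℂ} (hP : P.conjTranspose = P) (r : ι) :
    w * rotate P a r = star (rotate P.transpose a r) * w := by
  have : P.transpose.map star = P := hP
  rw [star_rotate, this]
  simp [rotate, Finset.mul_sum, Finset.sum_mul, hw]

namespace IsFermionic

variable {a : ι → 𝔄} (ha : IsFermionic a)

include ha

theorem rotate_anti (P Q : Matrix ι ι ℂ) (r l : ι) :
    rotate P a r * rotate Q a l + rotate Q a l * rotate P a r = 0 := by
  simp only [rotate, Finset.mul_sum, Finset.sum_mul, smul_mul_smul_comm]
  rw [Finset.sum_comm, ← Finset.sum_add_distrib]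
  refine Finset.sum_eq_zero fun i _ => ?_
  rw [← Finset.sum_add_distrib]
  refine Finset.sum_eq_zero fun j _ => ?_
  rw [mul_comm (Q _ _), ← smul_add, ha.anti, smul_zero]

theorem rotate_car (P Q : Matrix ι ι ℂ) (r l : ι) :
    rotate P a r * star (rotate Q a l) + star (rotate Q a l) * rotate P a r =
      (Q.conjTranspose * P) l r • (1 : 𝔄) := by
  rw [star_rotate]
  simp only [rotate, Finset.mul_sum, Finset.sum_mul, smul_mul_smul_comm, Matrix.map_apply,
    Matrix.mul_apply, Matrix.conjTranspose_apply, Finset.sum_smul]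
  rw [Finset.sum_comm, ← Finset.sum_add_distrib]
  have : ∀ i j, (P i r * star (Q j l)) • (a i * star (a j)) +
      (star (Q j l) * P i r) • (star (a j) * a i) =
      if i = j then (star (Q i l) * P i r) • (1 : 𝔄) else 0 := by
    intro i j
    rw [mul_comm (P i r), ← smul_add, ha.car]
    split_ifs with h
    · rw [h]
    · rw [smul_zero]
  refine Finset.sum_congr rfl fun i _ => ?_
  rw [← Finset.sum_add_distrib, Finset.sum_congr rfl fun j _ => this i j]
  simp

/-- Follows from `[x y, z] = x {y, z} - {x, z} y`: the second anticommutator vanishes and the first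
is a Kronecker delta. -/
theorem secondQuant_commutator (P : Matrix ι ι ℂ) (s : ι) :
    secondQuant P a * a s - a s * secondQuant P a = rotate P a s := by
  have h : ∀ r, rotate P a r * star (a r) * a s - a s * (rotate P a r * star (a r)) =
      if s = r then rotate P a s else 0 := by
    intro r
    have h1 := ha.car s r
    have h2 := ha.rotate_anti P 1 r s
    rw [rotate_one] at h2
    have : rotate P a r * star (a r) * a s - a s * (rotate P a r * star (a r)) =
        rotate P a r * (a s * star (a r) + star (a r) * a s) -
          (rotate P a r * a s + a s * rotate P a r) * star (a r) := by noncomm_ring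
    rw [this, h1, h2]
    split_ifs with h
    · rw [h]; simp
    · simp
  simp only [secondQuant, Finset.mul_sum, Finset.sum_mul]
  rw [← Finset.sum_sub_distrib]
  simp [h]

theorem secondQuant_commutator_rotate (P Q : Matrix ι ι ℂ) (s : ι) :
    secondQuant P a * rotate Q a s - rotate Q a s * secondQuant P a = rotate (P * Q) a s := by
  rw [← rotate_rotate]
  have h : rotate Q (rotate P a) s =
      ∑ l, Q l s • (secondQuant P a * a l - a l * secondQuant P a) := by
    simp only [ha.secondQuant_commutator]
    rfl
  rw [h, rotate.eq_1 Q]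
  simp only [Finset.mul_sum, Finset.sum_mul, smul_sub, Finset.sum_sub_distrib, mul_smul_comm,
    smul_mul_assoc]

omit ha in
theorem _root_.star_secondQuant (P : Matrix ι ι ℂ) :
    star (secondQuant P a) = secondQuant P.conjTranspose a := by
  simp only [secondQuant, rotate, star_sum, star_mul, star_star, star_smul, Finset.sum_mul,
    Finset.mul_sum, mul_smul_comm, smul_mul_assoc, Matrix.conjTranspose_apply]
  rw [Finset.sum_comm]

/-- The commutator of the second quantizations of `P` and `Q` is the second quantization of `P Q`
minus that of `Q P`, and here both products are zero. -/
theorem secondQuant_commute {P Q : Matrix ι ι ℂ} (h1 : P * Q = 0) (h2 : Q * P = 0) :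
    Commute (secondQuant P a) (secondQuant Q a) := by
  have hstar : ∀ r, secondQuant P a * star (a r) - star (a r) * secondQuant P a =
      -star (rotate P.conjTranspose a r) := by
    intro r
    have h := congrArg star (ha.secondQuant_commutator P.conjTranspose r)
    simp only [star_sub, star_mul, star_secondQuant, Matrix.conjTranspose_conjTranspose] at h
    rw [← h, neg_sub]
  have hsum : ∑ r, rotate Q a r * star (rotate P.conjTranspose a r) = secondQuant (Q * P) a := by
    have : P.conjTranspose.map star = P.transpose := by ext; simp
    simp only [secondQuant, ← rotate_rotate, star_rotate, this]
    simp only [rotate.eq_1 P, rotate.eq_1 P.transpose, Finset.mul_sum, Finset.sum_mul,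
      mul_smul_comm, smul_mul_assoc, Matrix.transpose_apply]
    rw [Finset.sum_comm]
  rw [commute_iff_lie_eq, Ring.lie_def]
  have : secondQuant P a * secondQuant Q a - secondQuant Q a * secondQuant P a =
      ∑ r, ((secondQuant P a * rotate Q a r - rotate Q a r * secondQuant P a) * star (a r) +
        rotate Q a r * (secondQuant P a * star (a r) - star (a r) * secondQuant P a)) := by
    conv_lhs => rw [secondQuant.eq_1 Q]
    rw [Finset.mul_sum, Finset.sum_mul, ← Finset.sum_sub_distrib]
    exact Finset.sum_congr rfl fun r _ => by noncomm_ring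
  rw [this]
  simp only [ha.secondQuant_commutator_rotate, h1, hstar, rotate_zero, zero_mul, zero_add, mul_neg,
    Finset.sum_neg_distrib, hsum, h2]
  simp [secondQuant, rotate_zero]

/-- Anticommuting with `a_t^*` reads off the coefficient of `a_t`. -/
theorem eq_of_sum_smul_eq [Nontrivial 𝔄] {c c' : ι → ℂ}
    (h : ∑ l, c l • a l = ∑ l, c' l • a l) : c = c' := by
  have key : ∀ (c : ι → ℂ) (t : ι), (∑ l, c l • a l) * star (a t) + star (a t) * (∑ l, c l • a l) =
      c t • (1 : 𝔄) := by
    intro c t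
    simp only [Finset.mul_sum, Finset.sum_mul, smul_mul_assoc, mul_smul_comm]
    rw [← Finset.sum_add_distrib]
    simp [← smul_add, ha.car]
  funext t
  have h1 := key c t
  rw [h, key c' t] at h1
  exact (smul_left_injective ℂ (one_ne_zero (α := 𝔄)) h1).symm

theorem rotate_injective [Nontrivial 𝔄] {P Q : Matrix ι ι ℂ}
    (h : ∀ r, rotate P a r = rotate Q a r) : P = Q := by
  ext l r
  exact congrFun (ha.eq_of_sum_smul_eq (c := fun l => P l r) (c' := fun l => Q l r) (h r)) l

theorem sum_smul_rotate_sq (P : Matrix ι ι ℂ) (c : ι → ℂ) :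
    (∑ r, c r • rotate P a r) * (∑ r, c r • rotate P a r) = 0 := by
  have h : (2 : ℂ) • ((∑ r, c r • rotate P a r) * (∑ r, c r • rotate P a r)) = 0 := by
    rw [two_smul]
    conv_lhs => arg 2; rw [Finset.sum_mul_sum, Finset.sum_comm]
    rw [Finset.sum_mul_sum, ← Finset.sum_add_distrib]
    refine Finset.sum_eq_zero fun r _ => ?_
    rw [← Finset.sum_add_distrib]
    refine Finset.sum_eq_zero fun l _ => ?_
    rw [smul_mul_smul_comm, smul_mul_smul_comm, mul_comm (c l), ← smul_add, ha.rotate_anti,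
      smul_zero]
  simpa using h

theorem sum_smul_rotate_anti (P Q : Matrix ι ι ℂ) (c c' : ι → ℂ) :
    (∑ r, c r • rotate P a r) * (∑ r, c' r • rotate Q a r) +
      (∑ r, c' r • rotate Q a r) * (∑ r, c r • rotate P a r) = 0 := by
  rw [Finset.sum_mul_sum, Finset.sum_mul_sum]
  conv_lhs => arg 2; rw [Finset.sum_comm]
  rw [← Finset.sum_add_distrib]
  refine Finset.sum_eq_zero fun r _ => ?_
  rw [← Finset.sum_add_distrib]
  refine Finset.sum_eq_zero fun l _ => ?_
  rw [smul_mul_smul_comm, smul_mul_smul_comm, mul_comm (c' l), ← smul_add, ha.rotate_anti,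
    smul_zero]

theorem sum_smul_rotate_car (P Q : Matrix ι ι ℂ) (c c' : ι → ℂ) :
    (∑ r, c r • rotate P a r) * star (∑ r, c' r • rotate Q a r) +
      star (∑ r, c' r • rotate Q a r) * (∑ r, c r • rotate P a r) =
      (star c' ⬝ᵥ (Q.conjTranspose * P).mulVec c) • (1 : 𝔄) := by
  simp only [star_sum, star_smul]
  rw [Finset.sum_mul_sum, Finset.sum_mul_sum]
  conv_lhs => arg 2; rw [Finset.sum_comm]
  rw [← Finset.sum_add_distrib, dotProduct]
  simp only [Matrix.mulVec, dotProduct, Finset.mul_sum, Finset.sum_smul]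
  rw [Finset.sum_comm]
  refine Finset.sum_congr rfl fun r _ => ?_
  rw [Finset.sum_add_distrib.symm]
  refine Finset.sum_congr rfl fun l _ => ?_
  rw [smul_mul_smul_comm, smul_mul_smul_comm, mul_comm (star (c' _)), ← smul_add, ha.rotate_car,
    smul_smul]
  congr 1
  simp only [Pi.star_apply]
  ring

end IsFermionic

/-- Two anticommuting families of Clifford generators combine to fermionic operators. -/
theorem isFermionic_of_clifford {e f : ι → 𝔄} {s : ℂ} (hs : s = 1 ∨ s = -1)
    (he : ∀ r, star (e r) = -e r) (hf : ∀ r, star (f r) = -f r)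
    (hee : ∀ r l, e r * e l + e l * e r = if r = l then (-2 : ℂ) • 1 else 0)
    (hff : ∀ r l, f r * f l + f l * f r = if r = l then (-2 : ℂ) • 1 else 0)
    (hef : ∀ r l, e r * f l + f l * e r = 0) :
    IsFermionic fun r => (1 / 2 : ℂ) • (e r - Complex.I • (-s • f r)) := by
  have hs2 : s * s = 1 := by rcases hs with rfl | rfl <;> norm_num
  have hss : star s = s := by rcases hs with rfl | rfl <;> simp
  have hsa : ∀ r, star ((1 / 2 : ℂ) • (e r - Complex.I • (-s • f r))) =
      (1 / 2 : ℂ) • (-e r - Complex.I • (-s • f r)) := by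
    intro r
    simp [star_smul, star_sub, he, hf, hss]
  -- Used with `c = i s` and `d = ± i s`. For `d = c` one has `c d = -1` and the Clifford relations
  -- of `e` and `f` cancel; for `d = -c` one has `c d = 1` and they add up to the factor compensated
  -- by the prefactors `1/2` and `-1/2`.
  have expand : ∀ (c d : ℂ) r l, (e r + c • f r) * (e l + d • f l) + (e l + d • f l) * (e r + c • f r) =
      (e r * e l + e l * e r) + (c * d) • (f r * f l + f l * f r) + d • (e r * f l + f l * e r) +
        c • (e l * f r + f r * e l) := by
    intro c d r l
    simp only [mul_add, add_mul, smul_mul_assoc, mul_smul_comm, smul_add, smul_smul, mul_comm d c]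
    abel
  have ea : ∀ r, (1 / 2 : ℂ) • (e r - Complex.I • (-s • f r)) =
      (1 / 2 : ℂ) • (e r + (Complex.I * s) • f r) := by
    intro r; simp [smul_smul]
  have eb : ∀ r, (1 / 2 : ℂ) • (-e r - Complex.I • (-s • f r)) =
      (-1 / 2 : ℂ) • (e r + (-(Complex.I * s)) • f r) := by
    intro r
    module
  have hI : Complex.I * s * (Complex.I * s) = -1 := by
    linear_combination (Complex.I * Complex.I) * hs2 + Complex.I_mul_I
  constructor
  · intro r l
    rw [ea, ea]
    simp only [smul_mul_smul_comm]
    rw [← smul_add, expand, hee, hff, hef, hef, hI]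
    split_ifs <;> simp
  · intro r l
    rw [hsa, ea, eb]
    simp only [smul_mul_smul_comm]
    rw [mul_comm (-1 / 2 : ℂ), ← smul_add, expand, hee, hff, hef, hef, mul_neg, hI]
    split_ifs
    · simp only [smul_zero, add_zero, neg_neg, one_smul]
      rw [← add_smul, smul_smul]
      norm_num
    · simp

end Fermions

/-! ### The fermionic matrices of the differential -/

namespace IsGradedClifford

variable {n : ℕ} {ν : Type*} [Fintype ν] [DecidableEq ν] {γ : Fin n → Matrix ν ν ℂ}
  {σ : Matrix ν ν ℂ} (hγ : IsGradedClifford γ σ) {s : ℂ} (hs : s = 1 ∨ s = -1)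

/-- The coefficient matrices of the differential `d`. -/
def fermion (γ : Fin n → Matrix ν ν ℂ) (σ : Matrix ν ν ℂ) (s : ℂ) (r : Fin n) :
    Matrix (ν × ν) (ν × ν) ℂ :=
  (1 / 2 : ℂ) • (((1 : Matrix ν ν ℂ) ⊗ₖ γ r) - Complex.I • (-s • (γ r ⊗ₖ σ)))

include hγ

theorem isFermionic (hs : s = 1 ∨ s = -1) : IsFermionic (fermion γ σ s) := by
  refine isFermionic_of_clifford (e := fun r => (1 : Matrix ν ν ℂ) ⊗ₖ γ r)
    (f := fun r => γ r ⊗ₖ σ) hs ?_ ?_ ?_ ?_ ?_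
  · intro r
    rw [Matrix.star_eq_conjTranspose, Matrix.conjTranspose_kronecker, hγ.skew,
      Matrix.conjTranspose_one, ← neg_one_smul ℂ, Matrix.kronecker_smul, neg_one_smul]
  · intro r
    rw [Matrix.star_eq_conjTranspose, Matrix.conjTranspose_kronecker, hγ.skew,
      hγ.grading_selfAdjoint, ← neg_one_smul ℂ, Matrix.smul_kronecker, neg_one_smul]
  · intro r l
    rw [← Matrix.mul_kronecker_mul, ← Matrix.mul_kronecker_mul, ← Matrix.kronecker_add,
      hγ.clifford]
    split_ifs
    · rw [one_mul, Matrix.kronecker_smul, Matrix.one_kronecker_one]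
    · rw [Matrix.kronecker_zero]
  · intro r l
    rw [← Matrix.mul_kronecker_mul, ← Matrix.mul_kronecker_mul, ← Matrix.add_kronecker,
      hγ.clifford, hγ.grading_sq]
    split_ifs
    · rw [Matrix.smul_kronecker, Matrix.one_kronecker_one]
    · rw [Matrix.zero_kronecker]
  · intro r l
    rw [← Matrix.mul_kronecker_mul, ← Matrix.mul_kronecker_mul, hγ.grading_anti, one_mul, mul_one,
      ← Matrix.kronecker_add, add_neg_cancel, Matrix.kronecker_zero]

theorem grading_fermion (r : Fin n) :
    (σ ⊗ₖ σ) * fermion γ σ s r = -(fermion γ σ s r * (σ ⊗ₖ σ)) := by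
  simp only [fermion, mul_smul_comm, smul_mul_assoc, mul_sub, sub_mul, ← Matrix.mul_kronecker_mul,
    hγ.grading_anti, mul_one, one_mul]
  rw [← neg_one_smul ℂ (γ r * σ), Matrix.kronecker_smul, Matrix.smul_kronecker]
  module

/-- Conjugation by `1 ⊗ σ` changes the sign of `1 ⊗ γ_r` and fixes `γ_r ⊗ σ`; on this combination,
with its factor `i`, taking adjoints does the same. -/
theorem hodge_fermion (hs : s = 1 ∨ s = -1) (r : Fin n) :
    ((1 : Matrix ν ν ℂ) ⊗ₖ σ) * fermion γ σ s r =
      star (fermion γ σ s r) * ((1 : Matrix ν ν ℂ) ⊗ₖ σ) := by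
  have hss : star s = s := by rcases hs with rfl | rfl <;> simp
  have h : star (fermion γ σ s r) =
      (1 / 2 : ℂ) • (-((1 : Matrix ν ν ℂ) ⊗ₖ γ r) - Complex.I • (-s • (γ r ⊗ₖ σ))) := by
    rw [fermion, star_smul, star_sub, star_smul, star_smul]
    simp only [Matrix.star_eq_conjTranspose, Matrix.conjTranspose_kronecker, hγ.skew,
      hγ.grading_selfAdjoint, Matrix.conjTranspose_one, star_neg, hss]
    rw [← neg_one_smul ℂ (γ r), Matrix.kronecker_smul, Matrix.smul_kronecker]
    simp
  rw [h, fermion]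
  simp only [mul_smul_comm, smul_mul_assoc, mul_sub, sub_mul, ← Matrix.mul_kronecker_mul,
    hγ.grading_anti, mul_one, one_mul, neg_mul]
  rw [← neg_one_smul ℂ (γ r * σ), Matrix.kronecker_smul]
  module

theorem isSelfAdjoint_grading : (σ ⊗ₖ σ).conjTranspose = σ ⊗ₖ σ := by
  rw [Matrix.conjTranspose_kronecker, hγ.grading_selfAdjoint]

theorem grading_mul_self : (σ ⊗ₖ σ) * (σ ⊗ₖ σ) = 1 := by
  rw [← Matrix.mul_kronecker_mul, hγ.grading_sq, Matrix.one_kronecker_one]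

theorem isSelfAdjoint_hodge : ((1 : Matrix ν ν ℂ) ⊗ₖ σ).conjTranspose = 1 ⊗ₖ σ := by
  rw [Matrix.conjTranspose_kronecker, hγ.grading_selfAdjoint, Matrix.conjTranspose_one]

theorem hodge_mul_self : ((1 : Matrix ν ν ℂ) ⊗ₖ σ) * (1 ⊗ₖ σ) = 1 := by
  rw [← Matrix.mul_kronecker_mul, hγ.grading_sq, one_mul, Matrix.one_kronecker_one]

/-- A Clifford sum squares to minus the square of the length of the vector. -/
theorem sum_smul_mul_self (c : Fin n → ℂ) :
    (∑ r, c r • γ r) * (∑ r, c r • γ r) = (-∑ r, c r * c r) • (1 : Matrix ν ν ℂ) := by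
  have h : (2 : ℂ) • ((∑ r, c r • γ r) * (∑ r, c r • γ r)) =
      (2 : ℂ) • (-∑ r, c r * c r) • (1 : Matrix ν ν ℂ) := by
    rw [two_smul]
    conv_lhs => arg 2; rw [Finset.sum_mul_sum, Finset.sum_comm]
    rw [Finset.sum_mul_sum, ← Finset.sum_add_distrib]
    have : ∀ r l, (c r • γ r) * (c l • γ l) + (c l • γ l) * (c r • γ r) =
        if r = l then (-2 * (c r * c r)) • (1 : Matrix ν ν ℂ) else 0 := by
      intro r l
      rw [smul_mul_smul_comm, smul_mul_smul_comm, mul_comm (c l), ← smul_add, hγ.clifford]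
      split_ifs with h
      · rw [h, smul_smul, mul_comm]
      · rw [smul_zero]
    simp only [← Finset.sum_add_distrib, this, Finset.sum_ite_eq, Finset.mem_univ, if_true]
    rw [← Finset.sum_smul, smul_smul, ← Finset.mul_sum]
    congr 1
    ring
  exact smul_right_injective _ (two_ne_zero' ℂ) h

end IsGradedClifford

/-! ### Orthogonal complex structures -/

section ComplexStructures

/-- The projection onto the `+i`-eigenspace of an orthogonal complex structure on `ℝ^ι`. -/
structure IsComplexPolarization {ι : Type*} [Fintype ι] [DecidableEq ι] (P : Matrix ι ι ℂ) :
    Prop where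
  selfAdjoint : P.conjTranspose = P
  idem : P * P = P
  transpose : P.transpose = 1 - P

namespace IsComplexPolarization

variable {ι : Type*} [Fintype ι] [DecidableEq ι] {P : Matrix ι ι ℂ} (hP : IsComplexPolarization P)

include hP

theorem transpose_transpose : IsComplexPolarization P.transpose where
  selfAdjoint := by
    rw [hP.transpose, Matrix.conjTranspose_sub, Matrix.conjTranspose_one, hP.selfAdjoint]
  idem := by rw [← Matrix.transpose_mul, hP.idem]
  transpose := by rw [Matrix.transpose_transpose, hP.transpose, sub_sub_cancel]

theorem mul_transpose : P * P.transpose = 0 := by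
  rw [hP.transpose, mul_sub, mul_one, hP.idem, sub_self]

theorem transpose_mul : P.transpose * P = 0 := by
  rw [hP.transpose, sub_mul, one_mul, hP.idem, sub_self]

theorem add_transpose : P + P.transpose = 1 := by
  rw [hP.transpose, add_sub_cancel]

/-- The pairing is bilinear, without conjugation, so `P` and `Pᵀ` have the same quadratic form, and
the two forms add up to `c ⬝ᵥ c`. -/
theorem dotProduct_mulVec (c : ι → ℂ) : c ⬝ᵥ P.mulVec c = (1 / 2) * (c ⬝ᵥ c) := by
  have h : c ⬝ᵥ P.mulVec c = c ⬝ᵥ P.transpose.mulVec c := by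
    rw [Matrix.dotProduct_mulVec, ← Matrix.mulVec_transpose, dotProduct_comm]
  rw [hP.transpose, Matrix.sub_mulVec, Matrix.one_mulVec, dotProduct_sub] at h
  linear_combination h / 2

end IsComplexPolarization

-- Extend `u, w` to an orthonormal basis arranged in `k` pairs, with `(u, w)` as one of them. The
-- complex vectors `b + i b'` formed from the pairs `(b, b')` are the columns of `Z`, and `P = Z Z*
-- / 2` is the projection onto their span.
open Complex in
theorem exists_polarization {k : ℕ} (hk : 0 < k)
    {u w : EuclideanSpace ℝ (Fin (2 * k))} (hu : ‖u‖ = 1) (hw : ‖w‖ = 1) (huw : ⟪u, w⟫_ℝ = 0) :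
    ∃ P : Matrix (Fin (2 * k)) (Fin (2 * k)) ℂ, IsComplexPolarization P ∧
      ∀ r, P.mulVec (fun l => (u l : ℂ)) r = (1 / 2 : ℂ) * (u r + I * w r) := by
  classical
  let z : Fin k := ⟨0, hk⟩
  let v : Fin k ⊕ Fin k → EuclideanSpace ℝ (Fin (2 * k)) := Sum.elim (fun _ => u) (fun _ => w)
  have hv : Orthonormal ℝ (({Sum.inl z, Sum.inr z} : Set (Fin k ⊕ Fin k)).restrict v) := by
    rw [orthonormal_iff_ite]
    rintro ⟨i, rfl | rfl⟩ ⟨j, rfl | rfl⟩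
    · simp [v, Set.restrict, hu]
    · simp [v, Set.restrict, huw, Subtype.ext_iff]
    · simp [v, Set.restrict, real_inner_comm, huw, Subtype.ext_iff]
    · simp [v, Set.restrict, hw]
  obtain ⟨b, hb⟩ := hv.exists_orthonormalBasis_extension_of_card_eq (by simp; ring)
  have hbu : b (Sum.inl z) = u := hb _ (by simp)
  have hbw : b (Sum.inr z) = w := hb _ (by simp)
  let Z : Matrix (Fin (2 * k)) (Fin k) ℂ :=
    Matrix.of fun l j => b (Sum.inl j) l + I * b (Sum.inr j) l
  have hinner : ∀ x y : EuclideanSpace ℝ (Fin (2 * k)), ∑ l, (x l : ℂ) * (y l : ℂ) = (⟪x, y⟫_ℝ : ℝ) := by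
    intro x y
    simp [PiLp.inner_apply, mul_comm]
  have hort : ∀ i j, (⟪b i, b j⟫_ℝ : ℝ) = if i = j then 1 else 0 :=
    orthonormal_iff_ite.1 b.orthonormal
  have hZstar : ∀ j l, Z.conjTranspose j l = b (Sum.inl j) l - I * b (Sum.inr j) l := by
    intro j l
    simp [Z, Matrix.conjTranspose_apply, sub_eq_add_neg]
  have hZZ : Z.conjTranspose * Z = (2 : ℂ) • 1 := by
    ext i j
    rw [Matrix.mul_apply]
    have : ∀ l, Z.conjTranspose i l * Z l j =
        ((b (Sum.inl i) l : ℂ) * b (Sum.inl j) l + (b (Sum.inr i) l : ℂ) * b (Sum.inr j) l) +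
        I * ((b (Sum.inl i) l : ℂ) * b (Sum.inr j) l - (b (Sum.inr i) l : ℂ) * b (Sum.inl j) l) := by
      intro l
      rw [hZstar, show Z l j = b (Sum.inl j) l + I * b (Sum.inr j) l from rfl]
      linear_combination (-(b (Sum.inr i) l : ℂ) * (b (Sum.inr j) l : ℂ)) * I_mul_I
    simp only [this, Finset.sum_add_distrib, ← Finset.mul_sum, Finset.sum_sub_distrib, hinner, hort]
    by_cases h : i = j
    · subst h; simp; norm_num
    · simp [h]
  -- Completeness of the basis. Since `P` is Hermitian, `P + Pᵀ` is twice its real part, and this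
  -- sum identifies that with the identity matrix.
  have hsum : ∀ l r, ∑ i, (b i l : ℂ) * (b i r : ℂ) = if l = r then 1 else 0 := by
    intro l r
    have h := b.sum_inner_mul_inner (EuclideanSpace.single l 1) (EuclideanSpace.single r 1)
    simp only [EuclideanSpace.inner_single_left, EuclideanSpace.inner_single_right] at h
    have h' := congrArg (fun t : ℝ => (t : ℂ)) h
    simp only [map_one, one_mul, mul_one, conj_trivial] at h'
    push_cast at h'
    rw [h']
    by_cases hlr : l = r <;> simp [hlr, eq_comm]
  refine ⟨(1 / 2 : ℂ) • (Z * Z.conjTranspose), ⟨?_, ?_, ?_⟩, ?_⟩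
  · rw [Matrix.conjTranspose_smul, Matrix.conjTranspose_mul, Matrix.conjTranspose_conjTranspose]
    congr 1
    simp
  · rw [smul_mul_smul_comm, ← Matrix.mul_assoc, Matrix.mul_assoc Z, hZZ, Matrix.mul_smul,
      Matrix.mul_one, Matrix.smul_mul, smul_smul]
    norm_num
  · ext l r
    have h1 : ∀ l r, (Z * Z.conjTranspose) l r =
        ∑ j, ((b (Sum.inl j) l : ℂ) + I * b (Sum.inr j) l) *
          (b (Sum.inl j) r - I * b (Sum.inr j) r) := by
      intro l r
      rw [Matrix.mul_apply]
      simp only [hZstar]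
      rfl
    have h2 := hsum l r
    rw [Fintype.sum_sum_type, ← Finset.sum_add_distrib] at h2
    rw [Matrix.transpose_apply, Matrix.sub_apply, Matrix.smul_apply, Matrix.smul_apply, h1, h1,
      Matrix.one_apply, ← h2, smul_eq_mul, smul_eq_mul, Finset.mul_sum, Finset.mul_sum,
      ← Finset.sum_sub_distrib]
    refine Finset.sum_congr rfl fun j _ => ?_
    linear_combination (-(b (Sum.inr j) l : ℂ) * (b (Sum.inr j) r : ℂ)) * I_mul_I
  · intro r
    have h1 : Z.conjTranspose.mulVec (fun l => (u l : ℂ)) = Pi.single z 1 := by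
      funext j
      rw [Matrix.mulVec, dotProduct]
      simp only [hZstar, sub_mul, Finset.sum_sub_distrib, mul_assoc, ← Finset.mul_sum, hinner]
      rw [← hbu, hort, hort]
      by_cases h : j = z
      · subst h; simp
      · simp [h]
    rw [Matrix.smul_mulVec, ← Matrix.mulVec_mulVec, h1, Pi.smul_apply, Matrix.mulVec_single_one]
    simp [Z, hbu, hbw]

open Complex in
/-- There are arbitrarily many orthogonal complex structures that differ on a given nonzero
vector, if the dimension is at least `4`. -/
theorem exists_polarization_family (k M : ℕ) (hM : M ≤ 1 ∨ 2 ≤ k) (v : Fin (2 * k) → ℝ)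
    (hv : 0 < k → v ≠ 0) :
    ∃ P : Fin M → Matrix (Fin (2 * k)) (Fin (2 * k)) ℂ, (∀ m, IsComplexPolarization (P m)) ∧
      Function.Injective fun m => (P m).mulVec fun l => (v l : ℂ) := by
  classical
  rcases Nat.eq_zero_or_pos k with rfl | hk
  · refine ⟨fun _ => 0, fun _ => ⟨?_, ?_, ?_⟩, ?_⟩
    · ext i; exact i.elim0
    · ext i; exact i.elim0
    · ext i; exact i.elim0
    · have : M ≤ 1 := by omega
      have : Subsingleton (Fin M) := Fin.subsingleton_iff_le_one.2 this
      exact Function.injective_of_subsingleton _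
  let x : EuclideanSpace ℝ (Fin (2 * k)) := WithLp.toLp 2 v
  have hx : x ≠ 0 := fun h => hv hk (by simpa [x] using h)
  have hx0 : ‖x‖ ≠ 0 := norm_ne_zero_iff.2 hx
  let u := (‖x‖⁻¹ : ℝ) • x
  have hu : ‖u‖ = 1 := by rw [norm_smul, norm_inv, norm_norm, inv_mul_cancel₀ hx0]
  have hxu : ∀ l, v l = ‖x‖ * u l := by
    intro l; simp [u, x, hx0]
  have hort : Orthonormal ℝ (({⟨0, by omega⟩} : Set (Fin (2 * k))).restrict fun _ => u) := by
    rw [orthonormal_iff_ite]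
    rintro ⟨i, rfl⟩ ⟨j, rfl⟩
    simp [Set.restrict, hu]
  obtain ⟨b, hb⟩ := hort.exists_orthonormalBasis_extension_of_card_eq (by simp)
  have hb0 : b ⟨0, by omega⟩ = u := hb _ rfl
  have hbo : ∀ i j, (⟪b i, b j⟫_ℝ : ℝ) = if i = j then 1 else 0 :=
    orthonormal_iff_ite.1 b.orthonormal
  obtain ⟨w, hw1, hw2, hw3⟩ : ∃ w : Fin M → EuclideanSpace ℝ (Fin (2 * k)),
      (∀ m, ‖w m‖ = 1) ∧ (∀ m, ⟪u, w m⟫_ℝ = 0) ∧ Function.Injective w := by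
    rcases hM with hM | hM
    · have : Subsingleton (Fin M) := Fin.subsingleton_iff_le_one.2 hM
      refine ⟨fun _ => b ⟨1, by omega⟩, fun _ => b.orthonormal.1 _, fun _ => ?_,
        Function.injective_of_subsingleton _⟩
      rw [← hb0, hbo]; simp
    -- In dimension at least `4` the orthogonal complement of `u` contains two orthonormal vectors,
    -- and `w` runs through points of the circle they span. The angles lie in `[0, 1) ⊆ [0, π]`,
    -- where the cosine is injective.
    · let θ : Fin M → ℝ := fun m => (m : ℝ) / M
      have hθ : ∀ m, θ m ∈ Set.Icc 0 Real.pi := fun m => by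
        have hm : (m : ℝ) < M := by exact_mod_cast m.2
        have hM0 : (0 : ℝ) < M := lt_of_le_of_lt (by positivity) hm
        refine ⟨by positivity, ?_⟩
        have : θ m ≤ 1 := (div_le_one hM0).2 hm.le
        linarith [Real.pi_gt_three]
      refine ⟨fun m => Real.cos (θ m) • b ⟨1, by omega⟩ + Real.sin (θ m) • b ⟨2, by omega⟩,
        fun m => ?_, fun m => ?_, fun m m' h => ?_⟩
      · rw [← sq_eq_sq₀ (norm_nonneg _) zero_le_one, ← real_inner_self_eq_norm_sq]
        simp only [inner_add_left, inner_add_right, inner_smul_left, inner_smul_right, hbo]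
        simp
        nlinarith [Real.sin_sq_add_cos_sq (θ m)]
      · rw [← hb0]
        simp [inner_add_right, inner_smul_right, hbo]
      · have h1 := congrArg (fun z => ⟪b ⟨1, by omega⟩, z⟫_ℝ) h
        simp only [inner_add_right, inner_smul_right, hbo] at h1
        simp at h1
        have h2 : θ m = θ m' := Real.injOn_cos (hθ m) (hθ m') h1
        have hm : (m : ℝ) < M := by exact_mod_cast m.2
        have hM0 : (M : ℝ) ≠ 0 := (lt_of_le_of_lt (by positivity) hm).ne'
        have h3 : (m : ℝ) = m' := (div_left_inj' hM0).1 h2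
        exact Fin.ext (by exact_mod_cast h3)
  choose P hP hPu using fun m => exists_polarization hk hu (hw1 m) (hw2 m)
  refine ⟨P, hP, fun m m' h => hw3 ?_⟩
  have hPv : ∀ m r, (P m).mulVec (fun l => (v l : ℂ)) r =
      ‖x‖ * ((1 / 2 : ℂ) * (u r + I * w m r)) := by
    intro m r
    have e : (fun l => (v l : ℂ)) = (‖x‖ : ℂ) • fun l => (u l : ℂ) := by
      funext l
      rw [hxu]
      simp
    rw [← hPu, e, Matrix.mulVec_smul, Pi.smul_apply, smul_eq_mul]
  ext r
  have h1 := congrFun h r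
  simp only [hPv] at h1
  have h2 : (‖x‖ : ℂ) ≠ 0 := by exact_mod_cast hx0
  have h3 := mul_left_cancel₀ (by norm_num : (1 / 2 : ℂ) ≠ 0) (mul_left_cancel₀ h2 h1)
  have h4 := mul_left_cancel₀ I_ne_zero (add_left_cancel h3)
  exact_mod_cast h4

end ComplexStructures

/-! ### The number of perfect matchings of a complete graph -/

section Matchings

open SimpleGraph Equiv.Perm

variable {V : Type*} [Fintype V] [DecidableEq V]

/-- Perfect matchings of the complete graph are the same as fixed point free involutions. -/
theorem card_perfectMatching_top :
    Nat.card {M : (⊤ : SimpleGraph V).Subgraph // M.IsPerfectMatching} =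
      Nat.card {f : Equiv.Perm V // (∀ v, f (f v) = v) ∧ ∀ v, f v ≠ v} := by
  symm
  let F : {f : Equiv.Perm V // (∀ v, f (f v) = v) ∧ ∀ v, f v ≠ v} →
      {M : (⊤ : SimpleGraph V).Subgraph // M.IsPerfectMatching} := fun f =>
    ⟨{ verts := Set.univ
       Adj := fun v w => f.1 v = w
       adj_sub := by
        rintro v w rfl
        exact (f.2.2 v).symm
       edge_vert := fun _ => Set.mem_univ _
       symm := ⟨by
        rintro v w rfl
        exact f.2.1 v⟩ },
      Subgraph.isPerfectMatching_iff.2 fun v => ⟨f.1 v, rfl, fun w hw => (show f.1 v = w from hw).symm⟩⟩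
  refine Nat.card_congr (Equiv.ofBijective F ⟨?_, ?_⟩)
  · intro f g h
    apply Subtype.ext
    ext v
    have h1 : (F g).1.Adj v (f.1 v) := by
      rw [← h]
    exact (show g.1 v = f.1 v from h1).symm
  · rintro ⟨M, hM⟩
    choose p hp hp' using Subgraph.isPerfectMatching_iff.1 hM
    have hpp : ∀ v, p (p v) = v := fun v => (hp' (p v) v (M.symm.symm _ _ (hp v))).symm
    refine ⟨⟨⟨p, p, hpp, hpp⟩, hpp, fun v h => (M.adj_sub (hp v)).ne h.symm⟩, ?_⟩
    apply Subtype.ext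
    refine Subgraph.ext ?_ ?_
    · exact (Subgraph.isSpanning_iff.1 hM.2).symm
    · funext v w
      refine propext ⟨?_, fun h => (hp' v w h).symm⟩
      rintro (rfl : p v = w)
      exact hp v

theorem cycleType_eq_replicate_two_iff {k : ℕ} (hV : Fintype.card V = 2 * k) (f : Equiv.Perm V) :
    f.cycleType = Multiset.replicate k 2 ↔ (∀ v, f (f v) = v) ∧ ∀ v, f v ≠ v := by
  constructor
  · intro h
    constructor
    · have h1 : f ^ 2 = 1 := by
        rw [← orderOf_dvd_iff_pow_eq_one, ← lcm_cycleType, h]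
        exact Multiset.lcm_dvd.2 fun b hb => by rw [Multiset.eq_of_mem_replicate hb]
      intro v
      simpa [sq] using congrArg (fun g : Equiv.Perm V => g v) h1
    · have h1 := f.sum_cycleType
      rw [h, Multiset.sum_replicate, smul_eq_mul] at h1
      have h2 : f.support = Finset.univ := by
        rw [← Finset.card_eq_iff_eq_univ, ← h1, hV, mul_comm]
      intro v
      rw [← Equiv.Perm.mem_support, h2]
      exact Finset.mem_univ v
  · rintro ⟨h1, h2⟩
    have h3 : f ^ 2 = 1 := by
      ext v
      simp [sq, h1]
    have : Fact (Nat.Prime 2) := ⟨Nat.prime_two⟩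
    have h4 := cycleType_of_pow_prime_eq_one h3
    have h5 := f.sum_cycleType
    have h6 : f.support = Finset.univ := by
      ext v
      simpa using h2 v
    rw [h4, Multiset.sum_replicate, smul_eq_mul, h6, Finset.card_univ, hV] at h5
    rw [h4]
    congr 1
    omega

theorem prod_odd_eq_doubleFactorial (k : ℕ) :
    ∏ j ∈ (Finset.Icc 1 (2 * k)).filter Odd, (2 * k - j) = ∏ i ∈ Finset.range k, (2 * i + 1) := by
  symm
  refine Finset.prod_bij (fun i _ => 2 * k - (2 * i + 1)) ?_ ?_ ?_ ?_
  · intro i hi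
    rw [Finset.mem_range] at hi
    rw [Finset.mem_filter, Finset.mem_Icc]
    refine ⟨by omega, ⟨k - i - 1, by omega⟩⟩
  · intro i hi j hj h
    rw [Finset.mem_range] at hi hj
    omega
  · intro j hj
    rw [Finset.mem_filter, Finset.mem_Icc] at hj
    obtain ⟨hj, m, hm⟩ := hj
    exact ⟨k - m - 1, Finset.mem_range.2 (by omega), by omega⟩
  · intro i hi
    rw [Finset.mem_range] at hi
    omega

/-- Fixed point free involutions are the permutations with `k` cycles of length two; the conjugacy
class formula counts `(2k)! / (2^k k!)` of them. -/
theorem card_perfectMatching (k : ℕ) :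
    Nat.card {M : (⊤ : SimpleGraph (Fin (2 * k))).Subgraph // M.IsPerfectMatching} =
      ∏ j ∈ (Finset.Icc 1 (2 * k)).filter Odd, (2 * k - j) := by
  classical
  rw [card_perfectMatching_top, prod_odd_eq_doubleFactorial]
  have hV : Fintype.card (Fin (2 * k)) = 2 * k := Fintype.card_fin _
  have h1 : Nat.card {f : Equiv.Perm (Fin (2 * k)) // (∀ v, f (f v) = v) ∧ ∀ v, f v ≠ v} =
      (Finset.univ.filter fun f : Equiv.Perm (Fin (2 * k)) =>
        f.cycleType = Multiset.replicate k 2).card := by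
    rw [Nat.card_eq_fintype_card, Fintype.card_subtype]
    congr 1
    ext f
    simp only [Finset.mem_filter, cycleType_eq_replicate_two_iff hV]
  rw [h1]
  have h2 := card_of_cycleType_mul_eq (α := Fin (2 * k)) (Multiset.replicate k 2)
  have h3 : (Multiset.replicate k 2).sum = 2 * k := by
    rw [Multiset.sum_replicate, smul_eq_mul, mul_comm]
  rw [if_pos ⟨by rw [h3, hV], fun a ha => (Multiset.eq_of_mem_replicate ha).ge⟩, h3, hV,
    Nat.sub_self, Nat.factorial_zero, one_mul, Multiset.prod_replicate] at h2
  have h4 : ∏ n ∈ (Multiset.replicate k 2).toFinset, ((Multiset.replicate k 2).count n).factorial =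
      k.factorial := by
    rcases Nat.eq_zero_or_pos k with rfl | hk
    · simp
    · rw [Multiset.toFinset_replicate, if_neg hk.ne', Finset.prod_singleton,
        Multiset.count_replicate_self]
  rw [h4] at h2
  -- What remains is `(2k - 1)!! · 2^k · k! = (2k)!`, proved by induction on `k`.
  refine Nat.eq_of_mul_eq_mul_right (by positivity : 0 < 2 ^ k * k.factorial) (h2.trans ?_)
  clear h1 h2 h3 h4 hV
  induction k with
  | zero => simp
  | succ k ih =>
    rw [Finset.prod_range_succ, mul_add, mul_one, Nat.factorial_succ, Nat.factorial_succ, ih,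
      pow_succ, Nat.factorial_succ]
    ring

end Matchings

namespace CStarDynamicalSystem

/-! ### The derivations of a `C*`-dynamical system -/

section Derivations

variable {E : Type*} [NormedAddCommGroup E] [NormedSpace ℝ E]
variable {G : Type*} [CommGroup G] [TopologicalSpace G] [ChartedSpace E G]
variable {A : Type*} [CStarAlgebra A] [PartialOrder A] [StarOrderedRing A]
variable (S : CStarDynamicalSystem G A)

/-- The automorphism `α_g` as a continuous linear map. -/
def αL (g : G) : A →L[ℂ] A :=
  LinearMap.mkContinuous (S.α g : A →ₗ[ℂ] A) 1 fun a => by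
    rw [one_mul]
    exact (StarAlgEquiv.norm_map (S.α g) a).le

theorem α_mul_apply (g h : G) (a : A) : S.α (g * h) a = S.α g (S.α h a) := by
  rw [map_mul]; rfl

theorem α_one_apply (a : A) : S.α 1 a = a := by
  rw [map_one]; rfl

theorem α_comm (g h : G) (a : A) : S.α g (S.α h a) = S.α h (S.α g a) := by
  rw [← α_mul_apply, mul_comm, α_mul_apply]

theorem α_mem_smooth (g : G) {a : A} (ha : a ∈ S.smooth E) : S.α g a ∈ S.smooth E := by
  have h := ((S.αL g).restrictScalars ℝ).contDiff (n := ∞) |>.contMDiff.comp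
    (show ContMDiff 𝓘(ℝ, E) 𝓘(ℝ, A) ∞ fun h => S.α h a from ha)
  change ContMDiff 𝓘(ℝ, E) 𝓘(ℝ, A) ∞ fun h => S.α h (S.α g a)
  convert h using 1
  funext h
  exact S.α_comm h g a

/-- Commutativity of `G` enters here: `α_h α_g = α_g α_h`, so `α_g` can be pulled out of the
derivative. -/
theorem derivation_α (X : GroupLieAlgebra 𝓘(ℝ, E) G) (g : G) (a : S.smooth E) :
    S.derivation X ⟨S.α g a, S.α_mem_smooth g a.2⟩ = S.α g (S.derivation X a) := by
  have h := (((S.αL g).restrictScalars ℝ).hasMFDerivAt (x := S.α 1 (a : A))).comp (1 : G)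
    (S.hasMFDerivAt_orbit a)
  have e : (fun h => S.α h (S.α g (a : A))) =
      ((S.αL g).restrictScalars ℝ) ∘ fun h => S.α h (a : A) := by
    funext h
    exact S.α_comm h g a
  change mfderiv 𝓘(ℝ, E) 𝓘(ℝ, A) (fun h => S.α h (S.α g (a : A))) 1 X = _
  rw [e, h.mfderiv]
  rfl

theorem derivation_mul (X : GroupLieAlgebra 𝓘(ℝ, E) G) (a b : S.smooth E) :
    S.derivation X (a * b) = S.derivation X a * b + a * S.derivation X b := by
  have h := (S.hasMFDerivAt_orbit a).mul' (S.hasMFDerivAt_orbit b)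
  have e : (fun g => S.α g ((a * b : S.smooth E) : A)) =
      (fun g => S.α g (a : A)) * fun g => S.α g (b : A) := by
    funext g; simp
  change mfderiv 𝓘(ℝ, E) 𝓘(ℝ, A) (fun g => S.α g ((a * b : S.smooth E) : A)) 1 X = _
  rw [e, h.mfderiv, add_comm]
  simp only [α_one_apply]
  rfl

variable [LieGroup 𝓘(ℝ, E) ∞ G]

/-- The orbit of `∂_X a` at `g` is the partial derivative at `h = 1`, in the direction `X`, of the
jointly smooth map `(g, h) ↦ α_{gh} a`; such a partial derivative is smooth in `g`. -/
theorem derivation_mem_smooth (X : GroupLieAlgebra 𝓘(ℝ, E) G) (a : S.smooth E) :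
    S.derivation X a ∈ S.smooth E := by
  have : IsManifold 𝓘(ℝ, E) 1 G := IsManifold.of_le (n := ∞) (by simp)
  have ha : ContMDiff 𝓘(ℝ, E) 𝓘(ℝ, A) ∞ fun h => S.α h (a : A) := a.2
  change ContMDiff 𝓘(ℝ, E) 𝓘(ℝ, A) ∞ fun g => S.α g (S.derivation X a)
  intro g₀
  have hf : ContMDiff (𝓘(ℝ, E).prod 𝓘(ℝ, E)) 𝓘(ℝ, A) ∞
      (Function.uncurry fun g h : G => S.α (g * h) (a : A)) :=
    ha.comp (contMDiff_mul 𝓘(ℝ, E) ∞)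
  have h := ContMDiffAt.mfderiv_apply (x₀ := g₀) (I := 𝓘(ℝ, E)) (I' := 𝓘(ℝ, A)) (m := ∞) (n := ∞)
    (fun g h : G => S.α (g * h) (a : A)) (fun _ => (1 : G)) id (fun _ => (X : E))
    hf.contMDiffAt contMDiffAt_const contMDiffAt_id contMDiffAt_const (by simp)
  convert h using 1
  funext g
  have h2 := (((S.αL g).restrictScalars ℝ).hasMFDerivAt (x := S.α 1 (a : A))).comp (1 : G)
    (S.hasMFDerivAt_orbit a)
  have e : (fun h => S.α (g * h) (a : A)) =
      ((S.αL g).restrictScalars ℝ) ∘ fun h => S.α h (a : A) := by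
    funext h
    exact S.α_mul_apply g h a
  have h3 : (tangentBundleCore 𝓘(ℝ, E) G).coordChange (achart E (1 : G)) (achart E (1 : G)) 1
      (X : E) = X := (tangentBundleCore 𝓘(ℝ, E) G).coordChange_self _ _ (by simp) _
  -- The base point in the source is constantly `1` and the target is a vector space, so both
  -- coordinate changes are trivial.
  have key : ∀ φ : G → E →L[ℝ] A, inTangentCoordinates 𝓘(ℝ, E) 𝓘(ℝ, A) (fun _ : G => (1 : G))
      (fun g : G => S.α (g * 1) (a : A)) φ g₀ g (X : E) = φ g (X : E) := by
    intro φ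
    rw [inTangentCoordinates_eq (f := fun _ : G => (1 : G)) (g := fun g : G => S.α (g * 1) (a : A))
      φ (by simp) (by rw [chartAt_self_eq]; exact Set.mem_univ _)]
    simp only [ContinuousLinearMap.comp_apply, tangentBundleCore_coordChange_model_space]
    exact congrArg (φ g) h3
  refine Eq.trans ?_ (key _).symm
  have h4 : mfderiv 𝓘(ℝ, E) 𝓘(ℝ, A) (fun h => S.α (g * h) (a : A)) 1 X =
      S.α g (S.derivation X a) := by
    rw [e, h2.mfderiv]
    rfl
  exact h4.symm

/-- The derivation attached to `X`, as a linear endomorphism of the smooth subalgebra. -/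
def smoothDerivation (X : GroupLieAlgebra 𝓘(ℝ, E) G) : S.smooth E →ₗ[ℂ] S.smooth E :=
  (S.derivation X).codRestrict (S.smooth E).toSubalgebra.toSubmodule (S.derivation_mem_smooth X)

@[simp] theorem coe_smoothDerivation (X : GroupLieAlgebra 𝓘(ℝ, E) G) (a : S.smooth E) :
    (S.smoothDerivation X a : A) = S.derivation X a := rfl

/-- If all derivations vanish on a smooth element, then it is invariant. -/
theorem α_eq_of_derivation_eq_zero [ConnectedSpace G] (a : S.smooth E)
    (ha : ∀ X : GroupLieAlgebra 𝓘(ℝ, E) G, S.derivation X a = 0) (g : G) :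
    S.α g (a : A) = a := by
  have hs : ContMDiff 𝓘(ℝ, E) 𝓘(ℝ, A) ∞ fun h => S.α h (a : A) := a.2
  -- By homogeneity the differential of the orbit map at `g` is its differential at `1` composed
  -- with the differential of a translation and followed by `α_g`.
  have h0 : ∀ g, mfderiv 𝓘(ℝ, E) 𝓘(ℝ, A) (fun h => S.α h (a : A)) g = 0 := by
    intro g
    have hl : HasMFDerivAt 𝓘(ℝ, E) 𝓘(ℝ, E) (fun h : G => g⁻¹ * h) g _ :=
      ((contMDiff_mul_left (I := 𝓘(ℝ, E)) (n := ∞) (a := g⁻¹)).mdifferentiable (by simp)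
        g).hasMFDerivAt
    have h1 : HasMFDerivAt 𝓘(ℝ, E) 𝓘(ℝ, A) (fun h => S.α h (a : A)) (g⁻¹ * g)
        (mfderiv 𝓘(ℝ, E) 𝓘(ℝ, A) (fun h => S.α h (a : A)) (g⁻¹ * g)) :=
      (hs.mdifferentiable (by simp) _).hasMFDerivAt
    have h2 := (((S.αL g).restrictScalars ℝ).hasMFDerivAt (x := S.α (g⁻¹ * g) (a : A))).comp g
      (h1.comp g hl)
    have e : (fun h => S.α h (a : A)) = ((S.αL g).restrictScalars ℝ) ∘
        ((fun h => S.α h (a : A)) ∘ fun h => g⁻¹ * h) := by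
      funext h
      change S.α h (a : A) = S.α g (S.α (g⁻¹ * h) (a : A))
      rw [← α_mul_apply, mul_inv_cancel_left]
    rw [e, h2.mfderiv]
    ext v
    have h3 : ∀ (x : G) (hx : x = 1) (w : TangentSpace 𝓘(ℝ, E) x),
        mfderiv 𝓘(ℝ, E) 𝓘(ℝ, A) (fun h => S.α h (a : A)) x w = 0 := by
      rintro x rfl w
      exact ha w
    change S.αL g (mfderiv 𝓘(ℝ, E) 𝓘(ℝ, A) (fun h => S.α h (a : A)) (g⁻¹ * g) _) = 0
    rw [h3 _ (inv_mul_cancel g)]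
    exact map_zero _
  have hloc : IsLocallyConstant fun h : G => S.α h (a : A) := by
    rw [IsLocallyConstant.iff_eventually_eq]
    intro x
    let φ := extChartAt 𝓘(ℝ, E) x
    have hopen : IsOpen φ.target := isOpen_extChartAt_target x
    have hd : DifferentiableOn ℝ ((fun h => S.α h (a : A)) ∘ φ.symm) φ.target := by
      intro y hy
      have h1 := (hs.mdifferentiable (by simp) (φ.symm y)).comp_mdifferentiableWithinAt y
        ((mdifferentiableOn_extChartAt_symm (I := 𝓘(ℝ, E)) (x := x)) y hy)
      exact h1.differentiableWithinAt
    have hz : φ.target.EqOn (fderiv ℝ ((fun h => S.α h (a : A)) ∘ φ.symm)) 0 := by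
      intro y hy
      have h1 : MDifferentiableAt 𝓘(ℝ, E) 𝓘(ℝ, E) φ.symm y :=
        ((mdifferentiableOn_extChartAt_symm (I := 𝓘(ℝ, E)) (x := x)) y hy).mdifferentiableAt
          (hopen.mem_nhds hy)
      have h2 := ((hs.mdifferentiable (by simp) (φ.symm y)).hasMFDerivAt).comp y h1.hasMFDerivAt
      rw [← mfderiv_eq_fderiv, h2.mfderiv, h0]
      exact ContinuousLinearMap.zero_comp _
    have hev := hopen.isOpen_inter_preimage_of_fderiv_eq_zero hd hz {S.α x (a : A)}
    have hmem : φ x ∈ φ.target ∩ ((fun h => S.α h (a : A)) ∘ φ.symm) ⁻¹' {S.α x (a : A)} :=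
      ⟨mem_extChartAt_target x, by
        change S.α (φ.symm (φ x)) (a : A) = _
        rw [extChartAt_to_inv]⟩
    have h4 : ∀ᶠ y in nhds x, φ y ∈ φ.target ∩
        ((fun h => S.α h (a : A)) ∘ φ.symm) ⁻¹' {S.α x (a : A)} :=
      (continuousAt_extChartAt x).eventually (hev.mem_nhds hmem)
    filter_upwards [h4, extChartAt_source_mem_nhds (I := 𝓘(ℝ, E)) x] with y hy hy'
    have h5 : S.α (φ.symm (φ y)) (a : A) = S.α x (a : A) := hy.2
    rwa [φ.left_inv hy'] at h5
  have := hloc.apply_eq_of_isPreconnected isPreconnected_univ (Set.mem_univ g) (Set.mem_univ 1)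
  rwa [α_one_apply] at this

end Derivations

/-! ### The unitary representation on the GNS space -/

section Unitary

variable {G : Type*} [CommGroup G] [TopologicalSpace G]
variable {A : Type*} [CStarAlgebra A] [PartialOrder A] [StarOrderedRing A]
variable (S : CStarDynamicalSystem G A)

theorem inner_toL2 (a b : A) : ⟪S.toL2 a, S.toL2 b⟫_ℂ = S.τ (star a * b) := by
  change ⟪((S.τ.toPreGNS a : S.τ.PreGNS) : S.τ.GNS), ((S.τ.toPreGNS b : S.τ.PreGNS) : S.τ.GNS)⟫_ℂ = _
  rw [UniformSpace.Completion.inner_coe, PositiveLinearMap.preGNS_inner_def]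
  rfl

theorem denseRange_toL2 : DenseRange S.toL2 :=
  UniformSpace.Completion.denseRange_coe (α := S.τ.PreGNS)

theorem gns_toL2 (a b : A) : S.τ.gnsStarAlgHom a (S.toL2 b) = S.toL2 (a * b) :=
  PositiveLinearMap.gnsNonUnitalStarAlgHom_apply_coe S.τ

theorem exists_norm_toL2_le : ∃ C : ℝ, ∀ a, ‖S.toL2 a‖ ≤ C * ‖a‖ := by
  obtain ⟨C, hC⟩ := S.τ.exists_norm_apply_le
  refine ⟨Real.sqrt (C : ℝ), fun a => ?_⟩
  refine le_of_sq_le_sq ?_ (by positivity)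
  have h1 : ‖S.toL2 a‖ ^ 2 = ‖S.τ (star a * a)‖ := by
    rw [← inner_toL2, inner_self_eq_norm_sq_to_K]
    simp
  rw [h1, mul_pow, Real.sq_sqrt C.coe_nonneg]
  refine (hC _).trans (le_of_eq ?_)
  rw [CStarRing.norm_star_mul_self, sq]

/-- The embedding of `A` into the GNS space as a continuous linear map. -/
def toL2L : A →L[ℂ] S.τ.GNS :=
  S.toL2.mkContinuousOfExistsBound S.exists_norm_toL2_le

theorem norm_toPreGNS_α (g : G) (a : S.τ.PreGNS) :
    ‖S.τ.toPreGNS (S.α g (S.τ.ofPreGNS a))‖ = ‖a‖ := by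
  rw [PositiveLinearMap.preGNS_norm_def, PositiveLinearMap.preGNS_norm_def]
  simp [← map_star, ← map_mul, S.invariant]

/-- The unitary operators on the GNS space implementing the action. -/
def U (g : G) : S.τ.GNS →L[ℂ] S.τ.GNS :=
  (LinearMap.mkContinuous (S.τ.toPreGNS.toLinearMap ∘ₗ (S.αL g).toLinearMap ∘ₗ
    S.τ.ofPreGNS.toLinearMap) 1 fun a => by
      rw [one_mul]
      exact (S.norm_toPreGNS_α g a).le).completion

theorem U_toL2 (g : G) (a : A) : S.U g (S.toL2 a) = S.toL2 (S.α g a) := by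
  change S.U g ((S.τ.toPreGNS a : S.τ.PreGNS) : S.τ.GNS) = _
  rw [U, ContinuousLinearMap.completion_apply_coe]
  rfl

theorem ext_toL2 {F : Type*} [NormedAddCommGroup F] [NormedSpace ℂ F] {T T' : S.τ.GNS →L[ℂ] F}
    (h : ∀ a, T (S.toL2 a) = T' (S.toL2 a)) : T = T' := by
  refine ContinuousLinearMap.coeFn_injective ?_
  exact S.denseRange_toL2.equalizer T.continuous T'.continuous (funext h)

theorem U_mul (g h : G) (x : S.τ.GNS) : S.U (g * h) x = S.U g (S.U h x) := by
  have : S.U (g * h) = S.U g ∘L S.U h := S.ext_toL2 fun a => by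
    simp [U_toL2, α_mul_apply]
  rw [this]; rfl

theorem U_comm (g h : G) (x : S.τ.GNS) : S.U g (S.U h x) = S.U h (S.U g x) := by
  rw [← U_mul, mul_comm, U_mul]

theorem inner_U (g : G) (x y : S.τ.GNS) : ⟪S.U g x, S.U g y⟫_ℂ = ⟪x, y⟫_ℂ := by
  refine S.denseRange_toL2.induction_on₂ (p := fun x y => ⟪S.U g x, S.U g y⟫_ℂ = ⟪x, y⟫_ℂ)
    ?_ ?_ x y
  · exact isClosed_eq (by fun_prop) (by fun_prop)
  · intro a b
    rw [U_toL2, U_toL2, inner_toL2, inner_toL2, ← map_star, ← map_mul, S.invariant]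

end Unitary

end CStarDynamicalSystem

/-! ### Closures of unbounded operators -/

section Closures

variable {H : Type*} [NormedAddCommGroup H] [InnerProductSpace ℂ H] [CompleteSpace H]

/-- The closure of a non-closable operator is by convention the operator itself, which could not
then be closed. Thus self-adjointness of `D` carries the closability of the operator it closes. -/
theorem LinearPMap.isClosable_of_closure_isClosed {T : H →ₗ.[ℂ] H} (h : T.closure.IsClosed) :
    T.IsClosable := by
  by_contra hT
  rw [LinearPMap.closure_def' hT] at h
  exact hT h.isClosable

/-- A relation between pairs of bounded operators that holds on the graph of a closable operator
passes to its closure. -/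
theorem LinearPMap.IsClosable.map_mem_graph_closure {T T' : H →ₗ.[ℂ] H} (hT : T.IsClosable)
    (hT' : T'.IsClosed) (B B' C : H →L[ℂ] H)
    (h : ∀ x y, (x, y) ∈ T.graph → (B x, B' y + C x) ∈ T'.graph) {x y : H}
    (hxy : (x, y) ∈ T.closure.graph) : (B x, B' y + C x) ∈ T'.graph := by
  rw [← hT.graph_closure_eq_closure_graph, ← SetLike.mem_coe,
    Submodule.topologicalClosure_coe] at hxy
  have hc : Continuous fun p : H × H => (B p.1, B' p.2 + C p.1) := by fun_prop
  have := map_mem_closure hc hxy (t := T'.graph) fun p hp => h p.1 p.2 hp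
  rwa [hT'.closure_eq] at this

end Closures

/-! ### Orthogonal decomposition into joint eigenspaces -/

section JointEigenspaces

variable {G L : Type*} [NormedAddCommGroup L] [InnerProductSpace ℂ L] [CompleteSpace L]

/-- The space of all `x` with `V g x = χ g • x` for all `g`. -/
def jointEigenspace (V : G → L →L[ℂ] L) (χ : G → ℂ) : Submodule ℂ L :=
  ⨅ g, LinearMap.ker (V g - χ g • 1 : L →L[ℂ] L).toLinearMap

theorem mem_jointEigenspace {V : G → L →L[ℂ] L} {χ : G → ℂ} {x : L} :
    x ∈ jointEigenspace V χ ↔ ∀ g, V g x = χ g • x := by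
  simp [jointEigenspace, sub_eq_zero]

instance (V : G → L →L[ℂ] L) (χ : G → ℂ) : CompleteSpace (jointEigenspace V χ) := by
  refine IsClosed.completeSpace_coe (hs := ?_)
  have : (jointEigenspace V χ : Set L) = ⋂ g, {x | V g x = χ g • x} := by
    ext x; simp [mem_jointEigenspace]
  rw [this]
  exact isClosed_iInter fun g => isClosed_eq (by fun_prop) (by fun_prop)

variable {V : G → L →L[ℂ] L}

/-- Here `χ` is an arbitrary function `G → ℂ`, not assumed to be a character; most of the spaces are
zero. If nonzero, isometry forces `|χ g| = 1`, and non-orthogonal vectors force `χ = ψ`. -/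
theorem orthogonalFamily_jointEigenspace (hV : ∀ g x y, ⟪V g x, V g y⟫_ℂ = ⟪x, y⟫_ℂ) :
    OrthogonalFamily ℂ (fun χ => jointEigenspace V χ) fun χ => (jointEigenspace V χ).subtypeₗᵢ := by
  rintro χ ψ hne ⟨x, hx⟩ ⟨y, hy⟩
  change ⟪x, y⟫_ℂ = 0
  rw [mem_jointEigenspace] at hx hy
  obtain ⟨g, hg⟩ := Function.ne_iff.1 hne
  by_contra h0
  have hx0 : x ≠ 0 := by rintro rfl; simp at h0
  have h1 : starRingEnd ℂ (χ g) * χ g = 1 := by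
    have h := hV g x x
    rw [hx, inner_smul_left, inner_smul_right, ← mul_assoc] at h
    exact mul_right_cancel₀ (inner_self_ne_zero.2 hx0) (h.trans (one_mul _).symm)
  have h2 : starRingEnd ℂ (χ g) * ψ g = 1 := by
    have h := hV g x y
    rw [hx, hy, inner_smul_left, inner_smul_right, ← mul_assoc] at h
    exact mul_right_cancel₀ h0 (h.trans (one_mul _).symm)
  exact hg (mul_left_cancel₀ (left_ne_zero_of_mul_eq_one h1) (h1.trans h2.symm))

/-- The orthogonal projection onto a joint eigenspace. -/
def jointProj (V : G → L →L[ℂ] L) (χ : G → ℂ) : L →L[ℂ] L := (jointEigenspace V χ).starProjection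

theorem jointProj_mem (χ : G → ℂ) (x : L) (g : G) : V g (jointProj V χ x) = χ g • jointProj V χ x :=
  mem_jointEigenspace.1 (Submodule.starProjection_apply_mem _ x) g

theorem isResolution_jointProj (hV : ∀ g x y, ⟪V g x, V g y⟫_ℂ = ⟪x, y⟫_ℂ)
    (htot : ∀ y : L, (∀ (χ : G → ℂ) x, (∀ g, V g x = χ g • x) → ⟪x, y⟫_ℂ = 0) → y = 0) :
    IsResolution (jointProj V) := by
  have hortho := orthogonalFamily_jointEigenspace hV
  have hinner : ∀ χ x y, ⟪jointProj V χ x, y⟫_ℂ = ⟪x, jointProj V χ y⟫_ℂ := fun χ x y =>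
    Submodule.inner_starProjection_left_eq_right _ x y
  have hid : ∀ χ x, x ∈ jointEigenspace V χ → jointProj V χ x = x := fun χ x hx =>
    Submodule.starProjection_eq_self_iff.2 hx
  have hzero : ∀ χ ψ x, χ ≠ ψ → x ∈ jointEigenspace V ψ → jointProj V χ x = 0 := by
    intro χ ψ x hne hx
    refine ext_inner_left ℂ fun z => ?_
    rw [← hinner, inner_zero_right]
    exact hortho hne ⟨_, Submodule.starProjection_apply_mem _ z⟩ ⟨x, hx⟩
  have hmem : ∀ χ x, jointProj V χ x ∈ jointEigenspace V χ := fun χ x =>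
    Submodule.starProjection_apply_mem _ x
  have hsum : IsHilbertSum ℂ (fun χ => jointEigenspace V χ)
      fun χ => (jointEigenspace V χ).subtypeₗᵢ := by
    refine IsHilbertSum.mkInternal _ hortho (top_le_iff.2 ?_)
    rw [Submodule.topologicalClosure_eq_top_iff, Submodule.eq_bot_iff]
    intro y hy
    refine htot y fun χ x hx => ?_
    exact Submodule.inner_right_of_mem_orthogonal
      (Submodule.mem_iSup_of_mem χ (mem_jointEigenspace.2 hx)) hy
  refine ⟨hinner, fun χ x => hid χ _ (hmem χ x), fun χ ψ x hne => hzero χ ψ _ hne (hmem ψ x), ?_⟩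
  intro x
  have h := hsum.hasSum_linearIsometryEquiv_symm (hsum.linearIsometryEquiv x)
  rw [LinearIsometryEquiv.symm_apply_apply] at h
  have hcomp : ∀ χ, jointProj V χ x = (hsum.linearIsometryEquiv x χ : L) := by
    intro χ
    refine (h.mapL (jointProj V χ)).unique ?_
    have h1 := hid χ (hsum.linearIsometryEquiv x χ : L) (Subtype.coe_prop _)
    conv =>
      enter [2]
      rw [← h1]
    refine hasSum_single χ fun ψ hne => ?_
    exact hzero χ ψ _ hne.symm (Subtype.coe_prop _)
  simp_rw [hcomp]
  exact h

theorem jointProj_comm (hQ : IsResolution (jointProj V)) (g : G) (χ : G → ℂ) (x : L) :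
    jointProj V χ (V g x) = χ g • jointProj V χ x := by
  have h := ((hQ.hasSum x).mapL (V g)).mapL (jointProj V χ)
  refine h.unique ?_
  have h1 : jointProj V χ (V g (jointProj V χ x)) = χ g • jointProj V χ x := by
    rw [jointProj_mem, map_smul, hQ.idem]
  rw [← h1]
  refine hasSum_single χ fun ψ hne => ?_
  rw [jointProj_mem, map_smul, hQ.ortho _ _ _ hne.symm, smul_zero]

end JointEigenspaces

namespace CStarDynamicalSystem

variable {E : Type*} [NormedAddCommGroup E] [NormedSpace ℝ E]
variable {G : Type*} [CommGroup G] [TopologicalSpace G] [ChartedSpace E G]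
  [LieGroup 𝓘(ℝ, E) ∞ G]
variable {A : Type*} [CStarAlgebra A] [PartialOrder A] [StarOrderedRing A]
variable (S : CStarDynamicalSystem G A)

/-! ### First order operators -/

section FirstOrder

variable {ι : Type*} [Fintype ι] {n : ℕ} {X : Fin n → GroupLieAlgebra 𝓘(ℝ, E) G}
  {m : Fin n → Matrix ι ι ℂ}

@[simp] theorem core_apply (a : ι → S.smooth E) (i : ι) :
    S.core E ι a i = S.toL2 (a i) := rfl

theorem mem_graph_firstOrder {x y : S.hilbert ι} : (x, y) ∈ (S.firstOrder X m).graph ↔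
    ∃ a : ι → S.smooth E, S.core E ι a = x ∧
      ∑ r, matOp (m r) (S.core E ι fun i => S.smoothDerivation (X r) (a i)) = y := by
  have key : ∀ a : ι → S.smooth E, S.firstOrder X m ⟨S.core E ι a, a, rfl⟩ =
      ∑ r, matOp (m r) (S.core E ι fun i => S.smoothDerivation (X r) (a i)) := by
    intro a
    have h : (LinearEquiv.ofInjective (S.core E ι) (S.core_injective ι)).symm
        ⟨S.core E ι a, a, rfl⟩ = a := by
      rw [LinearEquiv.symm_apply_eq]
      rfl
    have h' : (S.firstOrder X m).toFun ⟨S.core E ι a, a, rfl⟩ = _ :=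
      (LinearMap.comp_apply _ _ _).trans (congrArg _ h)
    refine Eq.trans h' ?_
    ext i
    simp
  rw [LinearPMap.mem_graph_iff]
  constructor
  · rintro ⟨⟨_, a, rfl⟩, rfl, rfl⟩
    exact ⟨a, rfl, (key a).symm⟩
  · rintro ⟨a, rfl, rfl⟩
    exact ⟨⟨_, a, rfl⟩, rfl, key a⟩

/-- The operators `U g ⊗ 1` preserve first order operators. -/
theorem diagOp_U_mem_graph_firstOrder (g : G) {x y : S.hilbert ι}
    (h : (x, y) ∈ (S.firstOrder X m).graph) :
    (diagOp ι (S.U g) x, diagOp ι (S.U g) y) ∈ (S.firstOrder X m).graph := by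
  rw [mem_graph_firstOrder] at h ⊢
  obtain ⟨a, rfl, rfl⟩ := h
  refine ⟨fun i => ⟨S.α g (a i), S.α_mem_smooth g (a i).2⟩, ?_, ?_⟩
  · ext i
    simp [U_toL2]
  · ext i
    simp [U_toL2, derivation_α]

end FirstOrder

/-! ### Consequences of the existence of the spectral triple -/

section Spectral

variable {n : ℕ} {ν : Type*} [Fintype ν] [DecidableEq ν] [Nonempty ν]
  {X : Fin n → GroupLieAlgebra 𝓘(ℝ, E) G} {γ : Fin n → Matrix ν ν ℂ} {σ : Matrix ν ν ℂ}

theorem isClosable_firstOrder_of_isSelfAdjoint (hD : IsSelfAdjoint (S.dirac X γ)) :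
    (S.firstOrder X γ).IsClosable :=
  LinearPMap.isClosable_of_closure_isClosed hD.isClosed

/-- No smoothing along `G` is required: `D` is densely defined, and every vector of its domain is a
limit of smooth vectors by construction. -/
theorem denseRange_toL2_smooth (hD : IsSelfAdjoint (S.dirac X γ)) :
    DenseRange fun a : S.smooth E => S.toL2 (a : A) := by
  have h1 : Dense (LinearMap.range (S.core E ν) : Set (S.hilbert ν)) := by
    have h2 : ((S.dirac X γ).domain : Set (S.hilbert ν)) ⊆
        closure (LinearMap.range (S.core E ν) : Set (S.hilbert ν)) := by
      intro x hx
      obtain ⟨y, hy⟩ := LinearPMap.mem_domain_iff.1 hx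
      rw [dirac, ← (S.isClosable_firstOrder_of_isSelfAdjoint hD).graph_closure_eq_closure_graph,
        ← SetLike.mem_coe, Submodule.topologicalClosure_coe] at hy
      exact map_mem_closure continuous_fst hy fun p hp => LinearPMap.mem_domain_of_mem_graph hp
    exact dense_closure.1 (hD.dense_domain.mono h2)
  obtain ⟨i⟩ := ‹Nonempty ν›
  intro x
  have h2 := map_mem_closure (PiLp.continuous_apply 2 (fun _ : ν => S.τ.GNS) i)
    (h1 (PiLp.single 2 i x)) (t := Set.range fun a : S.smooth E => S.toL2 (a : A)) (by
      rintro _ ⟨a, rfl⟩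
      exact ⟨a i, rfl⟩)
  simpa using h2

/-- The resolvent `R = (1 + D²)⁻¹` is compact, symmetric and injective, and it commutes with `U g ⊗
1`. The joint eigenvector theorem then holds on the amplified space and is read off in one
coordinate. -/
theorem eq_zero_of_forall_eigenvector (hD : IsSelfAdjoint (S.dirac X γ))
    (htr : HeatTraceClass (opMul (S.dirac X γ) (S.dirac X γ))) {y : S.τ.GNS}
    (hy : ∀ (χ : G → ℂ) x, (∀ g, S.U g x = χ g • x) → ⟪x, y⟫_ℂ = 0) : y = 0 := by
  set D := S.dirac X γ with hDdef
  obtain ⟨R, hR⟩ := hD.exists_resolvent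
  have hcl := S.isClosable_firstOrder_of_isSelfAdjoint hD
  have hVD : ∀ g x y, (x, y) ∈ D.graph →
      (diagOp ν (S.U g) x, diagOp ν (S.U g) y) ∈ D.graph := by
    intro g x y hxy
    have h := hcl.map_mem_graph_closure (T' := D) hD.isClosed (diagOp ν (S.U g))
      (diagOp ν (S.U g)) 0 (fun x y hxy => by
        rw [zero_apply, add_zero]
        exact LinearPMap.le_graph_of_le (LinearPMap.le_closure _)
          (S.diagOp_U_mem_graph_firstOrder g hxy)) hxy
    rwa [zero_apply, add_zero] at h
  have hcompact : IsCompactOperator R := by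
    obtain ⟨T, hT, hT'⟩ := htr
    exact hT.isCompactOperator_of_forall_mem_graph (fun ε hε => (hT' ε hε).isCompactOperator)
      (R := R) (B := 1 - R) hR
  have hsymm : R.IsSymmetric := by
    intro x y
    obtain ⟨u, hu1, hu2⟩ := mem_graph_opMul.1 (hR x)
    obtain ⟨v, hv1, hv2⟩ := mem_graph_opMul.1 (hR y)
    have h1 := hD.inner_eq_of_mem_graph hu1 hv2
    have h2 := hD.inner_eq_of_mem_graph hu2 hv1
    rw [inner_sub_right] at h1
    rw [inner_sub_left] at h2
    change ⟪R x, y⟫_ℂ = ⟪x, R y⟫_ℂ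
    linear_combination -h2 - h1
  have hinj : ∀ x, R x = 0 → x = 0 := by
    intro x hx
    obtain ⟨u, hu1, hu2⟩ := mem_graph_opMul.1 (hR x)
    rw [hx] at hu1 hu2
    have hu : u = 0 := LinearPMap.graph_fst_eq_zero_snd _ hu1 rfl
    rw [hu] at hu2
    simpa using LinearPMap.graph_fst_eq_zero_snd _ hu2 rfl
  -- With `V = U g ⊗ 1`, which preserves the graph of `D`, the vector `z = V R x - R V x` satisfies
  -- `D² z = -z`, hence is zero.
  have hVR : ∀ g x, diagOp ν (S.U g) (R x) = R (diagOp ν (S.U g) x) := by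
    intro g x
    rw [← sub_eq_zero]
    refine hD.eq_zero_of_mem_graph_opMul ?_
    have h1 : (diagOp ν (S.U g) (R x), diagOp ν (S.U g) (x - R x)) ∈ (opMul D D).graph := by
      obtain ⟨u, hu1, hu2⟩ := mem_graph_opMul.1 (hR x)
      exact mem_graph_opMul.2 ⟨_, hVD g _ _ hu1, hVD g _ _ hu2⟩
    have h2 := (opMul D D).graph.sub_mem h1 (hR (diagOp ν (S.U g) x))
    rw [neg_sub]
    rwa [map_sub, Prod.mk_sub_mk, sub_sub_sub_cancel_left] at h2
  obtain ⟨i⟩ := ‹Nonempty ν›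
  have h0 : (PiLp.single 2 i y : S.hilbert ν) = 0 := by
    refine eq_zero_of_forall_joint_eigenvector hcompact hsymm hinj
      (V := fun g => diagOp ν (S.U g)) (fun g x y => ?_) (fun g h x => ?_) hVR (fun χ x hx => ?_)
    · simp [PiLp.inner_apply, inner_U]
    · ext j
      simp [S.U_comm g h]
    · have h1 := hy χ (x i) fun g => by
        have := congrArg (fun z : S.hilbert ν => z i) (hx g)
        simpa using this
      rw [PiLp.inner_apply, Finset.sum_eq_single i]
      · simpa using h1
      · intro j _ hj
        simp [hj]
      · simp
  simpa using congrArg (fun z : S.hilbert ν => z i) h0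

end Spectral

end CStarDynamicalSystem

/-! ### The algebra of matrices on `L ⊗ ℂ^ι` -/

section Amplification

variable {ι : Type*} [Fintype ι] [DecidableEq ι]
variable {L : Type*} [NormedAddCommGroup L] [InnerProductSpace ℂ L] [CompleteSpace L]

theorem inner_matOp (m : Matrix ι ι ℂ) (x y : PiLp 2 (fun _ : ι => L)) :
    ⟪matOp m x, y⟫_ℂ = ⟪x, matOp m.conjTranspose y⟫_ℂ := by
  simp only [PiLp.inner_apply, matOp_apply, sum_inner, inner_sum, inner_smul_left,
    inner_smul_right, Matrix.conjTranspose_apply, Complex.star_def]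
  exact Finset.sum_comm

variable (ι L) in
/-- `m ↦ 1 ⊗ m` as a `*`-homomorphism. -/
def matHom : Matrix ι ι ℂ →⋆ₐ[ℂ] (PiLp 2 (fun _ : ι => L) →L[ℂ] PiLp 2 (fun _ : ι => L)) where
  toFun := matOp
  map_one' := by ext x i; simp [Matrix.one_apply]
  map_mul' m m' := by
    ext x i
    change matOp (m * m') x i = matOp m (matOp m' x) i
    simp only [matOp_apply, Matrix.mul_apply, Finset.smul_sum,
      Finset.sum_smul, smul_smul]
    rw [Finset.sum_comm]
  map_zero' := by ext x i; simp
  map_add' m m' := by ext x i; simp [add_smul, Finset.sum_add_distrib]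
  commutes' r := by
    ext x i
    simp [Algebra.algebraMap_eq_smul_one, Matrix.one_apply]
  map_star' m := by
    rw [ContinuousLinearMap.star_eq_adjoint, ContinuousLinearMap.eq_adjoint_iff]
    intro x y
    rw [inner_matOp, Matrix.star_eq_conjTranspose, Matrix.conjTranspose_conjTranspose]

theorem diagOp_matOp (b : L →L[ℂ] L) (m : Matrix ι ι ℂ) (x : PiLp 2 (fun _ : ι => L)) :
    diagOp ι b (matOp m x) = matOp m (diagOp ι b x) := by
  ext i
  simp

theorem eq_of_matOp_single_eq {m m' : Matrix ι ι ℂ} {z : L} (hz : z ≠ 0)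
    (h : ∀ j, matOp m (PiLp.single 2 j z : PiLp 2 (fun _ : ι => L)) =
      matOp m' (PiLp.single 2 j z)) : m = m' := by
  ext i j
  have h1 := congrArg (fun x : PiLp 2 (fun _ : ι => L) => x i) (h j)
  simp only [matOp_apply] at h1
  rw [Finset.sum_eq_single j (by intro l _ hl; simp [hl]) (by simp),
    Finset.sum_eq_single j (by intro l _ hl; simp [hl]) (by simp)] at h1
  simpa [sub_eq_zero, hz, ← sub_smul] using sub_eq_zero.2 h1

theorem matOp_injective [Nontrivial L] {m m' : Matrix ι ι ℂ}
    (h : (matOp m : PiLp 2 (fun _ : ι => L) →L[ℂ] _) = matOp m') : m = m' := by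
  obtain ⟨z, hz⟩ := exists_ne (0 : L)
  exact eq_of_matOp_single_eq hz fun j => by rw [h]

theorem isSelfAdjoint_matOp {m : Matrix ι ι ℂ} (hm : m.conjTranspose = m) :
    IsSelfAdjoint (matOp m : PiLp 2 (fun _ : ι => L) →L[ℂ] _) :=
  (map_star (matHom ι L) m).symm.trans (congrArg (matHom ι L) hm)

theorem IsResolution.amplify {κ : Type*} {P : κ → L →L[ℂ] L} (hP : IsResolution P) :
    IsResolution (fun χ => diagOp ι (P χ)) where
  inner_left χ x y := by simp [PiLp.inner_apply, hP.inner_left]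
  idem χ x := by ext i; simp [hP.idem]
  ortho χ ψ x h := by ext i; simp [hP.ortho _ _ _ h]
  hasSum x := by
    have h : HasSum (fun χ i => P χ (x i)) fun i => x i :=
      Pi.hasSum.2 fun i => hP.hasSum (x i)
    have h2 := h.mapL
      ((PiLp.continuousLinearEquiv 2 ℂ (fun _ : ι => L)).symm : (ι → L) →L[ℂ]
        PiLp 2 (fun _ : ι => L))
    exact h2

end Amplification

/-- Passing to adjoints reverses the inclusion, so a self-adjoint operator has no proper
self-adjoint extension. -/
theorem LinearPMap.eq_of_isSelfAdjoint_of_le {H : Type*} [NormedAddCommGroup H] [InnerProductSpace ℂ H]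
    [CompleteSpace H] {S T : H →ₗ.[ℂ] H} (hS : IsSelfAdjoint S) (hT : T.adjoint = T)
    (hT' : Dense (T.domain : Set H)) (h : S ≤ T) : S = T := by
  refine le_antisymm h (LinearPMap.le_of_le_graph ?_)
  rintro ⟨x, y⟩ hxy
  rw [← LinearPMap.isSelfAdjoint_def.1 hS, LinearPMap.mem_adjoint_graph_iff hS.dense_domain]
  rw [← hT, LinearPMap.mem_adjoint_graph_iff hT'] at hxy
  exact fun a b hab => hxy a b (LinearPMap.le_graph_of_le h hab)

namespace CStarDynamicalSystem

variable {E : Type*} [NormedAddCommGroup E] [NormedSpace ℝ E]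
variable {G : Type*} [CommGroup G] [TopologicalSpace G] [ChartedSpace E G]
  [LieGroup 𝓘(ℝ, E) ∞ G]
variable {A : Type*} [CStarAlgebra A] [PartialOrder A] [StarOrderedRing A]
variable (S : CStarDynamicalSystem G A)

/-! ### Weights -/

section Weights

variable {n : ℕ} {X : Fin n → GroupLieAlgebra 𝓘(ℝ, E) G}

/-- The derivations `∂_r` are diagonalised by the joint eigenspaces of the unitaries `U g`, and
act on them by the imaginary numbers `i w_r`. -/
structure IsWeightDecomposition (X : Fin n → GroupLieAlgebra 𝓘(ℝ, E) G)
    (w : (G → ℂ) → Fin n → ℝ) : Prop where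
  isResolution : IsResolution (jointProj S.U)
  weight : ∀ χ r (a : S.smooth E), jointProj S.U χ (S.toL2 (S.derivation (X r) a)) =
    (Complex.I * w χ r) • jointProj S.U χ (S.toL2 a)

theorem hasMFDerivAt_comp_orbit {F : Type*} [NormedAddCommGroup F] [NormedSpace ℝ F]
    (a : S.smooth E) (B : A →L[ℝ] F) :
    HasMFDerivAt 𝓘(ℝ, E) 𝓘(ℝ, F) (fun g => B (S.α g (a : A))) 1
      (B ∘L mfderiv 𝓘(ℝ, E) 𝓘(ℝ, A) (fun g => S.α g (a : A)) 1) :=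
  (B.hasMFDerivAt (x := S.α 1 (a : A))).comp (1 : G) (S.hasMFDerivAt_orbit a)

/-- Composing the embedding with the projection gives a map `T` with `T (α_g a) = χ(g) T a`.
Differentiating at `g = 1` shows that `∂_r` acts as the derivative of `χ` along `X_r`, which is
imaginary because `|χ| = 1`. -/
theorem exists_weight (hQ : IsResolution (jointProj S.U)) (X : Fin n → GroupLieAlgebra 𝓘(ℝ, E) G)
    (χ : G → ℂ) : ∃ w : Fin n → ℝ, ∀ r (a : S.smooth E),
      jointProj S.U χ (S.toL2 (S.derivation (X r) a)) =
        (Complex.I * w r) • jointProj S.U χ (S.toL2 a) := by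
  by_cases h0 : ∀ a : S.smooth E, jointProj S.U χ (S.toL2 a) = 0
  -- If the projection kills all smooth elements the weight is irrelevant; `0` works because `∂_r a`
  -- is again smooth.
  · refine ⟨0, fun r a => ?_⟩
    rw [h0 a, smul_zero]
    exact h0 (S.smoothDerivation (X r) a)
  push Not at h0
  obtain ⟨a₀, ha₀⟩ := h0
  let T : A →L[ℂ] S.τ.GNS := jointProj S.U χ ∘L S.toL2L
  have hT : ∀ g a, T (S.α g a) = χ g • T a := by
    intro g a
    change jointProj S.U χ (S.toL2 (S.α g a)) = _
    rw [← U_toL2, jointProj_comm hQ]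
    rfl
  set v := T a₀ with hv
  have hv0 : ⟪v, v⟫_ℂ ≠ 0 := inner_self_ne_zero.2 ha₀
  -- The functional is normalised so that `χ` becomes its composition with the orbit of `a₀`; this
  -- is what makes `χ` differentiable at `1`.
  let ψ : A →L[ℂ] ℂ := (⟪v, v⟫_ℂ)⁻¹ • (innerSL ℂ v ∘L T)
  have hψ : ∀ g, (ψ.restrictScalars ℝ) (S.α g (a₀ : A)) = χ g := by
    intro g
    change (⟪v, v⟫_ℂ)⁻¹ • ⟪v, T (S.α g (a₀ : A))⟫_ℂ = χ g
    rw [hT, ← hv, inner_smul_right, smul_eq_mul]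
    field_simp
  have hχ := S.hasMFDerivAt_comp_orbit a₀ (ψ.restrictScalars ℝ)
  rw [show (fun g => (ψ.restrictScalars ℝ) (S.α g (a₀ : A))) = χ from funext hψ] at hχ
  have hχ1 : χ 1 = 1 := by
    have := hT 1 (a₀ : A)
    rw [α_one_apply, ← hv] at this
    have h2 := congrArg (fun y => ⟪v, y⟫_ℂ) this
    simp only [inner_smul_right] at h2
    exact (mul_right_cancel₀ hv0 ((one_mul _).trans h2)).symm
  have hnorm : ∀ g, ‖χ g‖ ^ 2 = 1 := by
    intro g
    have h1 := S.inner_U g v v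
    have h2 : S.U g v = χ g • v := jointProj_mem χ (S.toL2 a₀) g
    rw [h2, inner_smul_left, inner_smul_right, ← mul_assoc, Complex.conj_mul'] at h1
    exact_mod_cast mul_right_cancel₀ hv0 (h1.trans (one_mul _).symm)
  have hre : ∀ r, (ψ (S.derivation (X r) a₀)).re = 0 := by
    intro r
    have h1 := ((hasStrictFDerivAt_norm_sq (χ 1)).hasFDerivAt.hasMFDerivAt).comp (1 : G) hχ
    have h2 : (fun z : ℂ => ‖z‖ ^ 2) ∘ χ = fun _ => (1 : ℝ) := funext hnorm
    have h3 := h1.mfderiv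
    rw [show mfderiv 𝓘(ℝ, E) 𝓘(ℝ, ℝ) ((fun z : ℂ => ‖z‖ ^ 2) ∘ fun g => χ g) 1 = 0 by
      rw [show ((fun z : ℂ => ‖z‖ ^ 2) ∘ fun g => χ g) = fun _ => (1 : ℝ) from h2]
      exact mfderiv_const] at h3
    have h4 := congrArg (fun B => B (X r)) h3
    have h5 : (0 : ℝ) = (2 • (innerSL ℝ (χ 1))) (ψ (S.derivation (X r) a₀)) := h4
    rw [hχ1] at h5
    simpa using h5.symm
  refine ⟨fun r => (ψ (S.derivation (X r) a₀)).im, fun r a => ?_⟩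
  have him : Complex.I * ((ψ (S.derivation (X r) a₀)).im : ℂ) = ψ (S.derivation (X r) a₀) := by
    apply Complex.ext <;> simp [hre r]
  rw [him]
  have h1 := S.hasMFDerivAt_comp_orbit a (T.restrictScalars ℝ)
  have h2 := (((ContinuousLinearMap.toSpanSingleton ℂ (T a)).restrictScalars ℝ).hasMFDerivAt
    (x := χ 1)).comp (1 : G) hχ
  have h3 : (fun g => (T.restrictScalars ℝ) (S.α g (a : A))) =
      ((ContinuousLinearMap.toSpanSingleton ℂ (T a)).restrictScalars ℝ) ∘ fun g => χ g := by
    funext g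
    exact hT g a
  rw [h3] at h1
  exact congrArg (fun B => B (X r)) (h1.mfderiv.symm.trans h2.mfderiv)

end Weights

end CStarDynamicalSystem

section Amplification

variable {ι : Type*} [Fintype ι] [DecidableEq ι]
variable {L : Type*} [NormedAddCommGroup L] [InnerProductSpace ℂ L] [CompleteSpace L]

theorem matOp_mul (m m' : Matrix ι ι ℂ) :
    (matOp (m * m') : PiLp 2 (fun _ : ι => L) →L[ℂ] _) = matOp m * matOp m' :=
  map_mul (matHom ι L) m m'

theorem matOp_mul_apply (m m' : Matrix ι ι ℂ) (x : PiLp 2 (fun _ : ι => L)) :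
    matOp (m * m') x = matOp m (matOp m' x) := by
  rw [matOp_mul]
  rfl

theorem matOp_add (m m' : Matrix ι ι ℂ) :
    (matOp (m + m') : PiLp 2 (fun _ : ι => L) →L[ℂ] _) = matOp m + matOp m' :=
  map_add (matHom ι L) m m'

theorem matOp_smul (c : ℂ) (m : Matrix ι ι ℂ) :
    (matOp (c • m) : PiLp 2 (fun _ : ι => L) →L[ℂ] _) = c • matOp m :=
  map_smul (matHom ι L) c m

theorem matOp_sum {J : Type*} (s : Finset J) (m : J → Matrix ι ι ℂ) :
    (matOp (∑ j ∈ s, m j) : PiLp 2 (fun _ : ι => L) →L[ℂ] _) = ∑ j ∈ s, matOp (m j) :=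
  map_sum (matHom ι L) m s

theorem matOp_one : (matOp (1 : Matrix ι ι ℂ) : PiLp 2 (fun _ : ι => L) →L[ℂ] _) = 1 :=
  map_one (matHom ι L)

theorem matOp_zero : (matOp (0 : Matrix ι ι ℂ) : PiLp 2 (fun _ : ι => L) →L[ℂ] _) = 0 :=
  map_zero (matHom ι L)

end Amplification

namespace CStarDynamicalSystem

variable {E : Type*} [NormedAddCommGroup E] [NormedSpace ℝ E]
variable {G : Type*} [CommGroup G] [TopologicalSpace G] [ChartedSpace E G]
  [LieGroup 𝓘(ℝ, E) ∞ G]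
variable {A : Type*} [CStarAlgebra A] [PartialOrder A] [StarOrderedRing A]
variable (S : CStarDynamicalSystem G A)

/-! ### First order operators as multiplication operators -/

/-- The matrix `∑_r i w_r m_r`. -/
def symbol {ι : Type*} {n : ℕ} (w : Fin n → ℝ) (m : Fin n → Matrix ι ι ℂ) : Matrix ι ι ℂ :=
  ∑ r, (Complex.I * w r) • m r

/-- The operator `∑_r ∂_r ⊗ m_r` with its maximal domain, where `∂_r` acts on the joint eigenspace
for `χ` as `i w_r(χ)`. -/
def symbolOp {ι : Type*} [Fintype ι] {n : ℕ} (w : (G → ℂ) → Fin n → ℝ)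
    (m : Fin n → Matrix ι ι ℂ) : S.hilbert ι →ₗ.[ℂ] S.hilbert ι :=
  multOp (fun χ => diagOp ι (jointProj S.U χ)) fun χ => matOp (symbol (w χ) m)

theorem diagOp_matOp_comm {ι : Type*} [Fintype ι] (M : (G → ℂ) → Matrix ι ι ℂ) (χ : G → ℂ)
    (x : S.hilbert ι) : diagOp ι (jointProj S.U χ) (matOp (M χ) x) =
      matOp (M χ) (diagOp ι (jointProj S.U χ) x) := by
  ext i
  simp

section Symbol

variable {n : ℕ} {X : Fin n → GroupLieAlgebra 𝓘(ℝ, E) G} {w : (G → ℂ) → Fin n → ℝ}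
variable {ι : Type*} [Fintype ι] [DecidableEq ι] {m m' : Fin n → Matrix ι ι ℂ}
variable {S}

variable (hw : S.IsWeightDecomposition X w)

include hw

theorem IsWeightDecomposition.res :
    IsResolution fun χ => (diagOp ι (jointProj S.U χ) : S.hilbert ι →L[ℂ] S.hilbert ι) :=
  hw.isResolution.amplify

theorem IsWeightDecomposition.mem_graph_symbolOp {x y : S.hilbert ι} :
    (x, y) ∈ (S.symbolOp w m).graph ↔ ∀ χ, diagOp ι (jointProj S.U χ) y =
      matOp (symbol (w χ) m) (diagOp ι (jointProj S.U χ) x) :=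
  hw.res.mem_graph

theorem IsWeightDecomposition.symbolOp_isClosed : (S.symbolOp w m).IsClosed :=
  hw.res.multOp_isClosed

theorem IsWeightDecomposition.firstOrder_le : S.firstOrder X m ≤ S.symbolOp w m := by
  refine LinearPMap.le_of_le_graph ?_
  rintro ⟨x, y⟩ h
  obtain ⟨a, rfl, rfl⟩ := S.mem_graph_firstOrder.1 h
  rw [hw.mem_graph_symbolOp]
  intro χ
  have h1 : ∀ r, diagOp ι (jointProj S.U χ) (S.core E ι fun i => S.smoothDerivation (X r) (a i)) =
      (Complex.I * w χ r) • diagOp ι (jointProj S.U χ) (S.core E ι a) := by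
    intro r
    ext i
    simpa using hw.weight χ r (a i)
  simp only [map_sum, diagOp_matOp, h1, symbol, matOp_sum, matOp_smul, map_smul,
    sum_apply, smul_apply]

theorem IsWeightDecomposition.isClosable_firstOrder : (S.firstOrder X m).IsClosable :=
  LinearPMap.IsClosable.leIsClosable hw.symbolOp_isClosed.isClosable hw.firstOrder_le

theorem IsWeightDecomposition.closure_firstOrder_le :
    (S.firstOrder X m).closure ≤ S.symbolOp w m := by
  refine LinearPMap.le_of_le_graph ?_
  rw [← hw.isClosable_firstOrder.graph_closure_eq_closure_graph]
  exact Submodule.topologicalClosure_minimal _ (LinearPMap.le_graph_of_le hw.firstOrder_le)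
    hw.symbolOp_isClosed

section Dirac

variable {ν : Type*} [Fintype ν] [DecidableEq ν] [Nonempty ν] {γ : Fin n → Matrix ν ν ℂ}
  {σ : Matrix ν ν ℂ} (hγ : IsGradedClifford γ σ)

include hγ

theorem IsWeightDecomposition.inner_symbol (χ : G → ℂ) (x y : S.hilbert ν) :
    ⟪matOp (symbol (w χ) γ) x, y⟫_ℂ = ⟪x, matOp (symbol (w χ) γ) y⟫_ℂ := by
  rw [inner_matOp]
  congr 2
  simp [symbol, Matrix.conjTranspose_sum, Matrix.conjTranspose_smul, hγ.skew]

theorem IsWeightDecomposition.symbol_mul_self (χ : G → ℂ) :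
    symbol (w χ) γ * symbol (w χ) γ = (((∑ r, w χ r ^ 2 : ℝ)) : ℂ) • 1 := by
  rw [symbol, hγ.sum_smul_mul_self]
  congr 1
  push_cast
  rw [← Finset.sum_neg_distrib]
  refine Finset.sum_congr rfl fun r _ => ?_
  linear_combination -(w χ r : ℂ) ^ 2 * Complex.I_sq

/-- An ellipticity estimate: the symbol of `D` is Hermitian with square `|w|²`, which dominates each
`w_r²`. -/
theorem IsWeightDecomposition.norm_symbol (χ : G → ℂ) (x : S.hilbert ν) (r : Fin n) :
    |w χ r| * ‖x‖ ≤ ‖matOp (symbol (w χ) γ) x‖ := by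
  refine le_of_sq_le_sq ?_ (norm_nonneg _)
  have h1 : (⟪matOp (symbol (w χ) γ) x, matOp (symbol (w χ) γ) x⟫_ℂ) =
      ((∑ r, w χ r ^ 2 : ℝ) : ℂ) * ⟪x, x⟫_ℂ := by
    rw [hw.inner_symbol hγ]
    have : matOp (symbol (w χ) γ) (matOp (symbol (w χ) γ) x) =
        ((∑ r, w χ r ^ 2 : ℝ) : ℂ) • x := by
      rw [← matOp_mul_apply, hw.symbol_mul_self hγ, matOp_smul, matOp_one]
      rfl
    rw [this, inner_smul_right]
  rw [inner_self_eq_norm_sq_to_K, inner_self_eq_norm_sq_to_K] at h1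
  simp only [Complex.coe_algebraMap] at h1
  have h2 : ‖matOp (symbol (w χ) γ) x‖ ^ 2 = (∑ r, w χ r ^ 2) * ‖x‖ ^ 2 := by
    exact_mod_cast h1
  rw [h2, mul_pow, sq_abs]
  gcongr
  exact Finset.single_le_sum (f := fun r => w χ r ^ 2) (fun r _ => sq_nonneg _) (Finset.mem_univ r)

theorem IsWeightDecomposition.adjoint_symbolOp_dirac :
    (S.symbolOp w γ).adjoint = S.symbolOp w γ :=
  hw.res.adjoint_multOp (S.diagOp_matOp_comm _) fun χ x y => hw.inner_symbol hγ χ x y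

/-- The multiplication operator is a self-adjoint extension of the self-adjoint operator `D`. -/
theorem IsWeightDecomposition.dirac_eq (hD : IsSelfAdjoint (S.dirac X γ)) :
    S.dirac X γ = S.symbolOp w γ :=
  LinearPMap.eq_of_isSelfAdjoint_of_le hD (hw.adjoint_symbolOp_dirac hγ)
    (hw.res.multOp_dense (S.diagOp_matOp_comm _)) hw.closure_firstOrder_le

/-- A vector `z` of the `χ`-eigenspace lies in the domain of `D`, so smooth vectors approximate it
in the graph norm of `D`. By `norm_symbol`, applied on each joint eigenspace, this norm dominates
that of every `∂_r`, so all derivatives converge simultaneously. -/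
theorem IsWeightDecomposition.mem_closure_gradient (hD : IsSelfAdjoint (S.dirac X γ))
    {χ : G → ℂ} {z : S.τ.GNS} (hz : jointProj S.U χ z = z) :
    ((z, fun r => (Complex.I * w χ r) • z) : S.τ.GNS × (Fin n → S.τ.GNS)) ∈
      closure (Set.range fun a : S.smooth E =>
        (S.toL2 (a : A), fun r => S.toL2 (S.derivation (X r) a))) := by
  obtain ⟨i⟩ := ‹Nonempty ν›
  have h1 : (PiLp.single 2 i z, matOp (symbol (w χ) γ) (PiLp.single 2 i z : S.hilbert ν)) ∈
      (S.dirac X γ).graph := by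
    rw [hw.dirac_eq hγ hD]
    have := hw.res.component_mem_graph (c := fun χ => matOp (symbol (w χ) γ))
      (S.diagOp_matOp_comm _) χ (PiLp.single 2 i z : S.hilbert ν)
    have e : diagOp ν (jointProj S.U χ) (PiLp.single 2 i z : S.hilbert ν) = PiLp.single 2 i z := by
      ext j
      by_cases h : j = i
      · subst h; simp [hz]
      · simp [h]
    rwa [e] at this
  have h1' := h1
  rw [hw.dirac_eq hγ hD] at h1'
  rw [dirac, ← hw.isClosable_firstOrder.graph_closure_eq_closure_graph, ← SetLike.mem_coe,
    Submodule.topologicalClosure_coe, Metric.mem_closure_iff] at h1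
  rw [Metric.mem_closure_iff]
  intro ε hε
  obtain ⟨⟨x, y⟩, hxy, hdist⟩ := h1 ε hε
  have h2 := (S.symbolOp w γ).graph.sub_mem (LinearPMap.le_graph_of_le hw.firstOrder_le hxy) h1'
  rw [Prod.mk_sub_mk, hw.mem_graph_symbolOp] at h2
  obtain ⟨b, rfl, -⟩ := S.mem_graph_firstOrder.1 hxy
  rw [Prod.dist_eq, max_lt_iff] at hdist
  refine ⟨_, ⟨b i, rfl⟩, ?_⟩
  rw [Prod.dist_eq, max_lt_iff, dist_pi_lt_iff hε]
  constructor
  · refine lt_of_le_of_lt ?_ hdist.1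
    have := PiLp.norm_apply_le ((PiLp.single 2 i z : S.hilbert ν) - S.core E ν b) i
    simpa [dist_eq_norm] using this
  · intro r
    refine lt_of_le_of_lt ?_ hdist.2
    rw [dist_comm, dist_comm _ y, dist_eq_norm, dist_eq_norm,
      ← PiLp.norm_single 2 (fun _ : ν => S.τ.GNS) i]
    refine hw.res.norm_le_norm fun ψ => ?_
    have h3 : diagOp ν (jointProj S.U ψ) (PiLp.single 2 i
        (S.toL2 (S.derivation (X r) (b i)) - (Complex.I * w χ r) • z) : S.hilbert ν) =
        PiLp.single 2 i ((Complex.I * w ψ r) • jointProj S.U ψ (S.toL2 (b i) - z)) := by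
      -- The component of `z` at `ψ` vanishes unless `ψ = χ`, so either weight may be used.
      have h4 : (Complex.I * w χ r) • jointProj S.U ψ z =
          (Complex.I * w ψ r) • jointProj S.U ψ z := by
        by_cases h : ψ = χ
        · rw [h]
        · rw [← hz, hw.isResolution.ortho _ _ _ h, smul_zero, smul_zero]
      ext j
      by_cases h : j = i
      · subst h
        simp [hw.weight, h4, smul_sub]
      · simp [h]
    rw [h3, PiLp.norm_single, h2 ψ, norm_smul, norm_mul, Complex.norm_I, one_mul,
      Complex.norm_real, Real.norm_eq_abs]
    refine le_trans ?_ (hw.norm_symbol hγ ψ _ r)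
    gcongr
    have := PiLp.norm_apply_le
      (diagOp ν (jointProj S.U ψ) (S.core E ν b - (PiLp.single 2 i z : S.hilbert ν))) i
    simpa using this

end Dirac

end Symbol

end CStarDynamicalSystem

/-- Each point of the graph of `multOp Q c` is the limit of finite sums of its components, so the
closure only has to contain single components. -/
theorem IsResolution.closure_eq_multOp {κ H : Type*} [NormedAddCommGroup H]
    [InnerProductSpace ℂ H] [CompleteSpace H] {Q c : κ → H →L[ℂ] H} (hQ : IsResolution Q)
    {T : H →ₗ.[ℂ] H} (hT : T ≤ multOp Q c)
    (h : ∀ χ x, (Q χ x, c χ (Q χ x)) ∈ T.graph.topologicalClosure) : T.closure = multOp Q c := by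
  have hcl : T.IsClosable := LinearPMap.IsClosable.leIsClosable hQ.multOp_isClosed.isClosable hT
  refine LinearPMap.eq_of_eq_graph ?_
  rw [← hcl.graph_closure_eq_closure_graph]
  refine le_antisymm (Submodule.topologicalClosure_minimal _ (LinearPMap.le_graph_of_le hT)
    hQ.multOp_isClosed) ?_
  rintro ⟨x, y⟩ hxy
  have hs : HasSum (fun χ => (Q χ x, Q χ y)) (x, y) := (hQ.hasSum x).prodMk (hQ.hasSum y)
  refine T.graph.isClosed_topologicalClosure.mem_of_tendsto hs (.of_forall fun s => ?_)
  refine Submodule.sum_mem _ fun χ _ => ?_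
  rw [hQ.mem_graph.1 hxy]
  exact h χ x

/-! ### Commutators, adjoints and cores of first order operators -/

namespace CStarDynamicalSystem

variable {E : Type*} [NormedAddCommGroup E] [NormedSpace ℝ E]
variable {G : Type*} [CommGroup G] [TopologicalSpace G] [ChartedSpace E G]
  [LieGroup 𝓘(ℝ, E) ∞ G]
variable {A : Type*} [CStarAlgebra A] [PartialOrder A] [StarOrderedRing A]
variable {S : CStarDynamicalSystem G A}
variable {n : ℕ} {X : Fin n → GroupLieAlgebra 𝓘(ℝ, E) G} {w : (G → ℂ) → Fin n → ℝ}
variable {ι : Type*} [Fintype ι] [DecidableEq ι] {m m' : Fin n → Matrix ι ι ℂ}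

/-- The commutator of `∑_r ∂_r ⊗ m_r` with left multiplication by `a`. -/
def commutatorOp (S : CStarDynamicalSystem G A) (X : Fin n → GroupLieAlgebra 𝓘(ℝ, E) G)
    (m : Fin n → Matrix ι ι ℂ) (a : S.smooth E) : S.hilbert ι →L[ℂ] S.hilbert ι :=
  ∑ r, matOp (m r) * S.rep E ι (S.smoothDerivation (X r) a)

theorem rep_core (a : S.smooth E) (b : ι → S.smooth E) :
    S.rep E ι a (S.core E ι b) = S.core E ι fun i => a * b i := by
  ext i
  exact S.gns_toL2 a (b i)

theorem commute_matOp_rep (W : Matrix ι ι ℂ) (a : S.smooth E) :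
    Commute (matOp W) (S.rep E ι a) :=
  ContinuousLinearMap.ext fun x => (diagOp_matOp (S.τ.gnsStarAlgHom (a : A)) W x).symm

theorem rep_mem_graph_firstOrder (a : S.smooth E) {x y : S.hilbert ι}
    (h : (x, y) ∈ (S.firstOrder X m).graph) :
    (S.rep E ι a x, S.rep E ι a y + commutatorOp S X m a x) ∈ (S.firstOrder X m).graph := by
  obtain ⟨b, rfl, rfl⟩ := S.mem_graph_firstOrder.1 h
  rw [mem_graph_firstOrder]
  refine ⟨fun i => a * b i, (rep_core a b).symm, ?_⟩
  have h1 : ∀ r, (S.core E ι fun i => S.smoothDerivation (X r) (a * b i)) =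
      S.rep E ι a (S.core E ι fun i => S.smoothDerivation (X r) (b i)) +
        S.rep E ι (S.smoothDerivation (X r) a) (S.core E ι b) := by
    intro r
    rw [rep_core, rep_core, ← map_add]
    congr 1
    funext i
    refine Subtype.ext ?_
    rw [coe_smoothDerivation, derivation_mul, add_comm]
    rfl
  simp only [h1, map_add, map_sum, Finset.sum_add_distrib, commutatorOp,
    sum_apply]
  congr 1
  refine Finset.sum_congr rfl fun r _ => ?_
  exact DFunLike.congr_fun (commute_matOp_rep (m r) a).eq _

/-- Left multiplication by smooth elements is faithful. -/
theorem rep_injective [Nonempty ι] : Function.Injective (S.rep E ι) := by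
  intro a b h
  obtain ⟨i⟩ := ‹Nonempty ι›
  have h1 := congrArg (fun T => T (S.core E ι fun _ => 1) i) h
  simp only [rep_core, core_apply, mul_one] at h1
  exact Subtype.ext (S.toL2_injective h1)

/-- If only zero weights occurred, all derivations would vanish, so connectedness would make every
smooth element invariant; by density of the smooth elements each `U g`, hence each `α_g`, would be
trivial. -/
theorem IsWeightDecomposition.exists_ne_zero [ConnectedSpace G]
    {X : Module.Basis (Fin n) ℝ (GroupLieAlgebra 𝓘(ℝ, E) G)} (hw : S.IsWeightDecomposition X w)
    (hdense : DenseRange fun a : S.smooth E => S.toL2 (a : A)) (hα : ∃ g a, S.α g a ≠ a) :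
    ∃ χ, w χ ≠ 0 ∧ ∃ z : S.τ.GNS, z ≠ 0 ∧ jointProj S.U χ z = z := by
  by_contra! hcon
  obtain ⟨g, a, hga⟩ := hα
  have h1 : ∀ (b : S.smooth E) r, S.derivation (X r) b = 0 := by
    intro b r
    refine S.toL2_injective (hw.isResolution.ext fun χ => ?_)
    rw [hw.weight, map_zero, map_zero]
    by_cases h : w χ = 0
    · simp [h]
    · by_cases h2 : jointProj S.U χ (S.toL2 b) = 0
      · rw [h2, smul_zero]
      · exact absurd (hw.isResolution.idem χ _) (hcon χ h _ h2)
  have h2 : ∀ b : S.smooth E, S.α g (b : A) = b := by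
    intro b
    refine S.α_eq_of_derivation_eq_zero b (fun Y => ?_) g
    have h3 : (mfderiv 𝓘(ℝ, E) 𝓘(ℝ, A) (fun g => S.α g (b : A)) 1).toLinearMap = 0 :=
      X.ext fun r => h1 b r
    exact congrArg (fun T => T Y) h3
  have h3 : S.U g = ContinuousLinearMap.id ℂ _ := by
    refine ContinuousLinearMap.coeFn_injective ?_
    refine hdense.equalizer (S.U g).continuous continuous_id (funext fun b => ?_)
    simp [U_toL2, h2]
  refine hga (S.toL2_injective ?_)
  rw [← U_toL2, h3]
  rfl

variable (hw : S.IsWeightDecomposition X w)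

include hw

/-- Matrices that intertwine the coefficients of two first order operators intertwine the
operators. -/
theorem IsWeightDecomposition.matOp_mem_graph {W W' : Matrix ι ι ℂ}
    (h : ∀ r, W' * m r = m' r * W) {x y : S.hilbert ι} (hxy : (x, y) ∈ (S.symbolOp w m).graph) :
    (matOp W x, matOp W' y) ∈ (S.symbolOp w m').graph := by
  rw [hw.mem_graph_symbolOp] at hxy ⊢
  intro χ
  have h1 : W' * symbol (w χ) m = symbol (w χ) m' * W := by
    simp only [symbol, Finset.mul_sum, Finset.sum_mul, mul_smul_comm, smul_mul_assoc, h]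
  rw [diagOp_matOp, hxy, ← matOp_mul_apply, h1, matOp_mul_apply, diagOp_matOp]

theorem IsWeightDecomposition.commutatorEqSmul {W : Matrix ι ι ℂ} {c : ℂ}
    (h : ∀ r, W * m r - m r * W = c • m r) : CommutatorEqSmul (matOp W) (S.symbolOp w m) c := by
  intro x
  have h1 := hw.matOp_mem_graph (m := m) (m' := m) (W := W) (W' := W - c • 1)
    (fun r => by rw [sub_mul, smul_mul_assoc, one_mul, ← h r, sub_sub_cancel])
    ((S.symbolOp w m).mem_graph x)
  rw [sub_eq_add_neg, matOp_add, ← neg_smul, matOp_smul, matOp_one] at h1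
  simpa [sub_eq_add_neg] using h1

theorem IsWeightDecomposition.anticommutatorExtends {W : Matrix ι ι ℂ}
    (h : ∀ r, W * m r = -(m r * W)) : AnticommutatorExtends (S.symbolOp w m) (matOp W) 0 := by
  intro x
  have h1 := hw.matOp_mem_graph (m := m) (m' := m) (W := W) (W' := (-1 : ℂ) • W)
    (fun r => by rw [smul_mul_assoc, h, neg_one_smul, neg_neg])
    ((S.symbolOp w m).mem_graph x)
  rw [matOp_smul] at h1
  simpa using h1

theorem IsWeightDecomposition.adjoint_symbolOp :
    (S.symbolOp w m).adjoint = S.symbolOp w fun r => -(m r).conjTranspose := by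
  refine hw.res.adjoint_multOp (S.diagOp_matOp_comm _) fun χ x y => ?_
  rw [inner_matOp]
  congr 3
  simp [symbol, Matrix.conjTranspose_sum, Matrix.conjTranspose_smul]

/-- The phase is `-1` because the derivations are skew-adjoint: taking the adjoint of `∑ ∂_r ⊗ m_r`
replaces `m_r` by `-m_r^*`. -/
theorem IsWeightDecomposition.intertwines {W : Matrix ι ι ℂ} (hW : W * W = 1)
    (h : ∀ r, W * m r = star (m' r) * W) :
    Intertwines (matOp W) (S.symbolOp w m) (S.symbolOp w m').adjoint (-1) := by
  rw [hw.adjoint_symbolOp]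
  intro x y
  have h1 : ∀ y : S.hilbert ι, (starRingEnd ℂ) (-1) • matOp W y = matOp ((-1 : ℂ) • W) y := by
    intro y
    rw [matOp_smul]
    simp
  rw [h1]
  constructor
  · exact hw.matOp_mem_graph fun r => by
      rw [smul_mul_assoc, h, neg_one_smul, neg_mul]
      rfl
  · intro hxy
    have h2 := hw.matOp_mem_graph (m' := m) (W := W) (W' := (-1 : ℂ) • W) (fun r => by
      have h3 := congrArg (fun M => W * M * W) (h r)
      simp only [← mul_assoc, hW, one_mul] at h3
      rw [smul_mul_assoc, neg_one_smul, mul_neg, neg_neg]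
      rw [mul_assoc _ W W, hW, mul_one] at h3
      exact h3.symm) hxy
    rw [← matOp_mul_apply, ← matOp_mul_apply, hW, smul_mul_smul_comm, hW, matOp_one] at h2
    simpa [matOp_one] using h2

theorem IsWeightDecomposition.symbolOp_dense : Dense ((S.symbolOp w m).domain : Set (S.hilbert ι)) :=
  hw.res.multOp_dense (S.diagOp_matOp_comm _)

/-- Every component `Q χ x` lies in the domains of both summands, so the sum is large enough for its
closure to be the maximal operator. -/
theorem IsWeightDecomposition.closure_add :
    (S.symbolOp w m + S.symbolOp w m').closure = S.symbolOp w fun r => m r + m' r := by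
  have hs : ∀ χ, symbol (w χ) (fun r => m r + m' r) = symbol (w χ) m + symbol (w χ) m' := by
    intro χ
    simp [symbol, smul_add, Finset.sum_add_distrib]
  refine hw.res.closure_eq_multOp (LinearPMap.le_of_le_graph ?_) fun χ x => ?_
  · rintro ⟨x, z⟩ h
    obtain ⟨y, y', h1, h2, rfl⟩ := mem_graph_add.1 h
    refine hw.mem_graph_symbolOp.2 fun χ => ?_
    rw [map_add, hw.mem_graph_symbolOp.1 h1, hw.mem_graph_symbolOp.1 h2, hs, matOp_add]
    rfl
  · refine Submodule.le_topologicalClosure _ (mem_graph_add.2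
      ⟨_, _, hw.res.component_mem_graph (S.diagOp_matOp_comm fun χ => symbol (w χ) m) χ x,
        hw.res.component_mem_graph (S.diagOp_matOp_comm fun χ => symbol (w χ) m') χ x, ?_⟩)
    rw [hs, matOp_add]
    rfl

section Core

variable {ν : Type*} [Fintype ν] [DecidableEq ν] [Nonempty ν] {γ : Fin n → Matrix ν ν ℂ}
  {σ : Matrix ν ν ℂ} (hγ : IsGradedClifford γ σ) (hD : IsSelfAdjoint (S.dirac X γ))

include hγ hD

/-- The smooth vectors are a core of every first order operator. -/
theorem IsWeightDecomposition.closure_firstOrder :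
    (S.firstOrder X m).closure = S.symbolOp w m := by
  refine hw.res.closure_eq_multOp hw.firstOrder_le fun χ x => ?_
  have key : ∀ i, (PiLp.single 2 i (jointProj S.U χ (x i)),
      matOp (symbol (w χ) m) (PiLp.single 2 i (jointProj S.U χ (x i)) : S.hilbert ι)) ∈
        (S.firstOrder X m).graph.topologicalClosure := by
    intro i
    let sgl : S.τ.GNS →L[ℂ] S.hilbert ι :=
      ((PiLp.continuousLinearEquiv 2 ℂ (fun _ : ι => S.τ.GNS)).symm : (ι → S.τ.GNS) →L[ℂ] _) ∘L
        ContinuousLinearMap.single ℂ (fun _ : ι => S.τ.GNS) i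
    have hsgl : ∀ z, sgl z = PiLp.single 2 i z := fun z => rfl
    let F : S.τ.GNS × (Fin n → S.τ.GNS) → S.hilbert ι × S.hilbert ι := fun p =>
      (sgl p.1, ∑ r, matOp (m r) (sgl (p.2 r)))
    have hF : Continuous F := by fun_prop
    have h1 := map_mem_closure hF (hw.mem_closure_gradient hγ hD
      (hw.isResolution.idem χ (x i))) (t := (S.firstOrder X m).graph) (by
        rintro _ ⟨a, rfl⟩
        refine S.mem_graph_firstOrder.2 ⟨Pi.single i a, ?_, ?_⟩
        · ext j
          by_cases h : j = i
          · subst h; simp [hsgl]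
          · simp [hsgl, h]
        · refine Finset.sum_congr rfl fun r _ => ?_
          congr 1
          ext j
          by_cases h : j = i
          · subst h; simp [hsgl]
          · simp [hsgl, h])
    rw [← SetLike.mem_coe, Submodule.topologicalClosure_coe]
    convert h1 using 1
    refine Prod.ext rfl ?_
    simp only [F, map_smul, symbol, matOp_sum, matOp_smul, sum_apply,
      smul_apply]
    rfl
  have h2 := Submodule.sum_mem _ fun i (_ : i ∈ Finset.univ) => key i
  convert h2 using 1
  have h3 : diagOp ι (jointProj S.U χ) x =
      ∑ i, (PiLp.single 2 i (jointProj S.U χ (x i)) : S.hilbert ι) := by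
    ext j
    simp [Finset.sum_apply, Pi.single_apply]
  rw [h3, map_sum]
  ext <;> simp [Prod.fst_sum, Prod.snd_sum]

theorem IsWeightDecomposition.commutatorExtends (a : S.smooth E) :
    CommutatorExtends (S.symbolOp w m) (S.rep E ι a) (commutatorOp S X m a) := by
  intro x
  refine hw.isClosable_firstOrder.map_mem_graph_closure (T := S.firstOrder X m)
    hw.symbolOp_isClosed _ _ _ (fun x y hxy => LinearPMap.le_graph_of_le hw.firstOrder_le
      (rep_mem_graph_firstOrder a hxy)) ?_
  rw [hw.closure_firstOrder hγ hD]
  exact LinearPMap.mem_graph _ x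

/-- The commutator with `a` is `∑_l m'_l (∂_l a)`. Moving `m'_l` past the first order operator costs
only a sign, leaving `-m'_l` times its commutator with the smooth element `∂_l a`, which is again
bounded. -/
theorem IsWeightDecomposition.exists_anticommutatorExtends
    (h : ∀ r l, m' l * m r = -(m r * m' l)) (a : S.smooth E) :
    ∃ C', AnticommutatorExtends (S.symbolOp w m) (commutatorOp S X m' a) C' := by
  refine ⟨-∑ l, matOp (m' l) * commutatorOp S X m (S.smoothDerivation (X l) a), fun x => ?_⟩
  have h1 : ∀ l, (matOp (m' l) (S.rep E ι (S.smoothDerivation (X l) a) (x : S.hilbert ι)),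
      matOp ((-1 : ℂ) • m' l) (S.rep E ι (S.smoothDerivation (X l) a) (S.symbolOp w m x) +
        commutatorOp S X m (S.smoothDerivation (X l) a) x)) ∈ (S.symbolOp w m).graph := fun l =>
    hw.matOp_mem_graph (fun r => by rw [smul_mul_assoc, h, neg_one_smul, neg_neg])
      (hw.commutatorExtends hγ hD _ x)
  have h2 := Submodule.sum_mem _ fun l (_ : l ∈ Finset.univ) => h1 l
  convert h2 using 1
  ext : 1
  · simp [commutatorOp, Prod.fst_sum]
  · have h3 : ∀ l (v : S.hilbert ι), matOp ((-1 : ℂ) • m' l) v = -matOp (m' l) v := fun l v => by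
      rw [matOp_smul, smul_apply, neg_one_smul]
    have h4 : commutatorOp S X m' a (S.symbolOp w m x) =
        ∑ l, matOp (m' l) (S.rep E ι (S.smoothDerivation (X l) a) (S.symbolOp w m x)) := by
      rw [commutatorOp, sum_apply]
      rfl
    simp only [Prod.snd_sum, h3, map_add, neg_add, Finset.sum_add_distrib, Finset.sum_neg_distrib,
      h4, neg_apply, sum_apply]
    rw [add_comm, ← sub_eq_add_neg]
    rfl

end Core

end CStarDynamicalSystem

/-! ### Amplification of heat semigroups -/

section Amplification

variable {ι J L κ : Type*} [Fintype ι] [Fintype J] [DecidableEq ι] [DecidableEq J]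
  [NormedAddCommGroup L] [InnerProductSpace ℂ L] [CompleteSpace L]

/-- The heat trace condition passes from `L ⊗ ℂ^ι` to `L ⊗ ℂ^ι ⊗ ℂ^J`. -/
theorem HeatTraceClass.amplify_multOp {P : κ → L →L[ℂ] L} (hP : IsResolution P) {μ : κ → ℂ}
    (h : HeatTraceClass (multOp (fun χ => diagOp ι (P χ)) fun χ => μ χ • 1)) :
    HeatTraceClass (multOp (fun χ => diagOp (ι × J) (P χ)) fun χ => μ χ • 1) := by
  let slice (j : J) : PiLp 2 (fun _ : ι × J => L) →L[ℂ] PiLp 2 (fun _ : ι => L) :=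
    ((PiLp.continuousLinearEquiv 2 ℂ (fun _ : ι => L)).symm : (ι → L) →L[ℂ] _) ∘L
      (ContinuousLinearMap.pi fun i => ContinuousLinearMap.proj (i, j)) ∘L
      ((PiLp.continuousLinearEquiv 2 ℂ (fun _ : ι × J => L)) : _ →L[ℂ] (ι × J → L))
  let incl (j : J) : PiLp 2 (fun _ : ι => L) →L[ℂ] PiLp 2 (fun _ : ι × J => L) :=
    ((PiLp.continuousLinearEquiv 2 ℂ (fun _ : ι × J => L)).symm : (ι × J → L) →L[ℂ] _) ∘L
      (ContinuousLinearMap.pi fun p => if p.2 = j then ContinuousLinearMap.proj p.1 else 0) ∘L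
      ((PiLp.continuousLinearEquiv 2 ℂ (fun _ : ι => L)) : _ →L[ℂ] (ι → L))
  have hs : ∀ j x i, slice j x i = x (i, j) := fun j x i => rfl
  have hi : ∀ j x p, incl j x p = if p.2 = j then x p.1 else 0 := by
    intro j x p
    change (if p.2 = j then ContinuousLinearMap.proj (R := ℂ) (φ := fun _ : ι => L) p.1 else 0)
      (fun i => x i) = _
    split_ifs <;> rfl
  refine h.amplify slice incl (fun i j x => ?_) (fun x => ?_) fun x y => ?_
  · ext l
    rw [hs, hi]
    split_ifs <;> rfl
  · ext p
    simp [hi, hs, Finset.sum_apply]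
  · simp only [hP.amplify.mem_graph]
    constructor
    · intro H j χ
      ext i
      simpa [hs] using congrArg (fun z : PiLp 2 (fun _ : ι × J => L) => z (i, j)) (H χ)
    · intro H χ
      ext p
      simpa [hs] using congrArg (fun z : PiLp 2 (fun _ : ι => L) => z p.1) (H p.2 χ)

end Amplification

/-! ### Kähler structures from complex polarizations -/

namespace CStarDynamicalSystem

variable {E : Type*} [NormedAddCommGroup E] [NormedSpace ℝ E]
variable {G : Type*} [CommGroup G] [TopologicalSpace G] [ChartedSpace E G]
  [LieGroup 𝓘(ℝ, E) ∞ G]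
variable {A : Type*} [CStarAlgebra A] [PartialOrder A] [StarOrderedRing A]
variable {S : CStarDynamicalSystem G A}
variable {n : ℕ} {X : Fin n → GroupLieAlgebra 𝓘(ℝ, E) G} {w : (G → ℂ) → Fin n → ℝ}
variable {ι : Type*} [Fintype ι] [DecidableEq ι] {m m' : Fin n → Matrix ι ι ℂ}

theorem symbol_neg_conjTranspose (v : Fin n → ℝ) (m : Fin n → Matrix ι ι ℂ) :
    (symbol v fun r => -(m r).conjTranspose) = star (symbol v m) := by
  simp [symbol, star_sum, star_smul, Matrix.star_eq_conjTranspose]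

theorem symbol_rotate (v : Fin n → ℝ) (P : Matrix (Fin n) (Fin n) ℂ) (a : Fin n → Matrix ι ι ℂ) :
    symbol v (rotate P a) = ∑ l, (P.mulVec fun r => Complex.I * v r) l • a l :=
  sum_smul_rotate P a _

section Operators

variable (hw : S.IsWeightDecomposition X w)

include hw

theorem IsWeightDecomposition.anticommuteZero
    (h : ∀ χ, symbol (w χ) m * symbol (w χ) m' + symbol (w χ) m' * symbol (w χ) m = 0) :
    AnticommuteZero (S.symbolOp w m) (S.symbolOp w m') :=
  hw.res.anticommuteZero_multOp (S.diagOp_matOp_comm _) (S.diagOp_matOp_comm _) fun χ x => by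
    rw [← matOp_mul_apply, ← matOp_mul_apply, ← add_apply, ← matOp_add, h,
      matOp_zero]
    rfl

theorem IsWeightDecomposition.opAnti_adjoint {μ : (G → ℂ) → ℝ}
    (h : ∀ χ, symbol (w χ) m * star (symbol (w χ) m) + star (symbol (w χ) m) * symbol (w χ) m =
      (μ χ : ℂ) • 1) :
    opAnti (S.symbolOp w m) (S.symbolOp w m).adjoint =
      multOp (fun χ => diagOp ι (jointProj S.U χ)) fun χ => (μ χ : ℂ) • 1 := by
  rw [hw.adjoint_symbolOp]
  refine hw.res.opAnti_multOp_adjoint (S.diagOp_matOp_comm _) (S.diagOp_matOp_comm _)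
    (fun χ x y => ?_) fun χ x => ?_
  · rw [inner_matOp, symbol_neg_conjTranspose]
    rfl
  · rw [← matOp_mul_apply, ← matOp_mul_apply, ← add_apply, ← matOp_add,
      symbol_neg_conjTranspose, h, matOp_smul, matOp_one]
    rfl

variable {a : Fin n → Matrix ι ι ℂ} (ha : IsFermionic a)

include ha

theorem IsWeightDecomposition.squareZero_rotate (P : Matrix (Fin n) (Fin n) ℂ) :
    SquareZero (S.symbolOp w (rotate P a)) :=
  hw.res.squareZero_multOp fun χ x => by
    rw [← matOp_mul_apply, symbol, ha.sum_smul_rotate_sq, matOp_zero]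
    rfl

theorem IsWeightDecomposition.anticommuteZero_rotate_adjoint {P Q : Matrix (Fin n) (Fin n) ℂ}
    (h : Q.conjTranspose * P = 0) :
    AnticommuteZero (S.symbolOp w (rotate P a)) (S.symbolOp w (rotate Q a)).adjoint := by
  rw [hw.adjoint_symbolOp]
  refine hw.anticommuteZero fun χ => ?_
  rw [symbol_neg_conjTranspose, symbol, symbol, ha.sum_smul_rotate_car, h]
  simp

/-- The vector `c = i w` is purely imaginary, so `c̄ = -c` and the Hermitian form in the
anticommutator becomes minus the bilinear form of the hypothesis. Hence `∂∂* + ∂*∂` is `q |w|²`,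
which depends on `P` only through `q`. -/
theorem IsWeightDecomposition.opAnti_rotate_adjoint {P : Matrix (Fin n) (Fin n) ℂ} {q : ℝ}
    (h : ∀ c : Fin n → ℂ, c ⬝ᵥ (P.conjTranspose * P).mulVec c = q * (c ⬝ᵥ c)) :
    opAnti (S.symbolOp w (rotate P a)) (S.symbolOp w (rotate P a)).adjoint =
      multOp (fun χ => diagOp ι (jointProj S.U χ))
        fun χ => ((q * ∑ r, w χ r ^ 2 : ℝ) : ℂ) • 1 := by
  refine hw.opAnti_adjoint fun χ => ?_
  rw [symbol, ha.sum_smul_rotate_car]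
  congr 1
  have h1 : star (fun r => Complex.I * (w χ r : ℂ)) = (-1 : ℂ) • fun r => Complex.I * (w χ r : ℂ) := by
    funext r
    simp
  rw [h1, smul_dotProduct, h]
  simp only [dotProduct, smul_eq_mul]
  push_cast
  rw [mul_left_comm, Finset.mul_sum]
  congr 1
  refine Finset.sum_congr rfl fun r _ => ?_
  linear_combination -(w χ r : ℂ) ^ 2 * Complex.I_sq

end Operators

section Kahler

variable {ν : Type*} [Fintype ν] [DecidableEq ν] [Nonempty ν] {γ : Fin n → Matrix ν ν ℂ}
  {σ : Matrix ν ν ℂ} {s : ℂ}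

variable (hw : S.IsWeightDecomposition X w) (hγ : IsGradedClifford γ σ)
  (hD : IsN1SpectralData (S.rep E ν) (S.dirac X γ) (matOp σ))

include hw hγ hD

theorem IsWeightDecomposition.opMul_dirac :
    opMul (S.dirac X γ) (S.dirac X γ) = multOp (fun χ => diagOp ν (jointProj S.U χ))
      fun χ => ((∑ r, w χ r ^ 2 : ℝ) : ℂ) • 1 := by
  rw [hw.dirac_eq hγ hD.selfAdjoint]
  refine hw.res.opMul_multOp_self (S.diagOp_matOp_comm _) (hw.inner_symbol hγ) fun χ x => ?_
  rw [← matOp_mul_apply, hw.symbol_mul_self hγ, matOp_smul, matOp_one]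
  rfl

theorem IsWeightDecomposition.isN11 (hs : s = 1 ∨ s = -1) :
    IsN11SpectralData (S.rep E (ν × ν)) (S.symbolOp w (IsGradedClifford.fermion γ σ s))
      (matOp (σ ⊗ₖ σ)) (matOp ((1 : Matrix ν ν ℂ) ⊗ₖ σ)) := by
  have ha := hγ.isFermionic hs
  have h1 : rotate 1 (IsGradedClifford.fermion γ σ s) = IsGradedClifford.fermion γ σ s :=
    funext fun r => rotate_one _ r
  have hh := hγ.hodge_mul_self
  refine
    { separable := ?_
      faithful := rep_injective
      dense := hw.symbolOp_dense
      closed := hw.symbolOp_isClosed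
      sq_zero := by rw [← h1]; exact hw.squareZero_rotate ha 1
      commutator := fun b => ⟨_, hw.commutatorExtends hγ hD.selfAdjoint b⟩
      traceClass := ?_
      grading := ⟨isSelfAdjoint_matOp hγ.isSelfAdjoint_grading, by
        rw [← matOp_mul, hγ.grading_mul_self, matOp_one]⟩
      grading_comm := commute_matOp_rep _
      grading_anti := hw.anticommutatorExtends hγ.grading_fermion
      hodge_unitary := ?_
      hodge_intertwines := ⟨-1, by simp, hw.intertwines hh (hγ.hodge_fermion hs)⟩
      hodge_comm := commute_matOp_rep _ }
  · have := hD.separable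
    obtain ⟨i⟩ := ‹Nonempty ν›
    have hL : TopologicalSpace.SeparableSpace S.τ.GNS := by
      refine (Function.Surjective.denseRange (f := fun x : S.hilbert ν => x i) fun z =>
        ⟨PiLp.single 2 i z, by simp⟩).separableSpace (PiLp.continuous_apply 2 _ i)
    exact (Function.Surjective.denseRange
      (PiLp.continuousLinearEquiv 2 ℂ (fun _ : ν × ν => S.τ.GNS)).symm.surjective).separableSpace
      (PiLp.continuousLinearEquiv 2 ℂ (fun _ : ν × ν => S.τ.GNS)).symm.continuous
  -- With `P = 1` and `q = 1` the Laplacian of `d` is multiplication by `|w|²`, that is `D²`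
  -- amplified by the second factor `ℂ^ν`.
  · have h2 := hD.traceClass
    rw [hw.opMul_dirac hγ hD] at h2
    have h3 := h2.amplify_multOp (J := ν) hw.isResolution
    have h4 := hw.opAnti_rotate_adjoint ha (P := 1) (q := 1) (by simp)
    rw [h1] at h4
    rw [h4]
    simpa only [one_mul] using h3
  · have hsa : IsSelfAdjoint (matOp ((1 : Matrix ν ν ℂ) ⊗ₖ σ) : S.hilbert (ν × ν) →L[ℂ] _) :=
      isSelfAdjoint_matOp hγ.isSelfAdjoint_hodge
    rw [Unitary.mem_iff, hsa.star_eq, ← matOp_mul, hh, matOp_one]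
    exact ⟨rfl, rfl⟩

variable {P : Matrix (Fin n) (Fin n) ℂ} (hP : IsComplexPolarization P) (hs : s = 1 ∨ s = -1)

/-- The Kähler structure attached to a complex polarization. -/
def IsWeightDecomposition.kahler : KahlerSpectralData (S.rep E (ν × ν)) :=
  have ha := hγ.isFermionic hs
  have hP' := hP.transpose_transpose
  -- Both `P` and `Pᵀ` yield the constant `1/2`, whence the equality of the two Laplacians.
  have hq : ∀ {P : Matrix (Fin n) (Fin n) ℂ}, IsComplexPolarization P → ∀ c : Fin n → ℂ,
      c ⬝ᵥ (P.conjTranspose * P).mulVec c = ((1 / 2 : ℝ) : ℂ) * (c ⬝ᵥ c) := fun hP c => by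
    rw [hP.selfAdjoint, hP.idem, hP.dotProduct_mulVec]
    push_cast
    rfl
  { del := S.symbolOp w (rotate P (IsGradedClifford.fermion γ σ s))
    delbar := S.symbolOp w (rotate P.transpose (IsGradedClifford.fermion γ σ s))
    T := matOp (secondQuant P (IsGradedClifford.fermion γ σ s))
    Tbar := matOp (secondQuant P.transpose (IsGradedClifford.fermion γ σ s))
    grading := matOp (σ ⊗ₖ σ)
    hodge := matOp ((1 : Matrix ν ν ℂ) ⊗ₖ σ)
    isN11 := by
      rw [hw.closure_add]
      simp only [← rotate_add, hP.add_transpose, rotate_one]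
      exact hw.isN11 hγ hD hs
    T_selfAdjoint := isSelfAdjoint_matOp ((star_secondQuant P).trans (by rw [hP.selfAdjoint]))
    Tbar_selfAdjoint := isSelfAdjoint_matOp
      ((star_secondQuant P.transpose).trans (by rw [hP'.selfAdjoint]))
    del_dense := hw.symbolOp_dense
    delbar_dense := hw.symbolOp_dense
    del_closed := hw.symbolOp_isClosed
    delbar_closed := hw.symbolOp_isClosed
    del_sq := hw.squareZero_rotate ha P
    delbar_sq := hw.squareZero_rotate ha P.transpose
    del_delbar := hw.anticommuteZero fun χ => ha.sum_smul_rotate_anti _ _ _ _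
    T_Tbar := (ha.secondQuant_commute hP.mul_transpose hP.transpose_mul).map
      (matHom (ν × ν) S.τ.GNS)
    T_del := hw.commutatorEqSmul fun r => by
      rw [ha.secondQuant_commutator_rotate, hP.idem, one_smul]
    T_delbar := hw.commutatorEqSmul fun r => by
      rw [ha.secondQuant_commutator_rotate, hP.mul_transpose, rotate_zero, zero_smul]
    Tbar_del := hw.commutatorEqSmul fun r => by
      rw [ha.secondQuant_commutator_rotate, hP.transpose_mul, rotate_zero, zero_smul]
    Tbar_delbar := hw.commutatorEqSmul fun r => by
      rw [ha.secondQuant_commutator_rotate, hP'.idem, one_smul]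
    T_comm := commute_matOp_rep _
    Tbar_comm := commute_matOp_rep _
    del_commutator := fun b => ⟨_, hw.commutatorExtends hγ hD.selfAdjoint b⟩
    delbar_commutator := fun b => ⟨_, hw.commutatorExtends hγ hD.selfAdjoint b,
      hw.exists_anticommutatorExtends hγ hD.selfAdjoint
        (fun r l => eq_neg_of_add_eq_zero_left (ha.rotate_anti _ _ l r)) b⟩
    grading_del := hw.anticommutatorExtends (rotate_anti_of_anti hγ.grading_fermion P)
    grading_delbar := hw.anticommutatorExtends
      (rotate_anti_of_anti hγ.grading_fermion P.transpose)
    grading_T := (secondQuant_commute_of_anti hγ.grading_fermion hγ.isSelfAdjoint_grading P).map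
      (matHom (ν × ν) S.τ.GNS)
    grading_Tbar := (secondQuant_commute_of_anti hγ.grading_fermion hγ.isSelfAdjoint_grading
      P.transpose).map (matHom (ν × ν) S.τ.GNS)
    hodge_intertwines := ⟨-1, by simp,
      hw.intertwines hγ.hodge_mul_self (rotate_intertwine (hγ.hodge_fermion hs) hP.selfAdjoint),
      hw.intertwines hγ.hodge_mul_self (rotate_intertwine (hγ.hodge_fermion hs) hP'.selfAdjoint)⟩
    kahler_del := hw.anticommuteZero_rotate_adjoint ha (by
      rw [hP'.selfAdjoint, hP.transpose_mul])
    kahler_delbar := hw.anticommuteZero_rotate_adjoint ha (by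
      rw [hP.selfAdjoint, hP.mul_transpose])
    kahler_laplacian := by
      rw [hw.opAnti_rotate_adjoint ha (hq hP), hw.opAnti_rotate_adjoint ha (hq hP')] }

theorem IsWeightDecomposition.kahler_d :
    (hw.kahler hγ hD hP hs).d = S.differential X γ σ s := by
  have h1 : (hw.kahler hγ hD hP hs).d = S.symbolOp w (IsGradedClifford.fermion γ σ s) := by
    refine hw.closure_add.trans ?_
    simp only [← rotate_add, hP.add_transpose, rotate_one]
  rw [h1, ← hw.closure_firstOrder hγ hD.selfAdjoint]
  rfl

variable {Q : Matrix (Fin n) (Fin n) ℂ} (hQ : IsComplexPolarization Q)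

/-- `T` determines `P` through the commutators `[T, a_r] = ∑_l P_{lr} a_l` and the linear
independence of the `a_l`. No weight is involved, so this covers trivial actions. -/
theorem IsWeightDecomposition.eq_of_kahler_eq [Nontrivial A]
    (h : hw.kahler hγ hD hP hs = hw.kahler hγ hD hQ hs) : P = Q := by
  have ha := hγ.isFermionic hs
  have : Nontrivial S.τ.GNS := S.toL2_injective.nontrivial
  have h1 : secondQuant P (IsGradedClifford.fermion γ σ s) =
      secondQuant Q (IsGradedClifford.fermion γ σ s) :=
    matOp_injective (congrArg KahlerSpectralData.T h)
  refine ha.rotate_injective fun r => ?_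
  rw [← ha.secondQuant_commutator, h1, ha.secondQuant_commutator]

/-- On a nonzero `χ`-eigenvector, tensored with the coordinate vectors, `∂` exhibits its symbol `∑_l
(P (i w))_l a_l`, whose coefficients are recovered by linear independence. -/
theorem IsWeightDecomposition.mulVec_eq_of_kahler_del_eq {χ : G → ℂ} {z : S.τ.GNS} (hz : z ≠ 0)
    (hz' : jointProj S.U χ z = z) (h : (hw.kahler hγ hD hP hs).del = (hw.kahler hγ hD hQ hs).del) :
    P.mulVec (fun r => (w χ r : ℂ)) = Q.mulVec fun r => (w χ r : ℂ) := by
  have ha := hγ.isFermionic hs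
  have h1 : symbol (w χ) (rotate P (IsGradedClifford.fermion γ σ s)) =
      symbol (w χ) (rotate Q (IsGradedClifford.fermion γ σ s)) := by
    refine eq_of_matOp_single_eq hz fun j => ?_
    have e : diagOp (ν × ν) (jointProj S.U χ) (PiLp.single 2 j z : S.hilbert (ν × ν)) =
        PiLp.single 2 j z := by
      ext l
      by_cases h : l = j
      · subst h; simp [hz']
      · simp [h]
    have h2 : ∀ {P : Matrix (Fin n) (Fin n) ℂ} (hP : IsComplexPolarization P),
        (PiLp.single 2 j z, matOp (symbol (w χ) (rotate P (IsGradedClifford.fermion γ σ s)))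
          (PiLp.single 2 j z : S.hilbert (ν × ν))) ∈ (hw.kahler hγ hD hP hs).del.graph := by
      intro P hP
      have := hw.res.component_mem_graph
        (S.diagOp_matOp_comm fun χ => symbol (w χ) (rotate P (IsGradedClifford.fermion γ σ s))) χ
        (PiLp.single 2 j z : S.hilbert (ν × ν))
      rwa [e] at this
    have h3 := h2 hP
    rw [h] at h3
    exact LinearPMap.mem_graph_snd_inj _ h3 (h2 hQ) rfl
  rw [symbol_rotate, symbol_rotate] at h1
  have h2 := ha.eq_of_sum_smul_eq h1
  have h3 : (fun r => Complex.I * (w χ r : ℂ)) = Complex.I • fun r => (w χ r : ℂ) := rfl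
  rw [h3, Matrix.mulVec_smul, Matrix.mulVec_smul] at h2
  exact smul_right_injective _ Complex.I_ne_zero h2

end Kahler

theorem exists_isWeightDecomposition {ν : Type*} [Fintype ν] [DecidableEq ν] [Nonempty ν]
    {γ : Fin n → Matrix ν ν ℂ} {σ : Matrix ν ν ℂ}
    (hD : IsN1SpectralData (S.rep E ν) (S.dirac X γ) (matOp σ)) :
    ∃ w, S.IsWeightDecomposition X w := by
  have hQ := isResolution_jointProj S.inner_U fun y hy =>
    S.eq_zero_of_forall_eigenvector hD.selfAdjoint hD.traceClass hy
  choose w hw using S.exists_weight hQ X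
  exact ⟨w, hQ, hw⟩

end CStarDynamicalSystem

/-- In real dimension `0` or `2` a single structure suffices, since the product is `1`; from
dimension `4` on the complex structures form continuous families. -/
theorem prod_odd_le_one_or (k : ℕ) :
    ∏ j ∈ (Finset.Icc 1 (2 * k)).filter Odd, (2 * k - j) ≤ 1 ∨ 2 ≤ k := by
  rw [prod_odd_eq_doubleFactorial]
  rcases Nat.lt_or_ge k 2 with h | h
  · left
    interval_cases k <;> simp
  · exact Or.inr h

theorem mainTheorem1
    {E : Type*} [NormedAddCommGroup E] [NormedSpace ℝ E] [FiniteDimensional ℝ E]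
    {G : Type*} [CommGroup G] [TopologicalSpace G] [ChartedSpace E G] [LieGroup 𝓘(ℝ, E) ∞ G]
    [ConnectedSpace G]
    {A : Type*} [CStarAlgebra A] [PartialOrder A] [StarOrderedRing A] [Nontrivial A]
    (k : ℕ) (hdim : Module.finrank ℝ E = 2 * k)
    (S : CStarDynamicalSystem G A)
    (X : Module.Basis (Fin (2 * k)) ℝ (GroupLieAlgebra 𝓘(ℝ, E) G))
    (γ : Fin (2 * k) → Matrix (Fin (2 ^ k)) (Fin (2 ^ k)) ℂ)
    (σ : Matrix (Fin (2 ^ k)) (Fin (2 ^ k)) ℂ)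
    (hγ : IsGradedClifford γ σ)
    (hD : IsN1SpectralData (S.rep E (Fin (2 ^ k))) (S.dirac X γ) (matOp σ))
    (s : ℂ) (hs : s = 1 ∨ s = -1) :
    (∃ K : Fin (∏ j ∈ (Finset.Icc 1 (2 * k)).filter Odd, (2 * k - j)) →
        KahlerSpectralData (S.rep E (Fin (2 ^ k) × Fin (2 ^ k))),
      (∀ m, (K m).d = S.differential X γ σ s ∧ (K m).grading = matOp (σ ⊗ₖ σ) ∧
        (K m).hodge = matOp ((1 : Matrix (Fin (2 ^ k)) (Fin (2 ^ k)) ℂ) ⊗ₖ σ)) ∧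
      Function.Injective K ∧
      ((∃ g a, S.α g a ≠ a) → Function.Injective fun m => (K m).del)) ∧
    Nat.card {M : (⊤ : SimpleGraph (Fin (2 * k))).Subgraph // M.IsPerfectMatching} =
      ∏ j ∈ (Finset.Icc 1 (2 * k)).filter Odd, (2 * k - j) := by
  refine ⟨?_, card_perfectMatching k⟩
  have : Nonempty (Fin (2 ^ k)) := ⟨⟨0, by positivity⟩⟩
  obtain ⟨w, hw⟩ := CStarDynamicalSystem.exists_isWeightDecomposition hD
  -- The polarizations are separated on one vector `v`: a nonzero weight that occurs if the action
  -- is nontrivial, and otherwise an arbitrary vector, here constantly `1`, which still makes the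
  -- `P` distinct.
  obtain ⟨v, hv0, hv⟩ : ∃ v : Fin (2 * k) → ℝ, (0 < k → v ≠ 0) ∧ ((∃ g a, S.α g a ≠ a) →
      ∃ χ, w χ = v ∧ ∃ z : S.τ.GNS, z ≠ 0 ∧ jointProj S.U χ z = z) := by
    by_cases h : ∃ g a, S.α g a ≠ a
    · obtain ⟨χ, h1, h2⟩ := hw.exists_ne_zero (S.denseRange_toL2_smooth hD.selfAdjoint) h
      exact ⟨w χ, fun _ => h1, fun _ => ⟨χ, rfl, h2⟩⟩
    · exact ⟨fun _ => 1, fun hk h0 => one_ne_zero (congrFun h0 ⟨0, by omega⟩),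
        fun h' => absurd h' h⟩
  obtain ⟨P, hP, hinj⟩ := exists_polarization_family k _ (prod_odd_le_one_or k) v hv0
  refine ⟨fun i => hw.kahler hγ hD (hP i) hs, fun i => ⟨hw.kahler_d hγ hD (hP i) hs, rfl, rfl⟩,
    fun i j h => ?_, fun hα i j h => ?_⟩
  · exact hinj (congrArg (fun P => P.mulVec fun l => (v l : ℂ)) (hw.eq_of_kahler_eq hγ hD (hP i) hs (hP j) h))
  · obtain ⟨χ, rfl, z, hz, hz'⟩ := hv hα
    exact hinj (hw.mulVec_eq_of_kahler_del_eq hγ hD (hP i) hs (hP j) hz hz' h)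

end
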